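/- **Corollary 3.4.** Let $L=(L_t)_{t\in\mathbb R}$ be a two-sided second-order zero-mean Lévy process with $EL_1^2=\sigma^2>0$. Let $0\le q<p$ be integers, $a(z)=z^p+a_1z^{p-1}+\cdots+a_p$ and $b(z)=b_0+b_1z+\cdots+b_qz^q$ with $b_q=1$ be real polynomials without common zeroes, all zeroes $\lambda_1,\dots,\lambda_p$ of $a$ (with multiplicity) lying in the open left half plane; put $b_j=0$ for $q<j<p$. Let $Y=(Y_t)_{t\in\mathbb R}$ be the CARMA$(p,q)$ process driven by $L$, i.e. a strictly stationary process $Y_t=\mathbf b^{T}\mathbf X_t$, where $\mathbf b=(b_0,\dots,b_{p-1})^T$ and $d\mathbf X_t=A\mathbf X_t\,dt+\mathbf e_p\,dL_t$, with $\mathbf e_p=(0,\dots,0,1)^T$ and $A$ the $p\times p$ matrix with ones on the superdiagonal, last row $(-a_p,\dots,-a_1)$ and zeroes elsewhere ($A=-a_1$ if $p=1$). For $\Delta>0$ let $B$ be the backward shift on sequences, $Y^\Delta_n=Y_{n\Delta}$, $\phi(B)=\prod_{j=1}^p(1-e^{\lambda_j\Delta}B)$ and $X_n=X^\Delta_n=\phi(B)Y^\Delta_n$,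 $n\in\mathbb Z$. Then for every $\Delta>0$ there is a representation $X_n=\theta(B)Z_n$, $n\in\mathbb Z$ (almost surely), where $Z=Z^\Delta$ is an uncorrelated sequence of zero-mean random variables with constant variance $\tau^2=\tau^2_\Delta$, and $\theta(z)=\theta^{\Delta}(z)=1+\theta^\Delta_1z+\cdots+\theta^\Delta_{p-1}z^{p-1}$ is a real polynomial without zeroes in $\{|z|<1\}$. For any choice of such representations, $\Delta>0$, the following holds as $\Delta\downarrow0$. Here "$X_n$ has the asymptotic form $\theta_0(B)Z_n$ with $\tau^2\sim v_0(\Delta)$" means that every coefficient of $\theta^\Delta$ converges to the corresponding coefficient of $\theta_0$, that $\tau^2_\Delta/v_0(\Delta)\to1$, and that $E|X^\Delta_n-\theta_0(B)Z^\Delta_n|^2/\tau^2_\Delta\to0$ for every $n\in\mathbb Z$. (a) If $p-q=1$, then $X_n$ has the asymptotic form $(1-B)^qZ_n$ with $\tau^2\sim\sigma^2\Delta$. (b) If $p-q=2$, then $X_n$ has the asymptotic form $(1+\vartheta B)(1-B)^qZ_n$ with $\vartheta=2-\sqrt3$ and $\tau^2\sim\sigma^2\Delta^3(2+\sqrt3)/6$;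 moreover $1+\vartheta z\ne0$ for $|z|\le1$. (c) If $p-q=3$, then $X_n$ has the asymptotic form $(1+\vartheta_1B+\vartheta_2B^2)(1-B)^qZ_n$ with $$\vartheta_2=2(8+\sqrt{30})-\sqrt{375+64\sqrt{30}},\qquad \vartheta_1=\frac{26\,\vartheta_2}{1+\vartheta_2}=13-\sqrt{135+4\sqrt{30}},$$ $$\tau^2\sim\bigl(2(8+\sqrt{30})+\sqrt{375+64\sqrt{30}}\bigr)\Delta^5\sigma^2/120;$$ moreover $1+\vartheta_1z+\vartheta_2z^2\ne0$ for $|z|\le1$. -/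

import Mathlib

open MeasureTheory ProbabilityTheory Filter Topology Polynomial

/-- `L = (L_t)_{t ∈ ℝ}` is a (two-sided) second-order zero-mean Lévy process with
`E L_1 ^ 2 = σ ^ 2`. -/
structure IsSecondOrderLevy {Ω : Type*} [MeasurableSpace Ω] (μ : Measure Ω) (σ : ℝ)
    (L : ℝ → Ω → ℝ) : Prop where
  measurable : ∀ t, Measurable (L t)
  zero : ∀ᵐ ω ∂μ, L 0 ω = 0
  indep_increments : HasIndepIncrements L μ
  stationary_increments : ∀ s t h : ℝ,
    IdentDistrib (fun ω => L (t + h) ω - L (s + h) ω) (fun ω => L t ω - L s ω) μ μ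
  cadlag : ∀ᵐ ω ∂μ, ∀ t : ℝ,
    ContinuousWithinAt (fun s => L s ω) (Set.Ici t) t ∧
      ∃ l : ℝ, Tendsto (fun s => L s ω) (𝓝[<] t) (𝓝 l)
  memLp : ∀ t, MemLp (L t) 2 μ
  mean_zero : ∀ t, ∫ ω, L t ω ∂μ = 0
  second_moment : ∫ ω, L 1 ω ^ 2 ∂μ = σ ^ 2

/-- Strict stationarity: the finite-dimensional distributions are shift invariant. -/
def IsStrictlyStationary {Ω : Type*} [MeasurableSpace Ω] (μ : Measure Ω)
    (Y : ℝ → Ω → ℝ) : Prop :=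
  ∀ (n : ℕ) (t : Fin n → ℝ) (h : ℝ),
    IdentDistrib (fun ω i => Y (t i + h) ω) (fun ω i => Y (t i) ω) μ μ

/-- The state matrix `A` of a CARMA process of autoregressive order `p`: ones on the superdiagonal
and last row `(-a_p, …, -a_1)`, where `a(z) = z ^ p + a_1 z ^ (p - 1) + ⋯ + a_p`. -/
noncomputable def carmaMatrix (p : ℕ) (a : ℝ[X]) : Matrix (Fin p) (Fin p) ℝ :=
  fun i j =>
    if (i : ℕ) + 1 = p then -a.coeff j
    else if (j : ℕ) = (i : ℕ) + 1 then 1 else 0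

/-- The last standard basis vector `e_p`. -/
def lastVec (p : ℕ) : Fin p → ℝ := fun i => if (i : ℕ) + 1 = p then 1 else 0

/-- `X` solves the state equation `dX_t = A X_t dt + e_p dL_t`, i.e. almost surely, for all
`s` and `t`, `X_t - X_s = ∫_s^t A X_u du + (L_t - L_s) e_p` (written in coordinates). -/
def SolvesStateEquation {Ω : Type*} [MeasurableSpace Ω] (μ : Measure Ω) (p : ℕ) (a : ℝ[X])
    (L : ℝ → Ω → ℝ) (X : ℝ → Ω → Fin p → ℝ) : Prop :=
  ∀ᵐ ω ∂μ, ∀ s t : ℝ,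
    (∀ i, IntervalIntegrable (fun u => X u ω i) volume s t) ∧
    ∀ i, X t ω i - X s ω i =
      (∫ u in s..t, ((carmaMatrix p a).mulVec (X u ω)) i) + (L t ω - L s ω) * lastVec p i

/-- `Y` is a CARMA process of autoregressive order `p` with polynomials `a`, `b`, driven by `L`:
a strictly stationary process of the form `Y_t = bᵀ X_t` with `dX_t = A X_t dt + e_p dL_t`. -/
def IsCARMA {Ω : Type*} [MeasurableSpace Ω] (μ : Measure Ω) (p : ℕ) (a b : ℝ[X])
    (L Y : ℝ → Ω → ℝ) : Prop :=
  IsStrictlyStationary μ Y ∧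
  ∃ X : ℝ → Ω → Fin p → ℝ,
    (∀ t, AEMeasurable (X t) μ) ∧
    SolvesStateEquation μ p a L X ∧
    ∀ t, ∀ᵐ ω ∂μ, Y t ω = ∑ i : Fin p, b.coeff i * X t ω i

/-- `P(B) W`, where `B` is the backward shift: `(P(B) W)_n = ∑_j P_j W_{n-j}`. -/
noncomputable def shiftFilter {Ω R : Type*} [CommRing R] (P : R[X]) (W : ℤ → Ω → R) :
    ℤ → Ω → R :=
  fun n ω => P.sum fun j c => c * W (n - j) ω

/-- The filter polynomial `φ(z) = ∏_j (1 - e ^ (λ_j Δ) z)`, the product being over the complex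
zeroes `λ_j` of `a`, with multiplicity. -/
noncomputable def arFilter (a : ℝ[X]) (Δ : ℝ) : ℂ[X] :=
  ((a.aroots ℂ).map fun l => 1 - C (Complex.exp (l * (Δ : ℂ))) * X).prod

/-- The filtered sampled sequence `φ(B) Y^Δ_n`, `Y^Δ_n = Y_{nΔ}` (as complex numbers; it is in
fact real since the zeroes of `a` come in conjugate pairs). -/
noncomputable def filteredSample {Ω : Type*} (a : ℝ[X]) (Y : ℝ → Ω → ℝ) (Δ : ℝ) :
    ℤ → Ω → ℂ :=
  shiftFilter (arFilter a Δ) fun n ω => (Y ((n : ℝ) * Δ) ω : ℂ)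

/-- Uncorrelated sequence of zero-mean random variables with constant variance `v`. -/
structure IsWhiteNoise {Ω : Type*} [MeasurableSpace Ω] (μ : Measure Ω) (v : ℝ)
    (Z : ℤ → Ω → ℝ) : Prop where
  memLp : ∀ n, MemLp (Z n) 2 μ
  mean_zero : ∀ n, ∫ ω, Z n ω ∂μ = 0
  variance_eq : ∀ n, Var[Z n; μ] = v
  uncorrelated : ∀ m n, m ≠ n → cov[Z m, Z n; μ] = 0

/-- `W_n = θ(B) Z_n` for all `n` (almost surely), where `θ(z) = 1 + θ_1 z + ⋯ + θ_m z ^ m` has no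
zeroes in the open unit disc and `Z` is white noise with variance `v`. -/
structure IsMARepresentation {Ω : Type*} [MeasurableSpace Ω] (μ : Measure Ω) (m : ℕ)
    (W : ℤ → Ω → ℂ) (θ : ℝ[X]) (v : ℝ) (Z : ℤ → Ω → ℝ) : Prop where
  coeff_zero : θ.coeff 0 = 1
  natDegree_le : θ.natDegree ≤ m
  no_zeroes : ∀ z : ℂ, ‖z‖ < 1 → aeval z θ ≠ 0
  whiteNoise : IsWhiteNoise μ v Z
  eq : ∀ n, ∀ᵐ ω ∂μ, W n ω = ((shiftFilter θ Z n ω : ℝ) : ℂ)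

/-- The moving averages `W^Δ_n = θ^Δ(B) Z^Δ_n`, `Var (Z^Δ_n) = v^Δ`, have for `Δ ↓ 0` the asymptotic
form `θ₀(B) Z_n` with white noise variance `v₀(Δ)`: the coefficients of `θ^Δ` converge to those of
`θ₀`, the ratio `v^Δ / v₀(Δ)` tends to one, and `W^Δ_n - θ₀(B) Z^Δ_n` is asymptotically negligible
in mean square compared with the white noise. -/
def HasAsymptoticForm {Ω : Type*} [MeasurableSpace Ω] (μ : Measure Ω)
    (W : ℝ → ℤ → Ω → ℂ) (θ : ℝ → ℝ[X]) (v : ℝ → ℝ) (Z : ℝ → ℤ → Ω → ℝ)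
    (θ₀ : ℝ[X]) (v₀ : ℝ → ℝ) : Prop :=
  (∀ k, Tendsto (fun Δ => (θ Δ).coeff k) (𝓝[>] 0) (𝓝 (θ₀.coeff k))) ∧
  Tendsto (fun Δ => v Δ / v₀ Δ) (𝓝[>] 0) (𝓝 1) ∧
  ∀ n, Tendsto
    (fun Δ => (∫ ω, ‖W Δ n ω - ((shiftFilter θ₀ (Z Δ) n ω : ℝ) : ℂ)‖ ^ 2 ∂μ) / v Δ)
    (𝓝[>] 0) (𝓝 0)

/-!
The filter `φ(B)` removes the autoregressive part of the sampled process. By the Cayley-Hamilton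
identity `a(A) = 0`, the polynomial with zeroes `e ^ (λ_j Δ)` annihilates `e ^ (A Δ)`
(`sum_arFilter_smul_flow`), so the state at time `(n - p) Δ` drops out of `φ(B) Y^Δ_n`, and what
is left is the sum over `k < p` of integrals of deterministic kernels `g_k`, which depend on `Δ`,
with respect to `L` over the disjoint intervals `((n - k - 1) Δ, (n - k) Δ]`
(`IsCARMA.filteredSample_eq`). The kernels are smooth, so these integrals can be defined pathwise by
partial integration (`variation_of_constants`). They are limits of Riemann-Stieltjes sums both
pathwise (`tendsto_dyadicSum`) and in `L²`, where the orthogonality of the increments of `L` gives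
an isometry (`HasOrthogonalIncrements.inner_limit`). Hence the covariances of the filtered sample
are sums of `σ² ∫ g_i g_j` over pairs `i`, `j` of fixed difference, and they vanish from lag `p` on
(`IsCARMA.exists_L2`).

Existence of the representation `θ(B) Z` is the Wold decomposition of a sequence with finite memory
(`exists_movingAverage`). A zero of `θ` in the open unit disc would keep the polynomials `f θ`,
`f ∈ ℝ[X]`, away from `1` in the norm given by the square sum of the coefficients, whereas the
innovation `Z_0` is a limit of linear combinations of present and past values of the sequence.

For the asymptotics, put `r = p - q - 1`. The kernel `g_k`, rescaled by `Δ ^ r`, converges to the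
coefficient of `z ^ k` in `(1 - z) ^ p ∑_m (m + x) ^ r / r! z ^ m = (1 - z) ^ q N_x(z)`, where the
coefficients of `N_x` are the pieces of a B-spline (`tendsto_kernelGram`, `coeff_mul_one_sub_pow`).
Therefore `v^Δ |θ^Δ(z)|² / (σ² Δ ^ (2 r + 1))` converges to `|1 - z| ^ (2 q) ∫_0^1 |N_x(z)|² dx`
on the unit circle. The spectral factorization with a factor free of zeroes in the open unit disc is
unique (`spectral_factorization_unique`), and the polynomials `θ^Δ` have bounded coefficients; by
compactness, convergence of the spectral densities forces convergence of `θ^Δ` and of the rescaled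
`v^Δ` (`tendsto_of_tendsto_spectral`). For `p - q = 1, 2, 3` the density `∫_0^1 |N_x(z)|² dx` is
`1`, `2/3 + (z + z⁻¹)/6` and `11/20 + 13/60 (z + z⁻¹) + (z² + z⁻²)/120`, with explicit
factorizations.
-/

/-! ### Dyadic Riemann-Stieltjes sums -/

/-- The `i`-th point of the partition of `[s, t]` into `2 ^ n` intervals of equal length. -/
noncomputable def dyadicPoint (s t : ℝ) (n i : ℕ) : ℝ := s + i * ((t - s) / 2 ^ n)

/-- The left-endpoint Riemann-Stieltjes sum of `∫_s^t f dx` along the dyadic partition. -/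
noncomputable def dyadicSum {E : Type*} [AddCommGroup E] [Module ℝ E] (f : ℝ → ℝ) (x : ℝ → E)
    (s t : ℝ) (n : ℕ) : E :=
  ∑ i ∈ Finset.range (2 ^ n),
    f (dyadicPoint s t n i) • (x (dyadicPoint s t n (i + 1)) - x (dyadicPoint s t n i))

lemma dyadicPoint_zero (s t : ℝ) (n : ℕ) : dyadicPoint s t n 0 = s := by simp [dyadicPoint]

lemma dyadicPoint_last (s t : ℝ) (n : ℕ) : dyadicPoint s t n (2 ^ n) = t := by
  simp only [dyadicPoint]; push_cast; field_simp; ring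

lemma dyadicPoint_mono {s t : ℝ} (h : s ≤ t) (n : ℕ) : Monotone (dyadicPoint s t n) := by
  intro i j hij
  have : (0 : ℝ) ≤ (t - s) / 2 ^ n := div_nonneg (by linarith) (by positivity)
  have h2 : (i : ℝ) ≤ j := by exact_mod_cast hij
  simp only [dyadicPoint]
  nlinarith [mul_le_mul_of_nonneg_right h2 this]

lemma dyadicPoint_mem {s t : ℝ} (h : s ≤ t) {n i : ℕ} (hi : i ≤ 2 ^ n) :
    dyadicPoint s t n i ∈ Set.Icc s t := by
  constructor
  · simpa [dyadicPoint_zero] using dyadicPoint_mono h n (Nat.zero_le i)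
  · simpa [dyadicPoint_last] using dyadicPoint_mono h n hi

lemma dyadicPoint_succ_sub (s t : ℝ) (n i : ℕ) :
    dyadicPoint s t n (i + 1) - dyadicPoint s t n i = (t - s) / 2 ^ n := by
  simp only [dyadicPoint]; push_cast; ring

lemma dyadicPoint_succ_two_mul (s t : ℝ) (n i : ℕ) :
    dyadicPoint s t (n + 1) (2 * i) = dyadicPoint s t n i := by
  simp only [dyadicPoint]; push_cast; field_simp; ring

/-- A function that is right-continuous with left limits is bounded on compact intervals. -/
lemma exists_bound_of_cadlag {x : ℝ → ℝ}
    (hx : ∀ t, ContinuousWithinAt x (Set.Ici t) t ∧ ∃ l, Tendsto x (𝓝[<] t) (𝓝 l)) (s t : ℝ) :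
    ∃ C, ∀ u ∈ Set.Icc s t, |x u| ≤ C := by
  refine (isCompact_Icc (a := s) (b := t)).induction_on (p := fun S => ∃ C, ∀ u ∈ S, |x u| ≤ C)
    ⟨0, by simp⟩ ?_ ?_ ?_
  · rintro S T hST ⟨C, hC⟩
    exact ⟨C, fun u hu => hC u (hST hu)⟩
  · rintro S T ⟨C, hC⟩ ⟨D, hD⟩
    refine ⟨max C D, ?_⟩
    rintro u (hu | hu)
    · exact (hC u hu).trans (le_max_left _ _)
    · exact (hD u hu).trans (le_max_right _ _)
  · intro u _
    obtain ⟨h1, l, h2⟩ := hx u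
    have e1 : ∀ᶠ v in 𝓝[≥] u, |x v| < |x u| + 1 :=
      (h1.abs).eventually (gt_mem_nhds (by linarith : |x u| < |x u| + 1))
    have e2 : ∀ᶠ v in 𝓝[<] u, |x v| < |l| + 1 :=
      (h2.abs).eventually (gt_mem_nhds (by linarith : |l| < |l| + 1))
    have e3 : ∀ᶠ v in 𝓝 u, |x v| ≤ max (|x u| + 1) (|l| + 1) := by
      rw [← nhdsLT_sup_nhdsGE, eventually_sup]
      exact ⟨e2.mono fun v hv => hv.le.trans (le_max_right _ _),
        e1.mono fun v hv => hv.le.trans (le_max_left _ _)⟩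
    exact ⟨_, mem_nhdsWithin_of_mem_nhds e3, _, fun v hv => hv⟩

/-- Summation by parts for the dyadic sums. -/
lemma dyadicSum_eq_sub (f x : ℝ → ℝ) (s t : ℝ) (n : ℕ) :
    dyadicSum f x s t n = f t * x t - f s * x s - ∑ i ∈ Finset.range (2 ^ n),
      (f (dyadicPoint s t n (i + 1)) - f (dyadicPoint s t n i)) * x (dyadicPoint s t n (i + 1)) := by
  have := Finset.sum_range_sub (fun i => f (dyadicPoint s t n i) * x (dyadicPoint s t n i)) (2 ^ n)
  simp only [dyadicPoint_last, dyadicPoint_zero] at this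
  rw [← this, ← Finset.sum_sub_distrib, dyadicSum]
  refine Finset.sum_congr rfl fun i _ => ?_
  simp only [smul_eq_mul]; ring

/-- Along a path that is right-continuous with left limits, the dyadic sums converge to the
integral obtained by partial integration. -/
lemma tendsto_dyadicSum {f f' x : ℝ → ℝ} (hf : ∀ u, HasDerivAt f (f' u) u) (hf' : Continuous f')
    (hx : ∀ t, ContinuousWithinAt x (Set.Ici t) t ∧ ∃ l, Tendsto x (𝓝[<] t) (𝓝 l))
    {s t : ℝ} (hst : s < t) :
    Tendsto (dyadicSum f x s t) atTop
      (𝓝 (f t * x t - f s * x s - ∫ u in s..t, f' u * x u)) := by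
  set h : ℕ → ℝ := fun n => (t - s) / 2 ^ n with hh
  have hpos : ∀ n, 0 < h n := fun n => div_pos (by linarith) (by positivity)
  set c : ℕ → ℝ → ℝ := fun n u => s + ⌈(u - s) / h n⌉ * h n with hc
  have hcge : ∀ n u, u ≤ c n u := by
    intro n u
    have := Int.le_ceil ((u - s) / h n)
    rw [div_le_iff₀ (hpos n)] at this
    simp only [hc]; linarith
  have hcle : ∀ n u, c n u ≤ u + h n := by
    intro n u
    have := (Int.ceil_lt_add_one ((u - s) / h n)).le
    have := mul_le_mul_of_nonneg_right this (hpos n).le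
    rw [add_mul, div_mul_cancel₀ _ (hpos n).ne'] at this
    simp only [hc]; linarith
  have hcmem : ∀ n, ∀ u ∈ Set.Ioc s t, c n u ∈ Set.Icc s t := by
    intro n u hu
    refine ⟨hu.1.le.trans (hcge n u), ?_⟩
    have : ⌈(u - s) / h n⌉ ≤ (2 ^ n : ℕ) := by
      rw [Int.ceil_le, div_le_iff₀ (hpos n)]
      have : ((2 ^ n : ℕ) : ℝ) * h n = t - s := by simp only [hh]; push_cast; field_simp
      have h3 := hu.2
      push_cast at this ⊢
      linarith
    have h2 : (⌈(u - s) / h n⌉ : ℝ) ≤ 2 ^ n := by exact_mod_cast this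
    have h4 := mul_le_mul_of_nonneg_right h2 (hpos n).le
    have : (2 : ℝ) ^ n * h n = t - s := by simp only [hh]; field_simp
    simp only [hc]; linarith
  have hceq : ∀ n i, ∀ u ∈ Set.Ioc (dyadicPoint s t n i) (dyadicPoint s t n (i + 1)),
      c n u = dyadicPoint s t n (i + 1) := by
    intro n i u hu
    have : ⌈(u - s) / h n⌉ = (i + 1 : ℕ) := by
      rw [Int.ceil_eq_iff, lt_div_iff₀ (hpos n), div_le_iff₀ (hpos n)]
      simp only [dyadicPoint, Set.mem_Ioc] at hu
      push_cast at hu ⊢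
      simp only [hh]
      constructor <;> [skip; linarith [hu.2]]
      have : (i : ℝ) + 1 - 1 = i := by ring
      rw [this]; linarith [hu.1]
    simp only [hc, this, dyadicPoint]
    push_cast; rfl
  have hmeas : ∀ n, Measurable fun u => x (c n u) := by
    intro n
    have h1 : Measurable fun u : ℝ => ⌈(u - s) / h n⌉ :=
      Int.measurable_ceil.comp ((measurable_id.sub_const s).div_const _)
    exact (measurable_from_top (f := fun k : ℤ => x (s + k * h n))).comp h1
  obtain ⟨C, hC⟩ := exists_bound_of_cadlag hx s t
  have hint : ∀ n, IntervalIntegrable (fun u => f' u * x (c n u)) volume s t := by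
    intro n
    rw [intervalIntegrable_iff, Set.uIoc_of_le hst.le]
    refine Integrable.mono' (g := fun u => |f' u| * C) ?_
      (hf'.aestronglyMeasurable.mul (hmeas n).aestronglyMeasurable) ?_
    · exact ((hf'.abs.mul continuous_const).integrableOn_Icc).mono_set Set.Ioc_subset_Icc_self
    · refine (ae_restrict_iff' measurableSet_Ioc).2 (Eventually.of_forall fun u hu => ?_)
      rw [norm_mul, Real.norm_eq_abs, Real.norm_eq_abs]
      exact mul_le_mul_of_nonneg_left (hC _ (hcmem n u hu)) (abs_nonneg _)
  have key : ∀ n, dyadicSum f x s t n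
      = f t * x t - f s * x s - ∫ u in s..t, f' u * x (c n u) := by
    intro n
    rw [dyadicSum_eq_sub]
    congr 1
    have h1 : ∀ i < 2 ^ n, IntervalIntegrable (fun u => f' u * x (c n u)) volume
        (dyadicPoint s t n i) (dyadicPoint s t n (i + 1)) := by
      intro i hi
      refine (hint n).mono_set ?_
      rw [Set.uIcc_of_le hst.le, Set.uIcc_of_le (dyadicPoint_mono hst.le n (Nat.le_succ i))]
      exact Set.Icc_subset_Icc (dyadicPoint_mem hst.le hi.le).1 (dyadicPoint_mem hst.le hi).2
    have := intervalIntegral.sum_integral_adjacent_intervals h1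
    rw [dyadicPoint_zero, dyadicPoint_last] at this
    rw [← this]
    refine Finset.sum_congr rfl fun i _ => ?_
    have h2 : ∫ u in (dyadicPoint s t n i)..(dyadicPoint s t n (i + 1)), f' u * x (c n u)
        = ∫ u in (dyadicPoint s t n i)..(dyadicPoint s t n (i + 1)),
          f' u * x (dyadicPoint s t n (i + 1)) := by
      refine intervalIntegral.integral_congr_ae (Eventually.of_forall fun u hu => ?_)
      rw [Set.uIoc_of_le (dyadicPoint_mono hst.le n (Nat.le_succ i))] at hu
      simp only [hceq n i u hu]
    rw [h2, intervalIntegral.integral_mul_const,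
      intervalIntegral.integral_eq_sub_of_hasDerivAt (fun u _ => hf u) (hf'.intervalIntegrable _ _)]
  have hh0 : Tendsto h atTop (𝓝 0) := by
    have := (tendsto_pow_atTop_nhds_zero_of_lt_one (r := (2 : ℝ)⁻¹) (by norm_num)
      (by norm_num)).const_mul (t - s)
    simpa [hh, div_eq_mul_inv] using this
  rw [show dyadicSum f x s t = fun n => f t * x t - f s * x s - ∫ u in s..t, f' u * x (c n u) from
    funext key]
  refine Tendsto.sub tendsto_const_nhds ?_
  refine intervalIntegral.tendsto_integral_filter_of_dominated_convergence (fun u => |f' u| * C)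
    (Eventually.of_forall fun n => ?_) (Eventually.of_forall fun n => ?_) ?_ ?_
  · exact (hf'.aestronglyMeasurable.mul (hmeas n).aestronglyMeasurable)
  · refine Eventually.of_forall fun u hu => ?_
    rw [Set.uIoc_of_le hst.le] at hu
    rw [norm_mul, Real.norm_eq_abs, Real.norm_eq_abs]
    exact mul_le_mul_of_nonneg_left (hC _ (hcmem n u hu)) (abs_nonneg _)
  · exact (hf'.abs.mul continuous_const).intervalIntegrable _ _
  · refine Eventually.of_forall fun u _ => Tendsto.const_mul _ ?_
    have h1 : Tendsto (fun n => c n u) atTop (𝓝[≥] u) := by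
      refine tendsto_nhdsWithin_iff.2 ⟨?_, Eventually.of_forall fun n => hcge n u⟩
      refine tendsto_of_tendsto_of_tendsto_of_le_of_le tendsto_const_nhds ?_
        (fun n => hcge n u) (fun n => hcle n u)
      simpa using tendsto_const_nhds.add hh0
    exact (hx u).1.tendsto.comp h1

/-! ### The isometry for integrals with respect to orthogonal increments -/

/-- A Hilbert space valued path with orthogonal increments, the squared norm of an increment being
`κ` times the length of the interval. -/
structure HasOrthogonalIncrements {H : Type*} [NormedAddCommGroup H] [InnerProductSpace ℝ H]
    (κ : ℝ) (x : ℝ → H) : Prop where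
  inner_eq_zero : ∀ a b c d, a ≤ b → b ≤ c → c ≤ d → inner ℝ (x b - x a) (x d - x c) = 0
  norm_sq : ∀ a b, a ≤ b → ‖x b - x a‖ ^ 2 = κ * (b - a)

section Hilbert

variable {H : Type*} [NormedAddCommGroup H] [InnerProductSpace ℝ H] {κ : ℝ} {x : ℝ → H}

lemma HasOrthogonalIncrements.inner_dyadicSum (hx : HasOrthogonalIncrements κ x) (f g : ℝ → ℝ)
    {s t : ℝ} (hst : s ≤ t) (n : ℕ) :
    inner ℝ (dyadicSum f x s t n) (dyadicSum g x s t n)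
      = κ * dyadicSum (fun u => f u * g u) (fun u => u) s t n := by
  have hm := dyadicPoint_mono hst n
  simp only [dyadicSum, sum_inner, inner_sum, inner_smul_left, inner_smul_right, Finset.mul_sum]
  refine Finset.sum_congr rfl fun i hi => ?_
  rw [Finset.sum_eq_single_of_mem i hi]
  · rw [real_inner_self_eq_norm_sq, hx.norm_sq _ _ (hm (Nat.le_succ i))]
    simp only [smul_eq_mul, conj_trivial]; ring
  · intro j _ hj
    rcases lt_or_gt_of_ne hj with h | h
    · rw [hx.inner_eq_zero _ _ _ _ (hm (Nat.le_succ j)) (hm h) (hm (Nat.le_succ i))]; simp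
    · rw [real_inner_comm, hx.inner_eq_zero _ _ _ _ (hm (Nat.le_succ i)) (hm h)
        (hm (Nat.le_succ j))]; simp

lemma HasOrthogonalIncrements.inner_dyadicSum_eq_zero (hx : HasOrthogonalIncrements κ x)
    (f g : ℝ → ℝ) {s t s' t' : ℝ} (hst : s ≤ t) (hts : t ≤ s') (hst' : s' ≤ t') (n : ℕ) :
    inner ℝ (dyadicSum f x s t n) (dyadicSum g x s' t' n) = 0 := by
  simp only [dyadicSum, sum_inner, inner_sum, inner_smul_left, inner_smul_right, Finset.mul_sum]
  refine Finset.sum_eq_zero fun i hi => Finset.sum_eq_zero fun j hj => ?_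
  rw [hx.inner_eq_zero _ _ _ _ (dyadicPoint_mono hst n (Nat.le_succ j)) _
    (dyadicPoint_mono hst' n (Nat.le_succ i))]
  · simp
  · exact ((dyadicPoint_mem hst (Finset.mem_range.1 hj)).2.trans hts).trans
      (dyadicPoint_mem hst' (Finset.mem_range.1 hi).le).1

lemma sum_range_two_mul {E : Type*} [AddCommGroup E] (a : ℕ → E) (N : ℕ) :
    ∑ i ∈ Finset.range (2 * N), a i = ∑ i ∈ Finset.range N, (a (2 * i) + a (2 * i + 1)) := by
  induction N with
  | zero => simp
  | succ N ih =>
    rw [show 2 * (N + 1) = 2 * N + 1 + 1 by ring, Finset.sum_range_succ, Finset.sum_range_succ, ih,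
      Finset.sum_range_succ, add_assoc]

lemma dyadicSum_succ_sub (f : ℝ → ℝ) (x : ℝ → H) (s t : ℝ) (n : ℕ) :
    dyadicSum f x s t (n + 1) - dyadicSum f x s t n = ∑ i ∈ Finset.range (2 ^ n),
      (f (dyadicPoint s t (n + 1) (2 * i + 1)) - f (dyadicPoint s t (n + 1) (2 * i))) •
        (x (dyadicPoint s t (n + 1) (2 * i + 2)) - x (dyadicPoint s t (n + 1) (2 * i + 1))) := by
  simp only [dyadicSum]
  rw [pow_succ', sum_range_two_mul, ← Finset.sum_sub_distrib]
  refine Finset.sum_congr rfl fun i _ => ?_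
  rw [← dyadicPoint_succ_two_mul s t n i, ← dyadicPoint_succ_two_mul s t n (i + 1),
    show 2 * (i + 1) = 2 * i + 1 + 1 by ring]
  module

/-- Refining the dyadic partition changes the sum of a Lipschitz integrand by `O(2 ^ (-n))`. -/
lemma HasOrthogonalIncrements.norm_dyadicSum_succ_sub_le (hx : HasOrthogonalIncrements κ x)
    {f : ℝ → ℝ} {K : ℝ} {s t : ℝ} (hst : s ≤ t) (hκ : 0 ≤ κ)
    (hf : ∀ u ∈ Set.Icc s t, ∀ v ∈ Set.Icc s t, |f u - f v| ≤ K * |u - v|) (n : ℕ) :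
    ‖dyadicSum f x s t (n + 1) - dyadicSum f x s t n‖
      ≤ |K| * (t - s) * √(κ * (t - s)) / 2 ^ n := by
  set h := (t - s) / 2 ^ (n + 1) with hh
  have h0 : 0 ≤ h := div_nonneg (by linarith) (by positivity)
  have hts : 0 ≤ t - s := by linarith
  have hm := dyadicPoint_mono hst (n + 1)
  have key : ‖dyadicSum f x s t (n + 1) - dyadicSum f x s t n‖ ^ 2
      ≤ 2 ^ n * ((|K| * h) ^ 2 * (κ * h)) := by
    rw [← real_inner_self_eq_norm_sq, dyadicSum_succ_sub]
    simp only [sum_inner, inner_sum, inner_smul_left, inner_smul_right]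
    have : ∑ _i ∈ Finset.range (2 ^ n), ((|K| * h) ^ 2 * (κ * h))
        = 2 ^ n * ((|K| * h) ^ 2 * (κ * h)) := by simp
    rw [← this]
    refine Finset.sum_le_sum fun i hi => ?_
    have hi' : 2 * i + 2 ≤ 2 ^ (n + 1) := by
      rw [pow_succ']; have := Finset.mem_range.1 hi; omega
    rw [Finset.sum_eq_single_of_mem i hi]
    · rw [real_inner_self_eq_norm_sq, hx.norm_sq _ _ (hm (Nat.le_succ _)), dyadicPoint_succ_sub,
        ← hh, conj_trivial, ← mul_assoc, ← sq]
      refine mul_le_mul_of_nonneg_right ?_ (mul_nonneg hκ h0)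
      rw [← sq_abs]
      refine pow_le_pow_left₀ (abs_nonneg _) ?_ 2
      have := hf _ (dyadicPoint_mem hst (n := n + 1) (i := 2 * i + 1) (by omega))
        _ (dyadicPoint_mem hst (n := n + 1) (i := 2 * i) (by omega))
      rw [dyadicPoint_succ_sub, ← hh, abs_of_nonneg h0] at this
      exact this.trans (mul_le_mul_of_nonneg_right (le_abs_self K) h0)
    · intro j _ hj
      rcases lt_or_gt_of_ne hj with h | h
      · rw [hx.inner_eq_zero _ _ _ _ (hm (Nat.le_succ _)) (hm (by omega)) (hm (Nat.le_succ _))]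
        simp
      · rw [real_inner_comm, hx.inner_eq_zero _ _ _ _ (hm (Nat.le_succ _)) (hm (by omega))
          (hm (Nat.le_succ _))]; simp
  refine abs_le_of_sq_le_sq' (key.trans ?_) (by positivity) |>.2
  have h2 : (2 : ℝ) ^ n * h ≤ t - s := by
    rw [hh, pow_succ]; field_simp; linarith
  have h3 : h ≤ (t - s) / 2 ^ n := by
    rw [hh, pow_succ]
    exact div_le_div_of_nonneg_left hts (by positivity) (by nlinarith [pow_pos (two_pos (α := ℝ)) n])
  calc (2 : ℝ) ^ n * ((|K| * h) ^ 2 * (κ * h)) = (|K| * h) ^ 2 * (κ * (2 ^ n * h)) := by ring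
    _ ≤ (|K| * ((t - s) / 2 ^ n)) ^ 2 * (κ * (t - s)) := by gcongr
    _ = (|K| * (t - s) * √(κ * (t - s)) / 2 ^ n) ^ 2 := by
      rw [div_pow, mul_pow _ (√_), Real.sq_sqrt (mul_nonneg hκ hts)]; ring

lemma HasOrthogonalIncrements.exists_tendsto_dyadicSum [CompleteSpace H]
    (hx : HasOrthogonalIncrements κ x) (hκ : 0 ≤ κ) {f f' : ℝ → ℝ}
    (hf : ∀ u, HasDerivAt f (f' u) u) (hf' : Continuous f') {s t : ℝ} (hst : s ≤ t) :
    ∃ y, Tendsto (dyadicSum f x s t) atTop (𝓝 y) := by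
  obtain ⟨K, hK⟩ := isCompact_Icc.exists_bound_of_continuousOn (s := Set.Icc s t) hf'.continuousOn
  have hlip : ∀ u ∈ Set.Icc s t, ∀ v ∈ Set.Icc s t, |f u - f v| ≤ K * |u - v| := by
    intro u hu v hv
    exact (convex_Icc s t).norm_image_sub_le_of_norm_hasDerivWithin_le
      (fun w _ => (hf w).hasDerivWithinAt) hK hv hu
  set C := |K| * (t - s) * √(κ * (t - s)) with hC
  refine cauchySeq_tendsto_of_complete (cauchySeq_of_le_geometric_two (C := 2 * C) fun n => ?_)
  rw [dist_comm, dist_eq_norm]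
  have := hx.norm_dyadicSum_succ_sub_le hst hκ hlip n
  rw [← hC] at this
  refine this.trans (le_of_eq ?_)
  ring

/-- The isometry: inner products of limits of dyadic sums are integrals of products. -/
lemma HasOrthogonalIncrements.inner_limit (hx : HasOrthogonalIncrements κ x)
    {f f' g g' : ℝ → ℝ} (hf : ∀ u, HasDerivAt f (f' u) u) (hf' : Continuous f')
    (hg : ∀ u, HasDerivAt g (g' u) u) (hg' : Continuous g') {s t : ℝ} (hst : s < t) {y z : H}
    (hy : Tendsto (dyadicSum f x s t) atTop (𝓝 y)) (hz : Tendsto (dyadicSum g x s t) atTop (𝓝 z)) :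
    inner ℝ y z = κ * ∫ u in s..t, f u * g u := by
  have hfc : Continuous f := continuous_iff_continuousAt.2 fun u => (hf u).continuousAt
  have hgc : Continuous g := continuous_iff_continuousAt.2 fun u => (hg u).continuousAt
  have h1 := hy.inner (𝕜 := ℝ) hz
  have hfg : ∀ u, HasDerivAt (fun u => f u * g u) (f' u * g u + f u * g' u) u :=
    fun u => (hf u).mul (hg u)
  have hc : Continuous fun u => f' u * g u + f u * g' u :=
    (hf'.mul hgc).add (hfc.mul hg')
  have h2 := (tendsto_dyadicSum (x := fun u => u) hfg hc
    (fun t => ⟨continuous_id.continuousWithinAt, t, continuous_id.continuousWithinAt⟩)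
    hst).const_mul κ
  simp only [hx.inner_dyadicSum f g hst.le] at h1
  rw [tendsto_nhds_unique h1 h2]
  congr 1
  have := intervalIntegral.integral_mul_deriv_eq_deriv_mul (a := s) (b := t)
    (u := fun u => f u * g u) (v := fun u => u) (v' := fun _ => 1) (fun u _ => hfg u)
    (fun u _ => hasDerivAt_id u) (hc.intervalIntegrable _ _)
    (continuous_const.intervalIntegrable _ _)
  simpa using this.symm

lemma HasOrthogonalIncrements.inner_limit_eq_zero (hx : HasOrthogonalIncrements κ x)
    {f g : ℝ → ℝ} {s t s' t' : ℝ} (hst : s ≤ t) (hts : t ≤ s') (hst' : s' ≤ t') {y z : H}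
    (hy : Tendsto (dyadicSum f x s t) atTop (𝓝 y))
    (hz : Tendsto (dyadicSum g x s' t') atTop (𝓝 z)) :
    inner ℝ y z = 0 := by
  have h1 := hy.inner (𝕜 := ℝ) hz
  simp only [hx.inner_dyadicSum_eq_zero f g hst hts hst'] at h1
  exact (tendsto_nhds_unique h1 tendsto_const_nhds)

end Hilbert

/-! ### Integrals with respect to a second-order Lévy process -/

/-- A nonnegative additive function on the half line is linear. -/
lemma additive_nonneg_eq_mul {m : ℝ → ℝ} (hm : ∀ t, 0 ≤ t → 0 ≤ m t)
    (hadd : ∀ s t, 0 ≤ s → 0 ≤ t → m (s + t) = m s + m t) {t : ℝ} (ht : 0 ≤ t) :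
    m t = t * m 1 := by
  have hmul : ∀ (n : ℕ) (s : ℝ), 0 ≤ s → m (n * s) = n * m s := by
    intro n s hs
    induction n with
    | zero => have := hadd 0 0 le_rfl le_rfl; simp at this ⊢; linarith
    | succ n ih =>
      push_cast
      rw [add_mul, one_mul, hadd _ _ (by positivity) hs, ih]; ring
  have hmono : ∀ s t, 0 ≤ s → s ≤ t → m s ≤ m t := by
    intro s t hs hst
    have := hadd s (t - s) hs (by linarith)
    rw [add_sub_cancel] at this
    linarith [hm (t - s) (by linarith)]
  have h1 : 0 ≤ m 1 := hm 1 zero_le_one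
  have key : ∀ N : ℕ, |m t - t * m 1| * N ≤ m 1 := by
    intro N
    set k := ⌊(N : ℝ) * t⌋₊
    have hNt : 0 ≤ (N : ℝ) * t := by positivity
    have a1 : (k : ℝ) ≤ N * t := Nat.floor_le hNt
    have a2 : (N : ℝ) * t ≤ (k + 1 : ℕ) := by push_cast; exact (Nat.lt_floor_add_one _).le
    have b1 := hmono _ _ (by positivity) a1
    have b2 := hmono _ _ hNt a2
    rw [hmul N t ht] at b1 b2
    have c1 := hmul k 1 zero_le_one
    have c2 := hmul (k + 1) 1 zero_le_one
    rw [mul_one] at c1 c2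
    rw [c1] at b1
    rw [c2] at b2
    push_cast at b2 a2
    have : |m t - t * m 1| * N = |N * m t - N * t * m 1| := by
      rw [← abs_of_nonneg (Nat.cast_nonneg (α := ℝ) N), ← abs_mul, abs_of_nonneg
        (Nat.cast_nonneg (α := ℝ) N)]
      congr 1; ring
    rw [this, abs_le]
    constructor <;> nlinarith
  by_contra hne
  have hpos : 0 < |m t - t * m 1| := abs_pos.2 (sub_ne_zero.2 hne)
  obtain ⟨N, hN⟩ := exists_nat_gt (m 1 / |m t - t * m 1|)
  rw [div_lt_iff₀ hpos] at hN
  linarith [key N]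

/-- The integral `∫_s^t f dx`, defined by partial integration; `f'` is the derivative of `f`. -/
noncomputable def partsIntegral (f f' x : ℝ → ℝ) (s t : ℝ) : ℝ :=
  f t * x t - f s * x s - ∫ u in s..t, f' u * x u

section Levy

variable {Ω : Type*} [MeasurableSpace Ω] {μ : Measure Ω} [IsProbabilityMeasure μ] {σ : ℝ}
  {L : ℝ → Ω → ℝ}

lemma IsSecondOrderLevy.integral_mul_eq_zero (hL : IsSecondOrderLevy μ σ L) {a b c d : ℝ}
    (hab : a ≤ b) (hbc : b ≤ c) (hcd : c ≤ d) :
    ∫ ω, (L b ω - L a ω) * (L d ω - L c ω) ∂μ = 0 := by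
  let τ : ℕ → ℝ
    | 0 => a
    | 1 => b
    | 2 => c
    | _ => d
  have hτ : Monotone τ := by
    refine monotone_nat_of_le_succ fun n => ?_
    rcases n with _ | _ | _ | n <;> simp [τ, hab, hbc, hcd]
  have h := (hL.indep_increments.nat hτ).indepFun (by norm_num : (0 : ℕ) ≠ 2)
  have h2 := h.integral_fun_mul_eq_mul_integral
    ((hL.measurable _).sub (hL.measurable _)).aestronglyMeasurable
    ((hL.measurable _).sub (hL.measurable _)).aestronglyMeasurable
  simp only [τ] at h2
  rw [h2]
  have : ∫ ω, (L b ω - L a ω) ∂μ = 0 := by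
    rw [integral_sub ((hL.memLp b).integrable (by norm_num)) ((hL.memLp a).integrable (by norm_num)),
      hL.mean_zero, hL.mean_zero, sub_zero]
  simp only [this, zero_mul]

lemma IsSecondOrderLevy.integral_sq (hL : IsSecondOrderLevy μ σ L) {a b : ℝ} (hab : a ≤ b) :
    ∫ ω, (L b ω - L a ω) ^ 2 ∂μ = σ ^ 2 * (b - a) := by
  set m : ℝ → ℝ := fun t => ∫ ω, (L t ω - L 0 ω) ^ 2 ∂μ with hm
  have hshift : ∀ a b, ∫ ω, (L b ω - L a ω) ^ 2 ∂μ = m (b - a) := by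
    intro a b
    have := (hL.stationary_increments 0 (b - a) a).comp (measurable_id.pow_const 2)
    have h2 := this.integral_eq
    simpa [Function.comp_def, hm] using h2
  have hL2 : ∀ a b, MemLp (fun ω => L b ω - L a ω) 2 μ := fun a b => (hL.memLp b).sub (hL.memLp a)
  have hadd : ∀ s t, 0 ≤ s → 0 ≤ t → m (s + t) = m s + m t := by
    intro s t hs ht
    have e1 : m t = ∫ ω, (L (s + t) ω - L s ω) ^ 2 ∂μ := by rw [hshift]; simp
    rw [e1]
    have e2 := hL.integral_mul_eq_zero hs le_rfl (by linarith : s ≤ s + t)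
    have i1 := (hL2 0 s).integrable_sq
    have i2 := (hL2 s (s + t)).integrable_sq
    have i3 : Integrable (fun ω => (L s ω - L 0 ω) * (L (s + t) ω - L s ω)) μ :=
      (hL2 0 s).integrable_mul (hL2 s (s + t))
    have e4 : m (s + t) = ∫ ω, ((L s ω - L 0 ω) ^ 2 + (L (s + t) ω - L s ω) ^ 2
        + 2 * ((L s ω - L 0 ω) * (L (s + t) ω - L s ω))) ∂μ := by
      simp only [hm]; congr 1; ext ω; ring
    have e5 := integral_add (i1.add i2) (i3.const_mul 2)
    simp only [Pi.add_apply] at e5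
    rw [e4, e5, integral_add i1 i2, integral_const_mul, e2]
    simp [hm]
  have h1 : m 1 = σ ^ 2 := by
    rw [← hL.second_moment]
    simp only [hm]
    refine integral_congr_ae ?_
    filter_upwards [hL.zero] with ω hω
    simp [hω]
  rw [hshift, additive_nonneg_eq_mul (m := m) (fun t _ => integral_nonneg fun ω => sq_nonneg _) hadd
    (by linarith), h1, mul_comm]

/-- The Lévy process as a path in `L²`. -/
noncomputable def IsSecondOrderLevy.toL2 (hL : IsSecondOrderLevy μ σ L) (t : ℝ) : Lp ℝ 2 μ :=
  (hL.memLp t).toLp (L t)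

omit [IsProbabilityMeasure μ] in
lemma inner_toLp {f g : Ω → ℝ} (hf : MemLp f 2 μ) (hg : MemLp g 2 μ) :
    inner ℝ (hf.toLp f) (hg.toLp g) = ∫ ω, f ω * g ω ∂μ := by
  rw [L2.inner_def]
  refine integral_congr_ae ?_
  filter_upwards [hf.coeFn_toLp, hg.coeFn_toLp] with ω h1 h2
  simp [h1, h2, mul_comm]

lemma IsSecondOrderLevy.hasOrthogonalIncrements (hL : IsSecondOrderLevy μ σ L) :
    HasOrthogonalIncrements (σ ^ 2) hL.toL2 where
  inner_eq_zero a b c d hab hbc hcd := by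
    simp only [toL2]
    rw [← MemLp.toLp_sub, ← MemLp.toLp_sub, inner_toLp]
    exact hL.integral_mul_eq_zero hab hbc hcd
  norm_sq a b hab := by
    simp only [toL2]
    rw [← real_inner_self_eq_norm_sq, ← MemLp.toLp_sub, inner_toLp, ← hL.integral_sq hab]
    congr 1; ext ω; simp [sq]

omit [IsProbabilityMeasure μ] in
lemma IsSecondOrderLevy.coeFn_dyadicSum (hL : IsSecondOrderLevy μ σ L) (f : ℝ → ℝ) (s t : ℝ)
    (n : ℕ) :
    ⇑(dyadicSum f hL.toL2 s t n) =ᵐ[μ] fun ω => dyadicSum f (fun u => L u ω) s t n := by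
  have h : ∀ᵐ ω ∂μ, ∀ i, hL.toL2 (dyadicPoint s t n i) ω = L (dyadicPoint s t n i) ω :=
    ae_all_iff.2 fun i => MemLp.coeFn_toLp _
  have h2 := Lp.coeFn_fun_finsetSum (μ := μ) (Finset.range (2 ^ n)) fun i =>
    f (dyadicPoint s t n i) • (hL.toL2 (dyadicPoint s t n (i + 1)) - hL.toL2 (dyadicPoint s t n i))
  have h3 : ∀ᵐ ω ∂μ, ∀ i, (f (dyadicPoint s t n i) •
      (hL.toL2 (dyadicPoint s t n (i + 1)) - hL.toL2 (dyadicPoint s t n i)) : Lp ℝ 2 μ) ω =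
      f (dyadicPoint s t n i) • (hL.toL2 (dyadicPoint s t n (i + 1)) ω
        - hL.toL2 (dyadicPoint s t n i) ω) := by
    refine ae_all_iff.2 fun i => ?_
    filter_upwards [Lp.coeFn_smul (f (dyadicPoint s t n i)) (hL.toL2 (dyadicPoint s t n (i + 1))
      - hL.toL2 (dyadicPoint s t n i)), Lp.coeFn_sub (hL.toL2 (dyadicPoint s t n (i + 1)))
      (hL.toL2 (dyadicPoint s t n i))] with ω e1 e2
    rw [e1, Pi.smul_apply, e2, Pi.sub_apply]
  filter_upwards [h, h2, h3] with ω e1 e2 e3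
  rw [dyadicSum, e2, dyadicSum]
  simp only [e3, e1]

/-- For a continuously differentiable integrand, the integral defined by partial integration along
the paths is the `L²`-limit of the dyadic sums. -/
lemma IsSecondOrderLevy.exists_levyIntegral (hL : IsSecondOrderLevy μ σ L) {f f' : ℝ → ℝ}
    (hf : ∀ u, HasDerivAt f (f' u) u) (hf' : Continuous f') {s t : ℝ} (hst : s < t) :
    ∃ y : Lp ℝ 2 μ, Tendsto (dyadicSum f hL.toL2 s t) atTop (𝓝 y) ∧
      ⇑y =ᵐ[μ] fun ω => partsIntegral f f' (fun u => L u ω) s t := by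
  obtain ⟨y, hy⟩ := hL.hasOrthogonalIncrements.exists_tendsto_dyadicSum (sq_nonneg σ) hf hf' hst.le
  refine ⟨y, hy, ?_⟩
  have h1 := tendstoInMeasure_of_tendsto_Lp hy
  have h2 : ∀ᵐ ω ∂μ, ∀ n, ⇑(dyadicSum f hL.toL2 s t n) ω
      = dyadicSum f (fun u => L u ω) s t n := ae_all_iff.2 fun n => hL.coeFn_dyadicSum f s t n
  refine tendstoInMeasure_ae_unique h1
    (tendstoInMeasure_of_tendsto_ae (fun n => Lp.aestronglyMeasurable _) ?_)
  filter_upwards [h2, hL.cadlag] with ω e1 e2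
  simp only [e1]
  exact tendsto_dyadicSum hf hf' e2 hst

end Levy

/-! ### Variation of constants for the state equation -/

section VariationOfConstants

variable {V : Type*} [NormedAddCommGroup V] [NormedSpace ℝ V] [CompleteSpace V]

/-- The flow `exp (t A)` of the linear differential equation `v' = A v`. -/
noncomputable def flow (A : V →L[ℝ] V) (t : ℝ) : V →L[ℝ] V := NormedSpace.exp (t • A)

omit [CompleteSpace V] in
lemma flow_zero (A : V →L[ℝ] V) : flow A 0 = 1 := by simp [flow, NormedSpace.exp_zero]

lemma flow_add (A : V →L[ℝ] V) (s t : ℝ) : flow A (s + t) = flow A s * flow A t := by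
  rw [flow, flow, flow, add_smul]
  let _ : NormedAlgebra ℚ (V →L[ℝ] V) := NormedAlgebra.restrictScalars ℚ ℝ _
  exact NormedSpace.exp_add_of_commute (((Commute.refl A).smul_left s).smul_right t)

lemma flow_nat_mul (A : V →L[ℝ] V) (Δ : ℝ) (n : ℕ) : flow A (n * Δ) = flow A Δ ^ n := by
  induction n with
  | zero => simp [flow_zero]
  | succ n ih => rw [Nat.cast_succ, add_mul, one_mul, flow_add, ih, pow_succ]

lemma hasDerivAt_flow (A : V →L[ℝ] V) (t : ℝ) : HasDerivAt (flow A) (flow A t * A) t :=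
  hasDerivAt_exp_smul_const A t

lemma continuous_flow (A : V →L[ℝ] V) : Continuous (flow A) :=
  continuous_iff_continuousAt.2 fun t => (hasDerivAt_flow A t).continuousAt

/-- The kernel `t ↦ c (exp (t A) e)` and its derivative. -/
lemma hasDerivAt_kernel (A : V →L[ℝ] V) (c : V →L[ℝ] ℝ) (e : V) (t : ℝ) :
    HasDerivAt (fun t => c (flow A t e)) (c (flow A t (A e))) t := by
  have h := (hasDerivAt_flow A t).clm_apply (hasDerivAt_const t e)
  exact (c.hasFDerivAt.comp_hasDerivAt t h).congr_deriv (by simp)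

lemma continuous_kernel (A : V →L[ℝ] V) (c : V →L[ℝ] ℝ) (e : V) :
    Continuous fun t => c (flow A t e) :=
  c.continuous.comp ((continuous_flow A).clm_apply continuous_const)

/-- Variation of constants: a solution of `dX = A X dt + e dx` satisfies
`X_t = exp ((t - s) A) X_s + ∫_s^t exp ((t - u) A) e dx_u`, the integral being understood by
partial integration. The function `X_u - x_u e` is continuous with right derivative `A X_u`, because
`x` is right-continuous; this is what allows the fundamental theorem of calculus to be used. -/
lemma variation_of_constants {A : V →L[ℝ] V} {e : V} (he : e ≠ 0) {X : ℝ → V} {x : ℝ → ℝ}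
    (hx : ∀ t, ContinuousWithinAt x (Set.Ici t) t)
    (hint : ∀ s t, IntervalIntegrable X volume s t)
    (hX : ∀ s t, X t - X s = (∫ u in s..t, A (X u)) + (x t - x s) • e)
    (c : V →L[ℝ] ℝ) {s t : ℝ} (hst : s ≤ t) :
    c (X t) = c (flow A (t - s) (X s)) + partsIntegral (fun u => c (flow A (t - u) e))
      (fun u => -c (flow A (t - u) (A e))) x s t := by
  set D : ℝ → V := fun u => X u - x u • e with hD
  have hAint : ∀ s t, IntervalIntegrable (fun u => A (X u)) volume s t := fun s t =>
    ⟨A.integrable_comp (hint s t).1, A.integrable_comp (hint s t).2⟩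
  have hDeq : ∀ u, D u = D s + ∫ v in s..u, A (X v) := by
    intro u
    have := hX s u
    simp only [hD]
    rw [sub_eq_iff_eq_add] at this
    rw [this, sub_smul]; abel
  have hDc : Continuous D := by
    rw [show D = fun u => D s + ∫ v in s..u, A (X v) from funext hDeq]
    exact continuous_const.add (intervalIntegral.continuous_primitive hAint s)
  have hXr : ∀ u, ContinuousWithinAt X (Set.Ici u) u := by
    intro u
    have : X = fun v => D v + x v • e := by ext v; simp [hD]
    rw [this]
    exact hDc.continuousWithinAt.add ((hx u).smul continuousWithinAt_const)
  have hDr : ∀ u, HasDerivWithinAt D (A (X u)) (Set.Ioi u) u := by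
    intro u
    have h1 : HasDerivWithinAt (fun w => ∫ v in s..w, A (X v)) (A (X u)) (Set.Ici u) u := by
      refine intervalIntegral.integral_hasDerivWithinAt_right (hAint s u) ?_ ?_ (t := Set.Ioi u)
      · refine ⟨Set.Ioc u (u + 1), Ioc_mem_nhdsGT (by linarith), ?_⟩
        have := (hAint u (u + 1)).1.aestronglyMeasurable
        exact this
      · exact (A.continuous.continuousAt.comp_continuousWithinAt (hXr u)).mono Set.Ioi_subset_Ici_self
    have h2 := (h1.const_add (D s)).mono Set.Ioi_subset_Ici_self
    rwa [← show D = fun u => D s + ∫ v in s..u, A (X v) from funext hDeq] at h2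
  have hflow : ∀ u, HasDerivAt (fun u => flow A (t - u)) (-(flow A (t - u) * A)) u := by
    intro u
    exact ((hasDerivAt_flow A (t - u)).scomp u ((hasDerivAt_id u).const_sub t)).congr_deriv
      (by simp)
  have hF : ∀ u, HasDerivWithinAt (fun u => c (flow A (t - u) (D u)))
      (c (flow A (t - u) (A e)) * x u) (Set.Ioi u) u := by
    intro u
    have h := ((hflow u).hasDerivWithinAt (s := Set.Ioi u)).clm_apply (hDr u)
    have h2 := c.hasFDerivAt.comp_hasDerivWithinAt u h
    refine h2.congr_deriv ?_
    simp only [hD, neg_apply, mul_apply_eq_comp, map_sub, map_smul,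
      map_add, map_neg, smul_eq_mul]
    ring
  -- `x` is integrable because a functional with value one at `e` recovers it from `X` and `D`
  obtain ⟨ψ, hψ⟩ := SeparatingDual.exists_eq_one (R := ℝ) he
  have hxint : IntervalIntegrable x volume s t := by
    have : x = fun u => ψ (X u) - ψ (D u) := by ext u; simp [hD, hψ]
    rw [this]
    refine IntervalIntegrable.sub ⟨ψ.integrable_comp (hint s t).1, ψ.integrable_comp (hint s t).2⟩ ?_
    exact (ψ.continuous.comp hDc).intervalIntegrable _ _
  have hkc : Continuous fun u => c (flow A (t - u) (A e)) :=
    (continuous_kernel A c (A e)).comp (continuous_const.sub continuous_id)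
  have hFc : Continuous fun u => c (flow A (t - u) (D u)) :=
    c.continuous.comp (((continuous_flow A).comp (continuous_const.sub continuous_id)).clm_apply hDc)
  have hFTC := intervalIntegral.integral_eq_sub_of_hasDeriv_right_of_le hst hFc.continuousOn
    (fun u _ => hF u) (hxint.continuousOn_mul hkc.continuousOn)
  simp only [partsIntegral, neg_mul, intervalIntegral.integral_neg, hFTC]
  simp [hD, flow_zero]
  ring

end VariationOfConstants

/-! ### The autoregressive filter annihilates the flow -/

section Algebra

variable {𝔸 : Type*} [NormedRing 𝔸] [NormedAlgebra ℂ 𝔸] [CompleteSpace 𝔸]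

lemma exists_exp_sub_one_eq_mul (w : 𝔸) :
    ∃ y : 𝔸, Commute y w ∧ NormedSpace.exp w - 1 = y * w := by
  have hs : Summable fun n : ℕ => (((n + 1).factorial : ℂ)⁻¹) • w ^ n := by
    refine Summable.of_norm_bounded (NormedSpace.norm_expSeries_summable' (𝕂 := ℂ) w) fun n => ?_
    rw [norm_smul, norm_smul]
    refine mul_le_mul_of_nonneg_right ?_ (norm_nonneg _)
    simp only [norm_inv, RCLike.norm_natCast]
    exact inv_anti₀ (by positivity) (by exact_mod_cast Nat.factorial_le (Nat.le_succ n))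
  refine ⟨∑' n : ℕ, (((n + 1).factorial : ℂ)⁻¹) • w ^ n, ?_, ?_⟩
  · exact Commute.tsum_left _ fun n => ((Commute.refl w).pow_left n).smul_left _
  · have h1 := NormedSpace.exp_series_hasSum_exp' (𝕂 := ℂ) w
    rw [← hasSum_nat_add_iff' 1] at h1
    simp only [Finset.sum_range_one, Nat.factorial_zero, Nat.cast_one, inv_one, pow_zero,
      one_smul] at h1
    have h2 := hs.hasSum.mul_right w
    simp only [smul_mul_assoc, ← pow_succ] at h2
    exact h1.unique h2

/-- `exp x - exp l` is a multiple of `x - l`, the quotient commuting with `x`. -/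
lemma exists_exp_sub_exp_eq_mul (x : 𝔸) (l : ℂ) :
    ∃ y : 𝔸, Commute y x ∧
      NormedSpace.exp x - algebraMap ℂ 𝔸 (Complex.exp l) = y * (x - algebraMap ℂ 𝔸 l) := by
  let _ : NormedAlgebra ℚ 𝔸 := NormedAlgebra.restrictScalars ℚ ℂ 𝔸
  obtain ⟨y, hy, h⟩ := exists_exp_sub_one_eq_mul (x - algebraMap ℂ 𝔸 l)
  have hl : Commute (algebraMap ℂ 𝔸 l) (x - algebraMap ℂ 𝔸 l) := Algebra.commutes l _
  have hyx : Commute y x := by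
    have := hy.add_right (Algebra.commutes l y).symm
    rwa [sub_add_cancel] at this
  refine ⟨algebraMap ℂ 𝔸 (Complex.exp l) * y, Commute.mul_left (Algebra.commutes _ _) hyx, ?_⟩
  rw [mul_assoc, ← h, mul_sub, mul_one, Complex.exp_eq_exp_ℂ, NormedSpace.algebraMap_exp_comm,
    ← NormedSpace.exp_add_of_commute hl, add_sub_cancel]

/-- The product of the `exp x - exp l` is a multiple of the product of the `x - l`; in particular it
vanishes if the latter does. -/
lemma aeval_exp_prod (x : 𝔸) (s : Multiset ℂ) :
    ∃ y : 𝔸, Commute y x ∧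
      aeval (NormedSpace.exp x) (s.map fun l => X - C (Complex.exp l)).prod
        = y * aeval x (s.map fun l => X - C l).prod := by
  induction s using Multiset.induction_on with
  | empty => exact ⟨1, Commute.one_left x, by simp⟩
  | cons l s ih =>
    obtain ⟨y, hy, h⟩ := ih
    obtain ⟨w, hw, h2⟩ := exists_exp_sub_exp_eq_mul x l
    refine ⟨w * y, hw.mul_left hy, ?_⟩
    simp only [Multiset.map_cons, Multiset.prod_cons, map_mul, map_sub, aeval_X, aeval_C]
    rw [h, h2, mul_assoc, mul_assoc, ← mul_assoc (x - _) y, ← mul_assoc y (x - _),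
      (hy.sub_right (Algebra.commutes l y).symm).eq]

end Algebra

lemma natDegree_prod_one_sub_le (s : Multiset ℂ) :
    (s.map fun w => 1 - C w * X).prod.natDegree ≤ s.card := by
  induction s using Multiset.induction_on with
  | empty => simp
  | cons w s ih =>
    rw [Multiset.map_cons, Multiset.prod_cons, Multiset.card_cons, add_comm]
    refine natDegree_mul_le.trans (add_le_add ?_ ih)
    compute_degree

lemma reflect_prod_one_sub (s : Multiset ℂ) :
    reflect s.card (s.map fun w => 1 - C w * X).prod = (s.map fun w => X - C w).prod := by
  induction s using Multiset.induction_on with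
  | empty => simp
  | cons w s ih =>
    rw [Multiset.map_cons, Multiset.prod_cons, Multiset.card_cons, add_comm,
      reflect_mul _ _ _ (natDegree_prod_one_sub_le s), ih, Multiset.map_cons, Multiset.prod_cons]
    · congr 1
      rw [reflect_sub, reflect_C_mul, ← C_1, reflect_C, pow_one, C_1, one_mul]
      have : reflect 1 (X : ℂ[X]) = 1 := by
        simp
      rw [this, mul_one]
    · compute_degree

lemma sum_coeff_smul_pow_eq_aeval {𝔸 : Type*} [Ring 𝔸] [Algebra ℂ 𝔸] (s : Multiset ℂ) (x : 𝔸) :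
    ∑ j ∈ Finset.range (s.card + 1), ((s.map fun w => 1 - C w * X).prod).coeff j • x ^ (s.card - j)
      = aeval x (s.map fun w => X - C w).prod := by
  rw [← reflect_prod_one_sub, aeval_eq_sum_range' (n := s.card + 1)
    (lt_of_le_of_lt natDegree_reflect_le (by
      rw [max_eq_left (natDegree_prod_one_sub_le s)]; exact Nat.lt_succ_self _)),
    ← Finset.sum_range_reflect]
  refine Finset.sum_congr rfl fun j hj => ?_
  have hj' := Finset.mem_range.1 hj
  rw [coeff_reflect, revAt_le (by omega), show s.card - (s.card + 1 - 1 - j) = j by omega,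
    show s.card + 1 - 1 - j = s.card - j by omega]

/-! ### The state matrix -/

/-- The state matrix of a CARMA process as an operator on `𝕜 ^ p`. -/
noncomputable def carmaOp (𝕜 : Type*) [RCLike 𝕜] (p : ℕ) (a : ℝ[X]) :
    (Fin p → 𝕜) →L[𝕜] (Fin p → 𝕜) :=
  LinearMap.toContinuousLinearMap
    (Matrix.mulVecLin ((carmaMatrix p a).map (algebraMap ℝ 𝕜)))

section CarmaOp

variable {𝕜 : Type*} [RCLike 𝕜] {p : ℕ} {a : ℝ[X]}

lemma carmaOp_apply (v : Fin p → 𝕜) (i : Fin p) :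
    carmaOp 𝕜 p a v i = ∑ j, algebraMap ℝ 𝕜 (carmaMatrix p a i j) * v j := by
  simp [carmaOp, Matrix.mulVec, dotProduct]

lemma carmaOp_real_apply (v : Fin p → ℝ) : carmaOp ℝ p a v = (carmaMatrix p a).mulVec v := by
  ext i; simp [carmaOp_apply, Matrix.mulVec, dotProduct]

lemma carmaOp_apply_of_lt (v : Fin p → 𝕜) {i : ℕ} (hi : i + 1 < p) :
    carmaOp 𝕜 p a v ⟨i, by omega⟩ = v ⟨i + 1, hi⟩ := by
  rw [carmaOp_apply, Finset.sum_eq_single ⟨i + 1, hi⟩]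
  · simp [carmaMatrix, hi.ne]
  · intro j _ hj
    have : (j : ℕ) ≠ i + 1 := fun h => hj (Fin.ext h)
    simp [carmaMatrix, hi.ne, this]
  · simp

lemma carmaOp_apply_last (v : Fin p → 𝕜) {i : ℕ} (hi : i + 1 = p) :
    carmaOp 𝕜 p a v ⟨i, by omega⟩ = -∑ j : Fin p, algebraMap ℝ 𝕜 (a.coeff j) * v j := by
  rw [carmaOp_apply, ← Finset.sum_neg_distrib]
  refine Finset.sum_congr rfl fun j _ => ?_
  simp [carmaMatrix, hi]

lemma carmaOp_pow_apply_zero {k : ℕ} (hk : k < p) (v : Fin p → 𝕜) :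
    (carmaOp 𝕜 p a ^ k) v ⟨0, by omega⟩ = v ⟨k, hk⟩ := by
  induction k generalizing v with
  | zero => simp
  | succ k ih =>
    rw [pow_succ, mul_apply_eq_comp, ih (by omega), carmaOp_apply_of_lt]

/-- The Cayley-Hamilton identity `a(A) = 0` for the state matrix. -/
lemma aeval_carmaOp (hp : 0 < p) (ha : a.Monic) (hap : a.natDegree = p) :
    aeval (carmaOp 𝕜 p a) (a.map (algebraMap ℝ 𝕜)) = 0 := by
  set A := carmaOp 𝕜 p a with hA
  have h0 : ∀ v : Fin p → 𝕜, (aeval A (a.map (algebraMap ℝ 𝕜))) v ⟨0, hp⟩ = 0 := by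
    intro v
    rw [aeval_eq_sum_range, natDegree_map, hap, Finset.sum_range_succ]
    have h1 : (a.map (algebraMap ℝ 𝕜)).coeff p = 1 := by
      rw [coeff_map, ← hap, ha.coeff_natDegree, map_one]
    obtain ⟨m, rfl⟩ : ∃ m, p = m + 1 := ⟨p - 1, by omega⟩
    have h2 : (A ^ (m + 1)) v ⟨0, hp⟩
        = -∑ j : Fin (m + 1), algebraMap ℝ 𝕜 (a.coeff j) * v j := by
      rw [pow_succ, mul_apply_eq_comp, carmaOp_pow_apply_zero (Nat.lt_succ_self m),
        carmaOp_apply_last v rfl]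
    rw [h1, one_smul, add_apply, Pi.add_apply, h2, Finset.sum_range, sum_apply, Finset.sum_apply,
      ← sub_eq_add_neg, sub_eq_zero]
    refine Finset.sum_congr rfl fun j _ => ?_
    rw [smul_apply, Pi.smul_apply, carmaOp_pow_apply_zero j.2, coeff_map, smul_eq_mul]
  ext v i
  have hc : Commute (A ^ (i : ℕ)) (aeval A (a.map (algebraMap ℝ 𝕜))) :=
    by simpa using (Commute.all (X ^ (i : ℕ)) (a.map (algebraMap ℝ 𝕜))).map (aeval A)
  rw [← carmaOp_pow_apply_zero (a := a) i.2 (aeval A (a.map (algebraMap ℝ 𝕜)) v), ← hA,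
    ← mul_apply_eq_comp, hc.eq, mul_apply_eq_comp, h0]
  rfl

end CarmaOp

/-- A linear map intertwining two bounded operators intertwines their exponentials. -/
lemma intertwine_exp {V W : Type*} [NormedAddCommGroup V] [NormedSpace ℝ V] [CompleteSpace V]
    [NormedAddCommGroup W] [NormedSpace ℂ W] [NormedSpace ℝ W] [IsScalarTower ℝ ℂ W]
    [CompleteSpace W] (T : V →L[ℝ] W)
    {A : V →L[ℝ] V} {B : W →L[ℂ] W} (h : ∀ v, T (A v) = B (T v)) (v : V) :
    T (NormedSpace.exp A v) = NormedSpace.exp B (T v) := by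
  have hpow : ∀ n v, T ((A ^ n) v) = (B ^ n) (T v) := by
    intro n
    induction n with
    | zero => simp
    | succ n ih => intro v; rw [pow_succ, mul_apply_eq_comp, ih, h, pow_succ, mul_apply_eq_comp]
  have h1 := (NormedSpace.exp_series_hasSum_exp' (𝕂 := ℝ) A).mapL
    (T.comp (ContinuousLinearMap.apply ℝ V v))
  have h2 := (NormedSpace.exp_series_hasSum_exp' (𝕂 := ℂ) B).mapL
    (ContinuousLinearMap.apply ℂ W (T v))
  refine h1.unique ?_
  change HasSum _ (ContinuousLinearMap.apply ℂ W (T v) (NormedSpace.exp B))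
  convert h2 using 2 with n
  change T (((n.factorial : ℝ)⁻¹ • A ^ n) v) = ((n.factorial : ℂ)⁻¹ • B ^ n) (T v)
  rw [smul_apply, map_smul, hpow, smul_apply, inv_natCast_smul_eq ℝ ℂ]

/-- The coefficients of the filter polynomial are real, because the zeroes of `a` come in conjugate
pairs. -/
lemma exists_real_arFilter (a : ℝ[X]) (Δ : ℝ) :
    ∃ φ : ℝ[X], φ.map (algebraMap ℝ ℂ) = arFilter a Δ := by
  have hroots : (a.aroots ℂ).map (starRingEnd ℂ) = a.aroots ℂ := by
    have h := (IsAlgClosed.splits (a.map (algebraMap ℝ ℂ))).roots_map (starRingEnd ℂ)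
    rw [Polynomial.map_map] at h
    have h2 : (starRingEnd ℂ).comp (algebraMap ℝ ℂ) = algebraMap ℝ ℂ := by ext x; simp
    rw [h2] at h
    exact h.symm
  have hconj : (arFilter a Δ).map (starRingEnd ℂ) = arFilter a Δ := by
    rw [arFilter, Polynomial.map_multiset_prod, Multiset.map_map]
    conv_rhs => rw [← hroots, Multiset.map_map]
    congr 1
    refine Multiset.map_congr rfl fun l _ => ?_
    simp [← Complex.exp_conj]
  have hlift : arFilter a Δ ∈ Polynomial.lifts (algebraMap ℝ ℂ) := by
    rw [lifts_iff_coeff_lifts]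
    intro n
    have : (starRingEnd ℂ) ((arFilter a Δ).coeff n) = (arFilter a Δ).coeff n := by
      conv_rhs => rw [← hconj, coeff_map]
    obtain ⟨r, hr⟩ := Complex.conj_eq_iff_real.1 this
    exact ⟨r, by rw [hr]; rfl⟩
  obtain ⟨φ, hφ⟩ := (mem_lifts _).1 hlift
  exact ⟨φ, hφ⟩

lemma card_aroots (a : ℝ[X]) : (a.aroots ℂ).card = a.natDegree := by
  rw [aroots_def, ← (IsAlgClosed.splits (a.map (algebraMap ℝ ℂ))).natDegree_eq_card_roots,
    natDegree_map]

lemma arFilter_eq (a : ℝ[X]) (Δ : ℝ) : arFilter a Δ =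
    (((a.aroots ℂ).map fun l => Complex.exp (l * Δ)).map fun w => 1 - C w * X).prod := by
  rw [arFilter, Multiset.map_map]; rfl

lemma natDegree_le_of_map_eq_arFilter {a φ : ℝ[X]} {Δ : ℝ}
    (hφ : φ.map (algebraMap ℝ ℂ) = arFilter a Δ) : φ.natDegree ≤ a.natDegree := by
  rw [← natDegree_map (algebraMap ℝ ℂ), hφ, arFilter_eq, ← card_aroots a]
  exact (natDegree_prod_one_sub_le _).trans (by simp)

lemma aeval_smul_prod {𝔸 : Type*} [Ring 𝔸] [Algebra ℂ 𝔸] (x : 𝔸) (c : ℂ) (s : Multiset ℂ) :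
    aeval (c • x) ((s.map fun l => l * c).map fun l => X - C l).prod
      = c ^ s.card • aeval x (s.map fun l => X - C l).prod := by
  induction s using Multiset.induction_on with
  | empty => simp
  | cons l s ih =>
    simp only [Multiset.map_cons, Multiset.prod_cons, map_mul, Multiset.card_cons, ih,
      map_sub, aeval_X, aeval_C]
    have : c • x - algebraMap ℂ 𝔸 l * algebraMap ℂ 𝔸 c = c • (x - algebraMap ℂ 𝔸 l) := by
      rw [smul_sub, ← map_mul, mul_comm l c, map_mul, ← Algebra.smul_def]
    rw [this, smul_mul_smul_comm, pow_succ']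

/-- The autoregressive filter annihilates the sampled flow of the homogeneous state equation. -/
lemma sum_arFilter_smul_flow {p : ℕ} (hp : 0 < p) {a φ : ℝ[X]} (ha : a.Monic)
    (hap : a.natDegree = p) {Δ : ℝ} (hφ : φ.map (algebraMap ℝ ℂ) = arFilter a Δ) :
    ∑ j ∈ Finset.range (p + 1), φ.coeff j • flow (carmaOp ℝ p a) Δ ^ (p - j) = 0 := by
  set A := carmaOp ℝ p a
  set B := (Δ : ℂ) • carmaOp ℂ p a with hB
  have hcard : (a.aroots ℂ).card = p := by rw [card_aroots, hap]
  -- the complex version of the claim, from the factorization of `a(A) = 0`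
  have hcomplex : ∑ j ∈ Finset.range (p + 1), (φ.coeff j : ℂ) • NormedSpace.exp B ^ (p - j) = 0 := by
    obtain ⟨y, -, hy⟩ := aeval_exp_prod B ((a.aroots ℂ).map fun l => l * (Δ : ℂ))
    have h1 := sum_coeff_smul_pow_eq_aeval ((a.aroots ℂ).map fun l => Complex.exp (l * Δ))
      (NormedSpace.exp B)
    rw [← arFilter_eq, ← hφ, Multiset.card_map, hcard] at h1
    simp only [coeff_map, Complex.coe_algebraMap] at h1
    rw [h1, Multiset.map_map]
    rw [Multiset.map_map] at hy
    refine hy.trans ?_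
    rw [hB, aeval_smul_prod, hcard, aroots_def, ← (IsAlgClosed.splits
      (a.map (algebraMap ℝ ℂ))).eq_prod_roots_of_monic (ha.map _), aeval_carmaOp hp ha hap]
    simp
  set T : (Fin p → ℝ) →L[ℝ] (Fin p → ℂ) :=
    ContinuousLinearMap.pi fun i => Complex.ofRealCLM.comp (ContinuousLinearMap.proj i) with hT
  have hTapp : ∀ v i, T v i = (v i : ℂ) := fun v i => rfl
  have hTA : ∀ v, T ((Δ • A) v) = B (T v) := by
    intro v
    ext i
    simp [hTapp, hB, A, carmaOp_apply]
  have hTM : ∀ k v, T ((flow A Δ ^ k) v) = (NormedSpace.exp B ^ k) (T v) := by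
    intro k
    induction k with
    | zero => simp
    | succ k ih =>
      intro v
      rw [pow_succ, mul_apply_eq_comp, ih, flow, intertwine_exp T hTA, pow_succ, mul_apply_eq_comp]
  ext v i
  have h3 : T ((∑ j ∈ Finset.range (p + 1), φ.coeff j • flow A Δ ^ (p - j)) v) = 0 := by
    have := congrArg (fun M : (Fin p → ℂ) →L[ℂ] (Fin p → ℂ) => M (T v)) hcomplex
    simp only [sum_apply, smul_apply, zero_apply] at this
    rw [← this, sum_apply, map_sum]
    refine Finset.sum_congr rfl fun j _ => ?_
    rw [smul_apply, map_smul, hTM]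
    ext i; simp
  have h4 := congrFun h3 i
  rw [hTapp] at h4
  exact Complex.ofReal_eq_zero.1 h4

/-! ### The filtered sample as a finite moving average of Lévy increments -/

section Filtering

variable {V : Type*} [NormedAddCommGroup V] [NormedSpace ℝ V]

/-- The truncated product `∑_{j ≤ k} φ_j M ^ (k - j)` of the filter `φ(B)` with the resolvent
series `∑_i M ^ i B ^ i`. -/
noncomputable def truncatedFilter (φ : ℝ[X]) (M : V →L[ℝ] V) (k : ℕ) : V →L[ℝ] V :=
  ∑ j ∈ Finset.range (k + 1), φ.coeff j • M ^ (k - j)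

lemma truncatedFilter_succ (φ : ℝ[X]) (M : V →L[ℝ] V) (k : ℕ) :
    truncatedFilter φ M (k + 1) = truncatedFilter φ M k * M + φ.coeff (k + 1) • 1 := by
  rw [truncatedFilter, Finset.sum_range_succ, truncatedFilter, Finset.sum_mul]
  congr 1
  · refine Finset.sum_congr rfl fun j hj => ?_
    rw [smul_mul_assoc, ← pow_succ, show k - j + 1 = k + 1 - j by
      have := Finset.mem_range.1 hj; omega]
  · simp

/-- Filtering an autoregression `x_n = M x_{n-1} + ξ_n` with `φ(B)`. -/
lemma sum_coeff_smul_eq (φ : ℝ[X]) (M : V →L[ℝ] V) (x : ℤ → V) (n : ℤ) (N : ℕ) :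
    ∑ j ∈ Finset.range (N + 1), φ.coeff j • x (n - j) =
      (∑ k ∈ Finset.range N, truncatedFilter φ M k (x (n - k) - M (x (n - k - 1))))
        + truncatedFilter φ M N (x (n - N)) := by
  induction N with
  | zero => simp [truncatedFilter]
  | succ N ih =>
    rw [Finset.sum_range_succ, ih, Finset.sum_range_succ, truncatedFilter_succ]
    simp only [map_sub, add_apply, mul_apply_eq_comp, smul_apply, one_apply_eq_self]
    push_cast
    rw [show n - ((N : ℤ) + 1) = n - N - 1 by ring]
    abel

end Filtering

/-- The functional `v ↦ bᵀ v` of the observation equation. -/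
noncomputable def observation (p : ℕ) (b : ℝ[X]) : (Fin p → ℝ) →L[ℝ] ℝ :=
  ∑ i : Fin p, b.coeff i • ContinuousLinearMap.proj i

lemma observation_apply (p : ℕ) (b : ℝ[X]) (v : Fin p → ℝ) :
    observation p b v = ∑ i : Fin p, b.coeff i * v i := by
  simp [observation, sum_apply]

/-- The functional multiplying the noise of lag `k` in the filtered sample. -/
noncomputable def filteredObservation (p : ℕ) (a b φ : ℝ[X]) (Δ : ℝ) (k : ℕ) :
    (Fin p → ℝ) →L[ℝ] ℝ :=
  (observation p b).comp (truncatedFilter φ (flow (carmaOp ℝ p a) Δ) k)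

/-- The kernel against which the Lévy process is integrated over the interval of lag `k`. -/
noncomputable def filteredKernel (p : ℕ) (a b φ : ℝ[X]) (Δ : ℝ) (k : ℕ) (s : ℝ) : ℝ :=
  filteredObservation p a b φ Δ k (flow (carmaOp ℝ p a) s (lastVec p))

/-- The derivative of the kernel `filteredKernel`. -/
noncomputable def filteredKernelDeriv (p : ℕ) (a b φ : ℝ[X]) (Δ : ℝ) (k : ℕ) (s : ℝ) : ℝ :=
  filteredObservation p a b φ Δ k (flow (carmaOp ℝ p a) s (carmaOp ℝ p a (lastVec p)))

lemma lastVec_ne_zero {p : ℕ} (hp : 0 < p) : lastVec p ≠ 0 := by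
  intro h
  have := congrFun h ⟨p - 1, by omega⟩
  simp [lastVec, Nat.sub_add_cancel hp] at this

lemma SolvesStateEquation.vector {Ω : Type*} [MeasurableSpace Ω] {μ : Measure Ω} {p : ℕ} {a : ℝ[X]}
    {L : ℝ → Ω → ℝ} {X : ℝ → Ω → Fin p → ℝ} (h : SolvesStateEquation μ p a L X) :
    ∀ᵐ ω ∂μ, (∀ s t, IntervalIntegrable (fun u => X u ω) volume s t) ∧
      ∀ s t, X t ω - X s ω = (∫ u in s..t, carmaOp ℝ p a (X u ω))
        + (L t ω - L s ω) • lastVec p := by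
  filter_upwards [h] with ω hω
  have hint : ∀ s t, IntervalIntegrable (fun u => X u ω) volume s t := fun s t =>
    ⟨Integrable.of_eval fun i => ((hω s t).1 i).1, Integrable.of_eval fun i => ((hω s t).1 i).2⟩
  refine ⟨hint, fun s t => ?_⟩
  have hAint : IntervalIntegrable (fun u => carmaOp ℝ p a (X u ω)) volume s t :=
    ⟨(carmaOp ℝ p a).integrable_comp (hint s t).1, (carmaOp ℝ p a).integrable_comp (hint s t).2⟩
  ext i
  have h1 := (hω s t).2 i
  have h2 := (ContinuousLinearMap.proj (R := ℝ) (φ := fun _ : Fin p => ℝ) i).intervalIntegral_comp_comm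
    hAint
  simp only [ContinuousLinearMap.proj_apply, carmaOp_real_apply] at h2
  simp only [Pi.sub_apply, Pi.add_apply, Pi.smul_apply, smul_eq_mul, carmaOp_real_apply, ← h2]
  exact h1

/-- Almost surely, the filtered sample is a finite moving average of integrals with respect to the
Lévy process over disjoint intervals. -/
lemma IsCARMA.filteredSample_eq {Ω : Type*} [MeasurableSpace Ω] {μ : Measure Ω}
    [IsProbabilityMeasure μ] {σ : ℝ} {L Y : ℝ → Ω → ℝ} (hL : IsSecondOrderLevy μ σ L)
    {p : ℕ} (hp : 0 < p) {a b φ : ℝ[X]} (ha : a.Monic) (hap : a.natDegree = p)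
    (hY : IsCARMA μ p a b L Y) {Δ : ℝ} (hΔ : 0 < Δ)
    (hφ : φ.map (algebraMap ℝ ℂ) = arFilter a Δ) (n : ℤ) :
    ∀ᵐ ω ∂μ, filteredSample a Y Δ n ω = ((∑ k ∈ Finset.range p,
      partsIntegral (fun u => filteredKernel p a b φ Δ k ((n - k : ℤ) * Δ - u))
        (fun u => -filteredKernelDeriv p a b φ Δ k ((n - k : ℤ) * Δ - u))
        (fun u => L u ω) ((n - k - 1 : ℤ) * Δ) ((n - k : ℤ) * Δ) : ℝ) : ℂ) := by
  obtain ⟨-, X, -, hX, hYX⟩ := hY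
  set A := carmaOp ℝ p a with hA
  have hYX' : ∀ᵐ ω ∂μ, ∀ m : ℤ, Y (m * Δ) ω = observation p b (X (m * Δ) ω) := by
    refine ae_all_iff.2 fun m => ?_
    filter_upwards [hYX (m * Δ)] with ω hω
    rw [hω, observation_apply]
  filter_upwards [hYX', hX.vector, hL.cadlag] with ω h1 h2 h3
  -- one step of the autoregression satisfied by the sampled state
  have hstep : ∀ (c : (Fin p → ℝ) →L[ℝ] ℝ) (m : ℤ),
      c (X (m * Δ) ω - flow A Δ (X ((m - 1 : ℤ) * Δ) ω)) =
        partsIntegral (fun u => c (flow A (m * Δ - u) (lastVec p)))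
          (fun u => -c (flow A (m * Δ - u) (A (lastVec p)))) (fun u => L u ω)
          ((m - 1 : ℤ) * Δ) (m * Δ) := by
    intro c m
    have := variation_of_constants (lastVec_ne_zero hp) (fun t => (h3 t).1) h2.1 h2.2 c
      (s := (m - 1 : ℤ) * Δ) (t := m * Δ) (by push_cast; nlinarith)
    rw [show (m : ℝ) * Δ - (m - 1 : ℤ) * Δ = Δ by push_cast; ring] at this
    rw [map_sub, this]
    ring
  have hsum := sum_coeff_smul_eq φ (flow A Δ) (fun m : ℤ => X (m * Δ) ω) n p
  have hzero : truncatedFilter φ (flow A Δ) p = 0 := sum_arFilter_smul_flow hp ha hap hφ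
  rw [hzero, zero_apply, add_zero] at hsum
  have hsum2 := congrArg (observation p b) hsum
  rw [map_sum, map_sum] at hsum2
  rw [filteredSample, shiftFilter, ← hφ, sum_over_range' _ (by simp) (p + 1)
    (by rw [natDegree_map]; exact Nat.lt_succ_of_le ((natDegree_le_of_map_eq_arFilter hφ).trans
      hap.le))]
  simp only [coeff_map, Complex.coe_algebraMap, h1]
  have : ∀ k, partsIntegral (fun u => filteredKernel p a b φ Δ k ((n - k : ℤ) * Δ - u))
        (fun u => -filteredKernelDeriv p a b φ Δ k ((n - k : ℤ) * Δ - u))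
        (fun u => L u ω) ((n - k - 1 : ℤ) * Δ) ((n - k : ℤ) * Δ)
      = observation p b (truncatedFilter φ (flow A Δ) k
        (X ((n - k : ℤ) * Δ) ω - flow A Δ (X ((n - k - 1 : ℤ) * Δ) ω))) := by
    intro k
    exact (hstep (filteredObservation p a b φ Δ k) (n - k)).symm
  simp only [this]
  rw [← hsum2]
  push_cast
  refine Finset.sum_congr rfl fun j _ => ?_
  rw [map_smul, smul_eq_mul]
  push_cast
  rfl

/-- The inner products `∫_0^Δ g_i g_j` of the kernels of the filtered sample. -/
noncomputable def kernelGram (p : ℕ) (a b φ : ℝ[X]) (Δ : ℝ) (i j : ℕ) : ℝ :=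
  ∫ s in (0 : ℝ)..Δ, filteredKernel p a b φ Δ i s * filteredKernel p a b φ Δ j s

lemma hasDerivAt_filteredKernel_sub (p : ℕ) (a b φ : ℝ[X]) (Δ : ℝ) (k : ℕ) (t u : ℝ) :
    HasDerivAt (fun u => filteredKernel p a b φ Δ k (t - u))
      (-filteredKernelDeriv p a b φ Δ k (t - u)) u := by
  have h := (hasDerivAt_kernel (carmaOp ℝ p a) (filteredObservation p a b φ Δ k) (lastVec p)
    (t - u)).scomp u ((hasDerivAt_id u).const_sub t)
  exact h.congr_deriv (by simp [filteredKernelDeriv])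

lemma continuous_filteredKernel (p : ℕ) (a b φ : ℝ[X]) (Δ : ℝ) (k : ℕ) :
    Continuous (filteredKernel p a b φ Δ k) :=
  continuous_kernel _ _ _

lemma integral_eq_inner_one {Ω : Type*} [MeasurableSpace Ω] {μ : Measure Ω}
    [IsProbabilityMeasure μ] (z : Lp ℝ 2 μ) :
    ∫ ω, z ω ∂μ = inner ℝ ((memLp_const (1 : ℝ)).toLp fun _ : Ω => (1 : ℝ)) z := by
  rw [L2.inner_def]
  refine integral_congr_ae ?_
  filter_upwards [(memLp_const (μ := μ) (p := 2) (1 : ℝ)).coeFn_toLp] with ω h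
  rw [h]; simp

/-- The filtered sample, as a sequence in `L²`: it is centred, and its covariances are those of a
moving average of order less than `p` in vector-valued white noise. -/
lemma IsCARMA.exists_L2 {Ω : Type*} [MeasurableSpace Ω] {μ : Measure Ω}
    [IsProbabilityMeasure μ] {σ : ℝ} {L Y : ℝ → Ω → ℝ} (hL : IsSecondOrderLevy μ σ L)
    {p : ℕ} (hp : 0 < p) {a b φ : ℝ[X]} (ha : a.Monic) (hap : a.natDegree = p)
    (hY : IsCARMA μ p a b L Y) {Δ : ℝ} (hΔ : 0 < Δ)
    (hφ : φ.map (algebraMap ℝ ℂ) = arFilter a Δ) :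
    ∃ w : ℤ → Lp ℝ 2 μ, (∀ n, ∀ᵐ ω ∂μ, filteredSample a Y Δ n ω = ((w n ω : ℝ) : ℂ)) ∧
      (∀ n, ∫ ω, w n ω ∂μ = 0) ∧
      ∀ m n : ℤ, inner ℝ (w m) (w n) = ∑ i ∈ Finset.range p, ∑ j ∈ Finset.range p,
        if m - i = n - j then σ ^ 2 * kernelGram p a b φ Δ i j else 0 := by
  have hlt : ∀ m : ℤ, (((m - 1 : ℤ) : ℝ)) * Δ < m * Δ := by
    intro m; push_cast; nlinarith
  have hder := hasDerivAt_filteredKernel_sub p a b φ Δ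
  have hcont : ∀ (k : ℕ) (t : ℝ), Continuous fun u => -filteredKernelDeriv p a b φ Δ k (t - u) :=
    fun k t => ((continuous_kernel _ _ _).comp (continuous_const.sub continuous_id)).neg
  choose y hy1 hy2 using fun (k : ℕ) (m : ℤ) =>
    hL.exists_levyIntegral (hder k (m * Δ)) (hcont k (m * Δ)) (hlt m)
  have horth := hL.hasOrthogonalIncrements
  have hinner : ∀ i j m m', inner ℝ (y i m) (y j m')
      = if m = m' then σ ^ 2 * kernelGram p a b φ Δ i j else 0 := by
    intro i j m m'
    have hle : ∀ {m m' : ℤ}, m < m' → (m : ℝ) * Δ ≤ ((m' - 1 : ℤ) : ℝ) * Δ := by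
      intro m m' h
      refine mul_le_mul_of_nonneg_right ?_ hΔ.le
      exact_mod_cast (by omega : m ≤ m' - 1)
    split_ifs with h
    · subst h
      rw [horth.inner_limit (hder i (m * Δ)) (hcont i _) (hder j (m * Δ)) (hcont j _) (hlt m)
        (hy1 i m) (hy1 j m), kernelGram]
      congr 1
      rw [intervalIntegral.integral_comp_sub_left (fun s => filteredKernel p a b φ Δ i s
        * filteredKernel p a b φ Δ j s)]
      congr 1 <;> push_cast <;> ring
    · rcases lt_or_gt_of_ne h with h | h
      · exact horth.inner_limit_eq_zero (hlt m).le (hle h) (hlt m').le (hy1 i m) (hy1 j m')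
      · rw [real_inner_comm]
        exact horth.inner_limit_eq_zero (hlt m').le (hle h) (hlt m).le (hy1 j m') (hy1 i m)
  have hone : MemLp (fun _ : Ω => (1 : ℝ)) 2 μ := memLp_const 1
  have hmean : ∀ z : Lp ℝ 2 μ, ∫ ω, z ω ∂μ = inner ℝ (hone.toLp _) z := integral_eq_inner_one
  have hmeanL : ∀ t, inner ℝ (hone.toLp _) (hL.toL2 t) = 0 := by
    intro t
    rw [IsSecondOrderLevy.toL2, inner_toLp]
    simpa using hL.mean_zero t
  have hymean : ∀ k m, inner ℝ (hone.toLp _) (y k m) = 0 := by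
    intro k m
    have h := (tendsto_const_nhds (x := hone.toLp _)).inner (𝕜 := ℝ) (hy1 k m)
    refine tendsto_nhds_unique h ?_
    simp only [dyadicSum, inner_sum, inner_smul_right, inner_sub_right, hmeanL, sub_self, mul_zero,
      Finset.sum_const_zero]
    exact tendsto_const_nhds
  refine ⟨fun n => ∑ k ∈ Finset.range p, y k (n - k), fun n => ?_, fun n => ?_, fun m n => ?_⟩
  · have h2 : ∀ᵐ ω ∂μ, ∀ k : ℕ, y k (n - k) ω = _ := ae_all_iff.2 fun k : ℕ => hy2 k (n - k)
    filter_upwards [hY.filteredSample_eq hL hp ha hap hΔ hφ n, h2,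
      Lp.coeFn_fun_finsetSum (Finset.range p) fun k : ℕ => y k (n - k)] with ω e1 e2 e3
    rw [e1, e3]
    simp only [e2]
  · rw [hmean, inner_sum]
    exact Finset.sum_eq_zero fun k _ => hymean _ _
  · simp only [sum_inner, inner_sum, hinner]
    rw [Finset.sum_comm]

/-! ### Wold decomposition of a stationary sequence with finite memory -/

section Wold

variable {H : Type*} [NormedAddCommGroup H] [InnerProductSpace ℝ H]

/-- The linear map `g ↦ g(B) x_n`, where `B` is the backward shift. -/
noncomputable def seqFilter (x : ℤ → H) (n : ℤ) : ℝ[X] →ₗ[ℝ] H :=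
  Polynomial.lsum fun j => LinearMap.toSpanSingleton ℝ H (x (n - j))

lemma seqFilter_apply (x : ℤ → H) (n : ℤ) (g : ℝ[X]) :
    seqFilter x n g = g.sum fun j c => c • x (n - j) := by
  simp [seqFilter, Polynomial.lsum_apply]

lemma seqFilter_monomial (x : ℤ → H) (n : ℤ) (j : ℕ) (c : ℝ) :
    seqFilter x n (monomial j c) = c • x (n - j) := by
  rw [seqFilter_apply, sum_monomial_index _ _ (by simp)]

lemma seqFilter_one (x : ℤ → H) (n : ℤ) : seqFilter x n 1 = x n := by
  have := seqFilter_monomial x n 0 1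
  simpa using this

lemma seqFilter_X_pow_mul (x : ℤ → H) (n : ℤ) (k : ℕ) (g : ℝ[X]) :
    seqFilter x n (X ^ k * g) = seqFilter x (n - k) g := by
  induction g using Polynomial.induction_on' with
  | add f g hf hg => rw [mul_add, map_add, map_add, hf, hg]
  | monomial j c =>
    rw [X_pow_mul_monomial, seqFilter_monomial, seqFilter_monomial]
    congr 2; push_cast; ring

lemma seqFilter_X_mul (x : ℤ → H) (n : ℤ) (g : ℝ[X]) :
    seqFilter x n (X * g) = seqFilter x (n - 1) g := by
  simpa using seqFilter_X_pow_mul x n 1 g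

lemma seqFilter_mul {x z : ℤ → H} {θ : ℝ[X]} (h : ∀ n, x n = seqFilter z n θ) (n : ℤ) (f : ℝ[X]) :
    seqFilter x n f = seqFilter z n (f * θ) := by
  induction f using Polynomial.induction_on' with
  | add f g hf hg => rw [add_mul, map_add, map_add, hf, hg]
  | monomial j c =>
    rw [seqFilter_monomial, ← C_mul_X_pow_eq_monomial, mul_assoc, ← smul_eq_C_mul, map_smul,
      seqFilter_X_pow_mul, h]

/-- Stationarity of the second moments is inherited by filtered sequences. -/
lemma inner_seqFilter_add {x : ℤ → H} (hx : ∀ m n k, inner ℝ (x (m + k)) (x (n + k))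
    = inner ℝ (x m) (x n)) (m n k : ℤ) (f g : ℝ[X]) :
    inner ℝ (seqFilter x (m + k) f) (seqFilter x (n + k) g)
      = inner ℝ (seqFilter x m f) (seqFilter x n g) := by
  simp only [seqFilter_apply, Polynomial.sum, sum_inner, inner_sum, inner_smul_left,
    inner_smul_right]
  refine Finset.sum_congr rfl fun i _ => ?_
  congr 1
  refine Finset.sum_congr rfl fun j _ => ?_
  rw [← hx (m - j) (n - i) k]
  congr 4 <;> ring

lemma norm_sq_seqFilter {z : ℤ → H} {v : ℝ}
    (hz : ∀ m n, inner ℝ (z m) (z n) = if m = n then v else 0) (n : ℤ) (g : ℝ[X]) :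
    ‖seqFilter z n g‖ ^ 2 = v * ∑ i ∈ g.support, g.coeff i ^ 2 := by
  rw [← real_inner_self_eq_norm_sq]
  simp only [seqFilter_apply, Polynomial.sum, sum_inner, inner_sum, inner_smul_left,
    inner_smul_right, hz, Finset.mul_sum]
  refine Finset.sum_congr rfl fun i hi => ?_
  rw [Finset.sum_eq_single_of_mem i hi]
  · simp; ring
  · intro j _ hj
    rw [if_neg]
    · simp
    · intro h; exact hj (by omega)

/-- The square sum of the coefficients controls the values of a polynomial in the unit disc. -/
lemma norm_aeval_sq_mul_le (g : ℝ[X]) {w : ℂ} (hw : ‖w‖ < 1) :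
    ‖aeval w g‖ ^ 2 * (1 - ‖w‖ ^ 2) ≤ ∑ i ∈ g.support, g.coeff i ^ 2 := by
  have h0 : ‖w‖ ^ 2 < 1 := by nlinarith [norm_nonneg w]
  have h1 : ‖aeval w g‖ ≤ ∑ i ∈ g.support, |g.coeff i| * ‖w‖ ^ i := by
    rw [aeval_def, eval₂_eq_sum, Polynomial.sum]
    refine (norm_sum_le _ _).trans (Finset.sum_le_sum fun i _ => ?_)
    simp
  have h2 := Finset.sum_mul_sq_le_sq_mul_sq g.support (fun i => |g.coeff i|) fun i => ‖w‖ ^ i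
  have h3 : ∑ i ∈ g.support, (‖w‖ ^ i) ^ 2 ≤ (1 - ‖w‖ ^ 2)⁻¹ := by
    simp only [← pow_mul, mul_comm _ 2]
    simp only [pow_mul]
    exact sum_le_hasSum _ (fun i _ => by positivity) (hasSum_geometric_of_lt_one (by positivity) h0)
  simp only [sq_abs] at h2
  have h4 : ‖aeval w g‖ ^ 2 ≤ (∑ i ∈ g.support, g.coeff i ^ 2) * (1 - ‖w‖ ^ 2)⁻¹ :=
    (pow_le_pow_left₀ (norm_nonneg _) h1 2).trans (h2.trans
      (mul_le_mul_of_nonneg_left h3 (Finset.sum_nonneg fun i _ => sq_nonneg _)))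
  rwa [← div_eq_mul_inv, le_div_iff₀ (by linarith)] at h4

/-- The closed span of `x_n, x_{n-1}, …`. -/
noncomputable def pastSpan (x : ℤ → H) (n : ℤ) : Submodule ℝ H :=
  (LinearMap.range (seqFilter x n)).topologicalClosure

lemma seqFilter_mem_pastSpan (x : ℤ → H) (n : ℤ) (g : ℝ[X]) : seqFilter x n g ∈ pastSpan x n :=
  Submodule.le_topologicalClosure _ ⟨g, rfl⟩

lemma isClosed_pastSpan (x : ℤ → H) (n : ℤ) : IsClosed (pastSpan x n : Set H) :=
  Submodule.isClosed_topologicalClosure _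

/-- A continuous map sends `pastSpan` into a closed set if it does so for the filtered values. -/
lemma mem_of_mem_pastSpan {x : ℤ → H} {n : ℤ} {E : Type*} [TopologicalSpace E] {f : H → E}
    (hf : Continuous f) {S : Set E} (hS : IsClosed S) (h : ∀ g, f (seqFilter x n g) ∈ S) {w : H}
    (hw : w ∈ pastSpan x n) : f w ∈ S := by
  have : (pastSpan x n : Set H) ⊆ f ⁻¹' S := by
    rw [pastSpan, Submodule.topologicalClosure_coe]
    refine closure_minimal ?_ (hS.preimage hf)
    rintro _ ⟨g, rfl⟩
    exact h g
  exact this hw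

lemma pastSpan_mono (x : ℤ → H) {m n : ℤ} (h : m ≤ n) : pastSpan x m ≤ pastSpan x n := by
  intro w hw
  refine mem_of_mem_pastSpan (f := id) continuous_id (isClosed_pastSpan x n) (fun g => ?_) hw
  obtain ⟨k, rfl⟩ : ∃ k : ℕ, m = n - k := ⟨(n - m).toNat, by omega⟩
  rw [← seqFilter_X_pow_mul]
  exact seqFilter_mem_pastSpan x n _

lemma inner_eq_zero_of_mem_pastSpan {x : ℤ → H} {n : ℤ} {y : H}
    (h : ∀ g, inner ℝ y (seqFilter x n g) = 0) {w : H} (hw : w ∈ pastSpan x n) :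
    inner ℝ y w = 0 :=
  mem_of_mem_pastSpan (f := fun w => inner ℝ y w) (S := {0}) (by fun_prop) isClosed_singleton h hw

/-- The innovations `z_n` of a stationary sequence, together with polynomials `f_k` with
`f_k(B) x_n → z_n` for all `n`. The convergence for `n = 0` holds by construction, and stationarity
transports it to the other indices. -/
lemma exists_innovations [CompleteSpace H] {x : ℤ → H} (hx : ∀ m n k, inner ℝ (x (m + k)) (x (n + k))
    = inner ℝ (x m) (x n)) :
    ∃ (g : ℕ → ℝ[X]) (z : ℤ → H),
      (∀ n, Tendsto (fun k => seqFilter x n (1 - X * g k)) atTop (𝓝 (z n))) ∧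
      ∀ n, ∀ w ∈ pastSpan x (n - 1), inner ℝ (z n) w = 0 := by
  set K := pastSpan x (-1) with hK
  have : CompleteSpace K := (isClosed_pastSpan x (-1)).completeSpace_coe
  have hproj : (K.starProjection (x 0)) ∈ closure (Set.range (seqFilter x (-1))) := by
    have h1 : (K : Set H) = closure (Set.range (seqFilter x (-1))) := by
      rw [hK, pastSpan, Submodule.topologicalClosure_coe]; rfl
    exact h1.subset (Submodule.starProjection_apply_mem K (x 0))
  obtain ⟨s, hs, hslim⟩ := mem_closure_iff_seq_limit.1 hproj
  choose g hg using hs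
  have hsq : ∀ n f, ‖seqFilter x n f‖ = ‖seqFilter x 0 f‖ := by
    intro n f
    have := inner_seqFilter_add hx 0 0 n f f
    rw [zero_add, real_inner_self_eq_norm_sq, real_inner_self_eq_norm_sq] at this
    exact (sq_eq_sq₀ (norm_nonneg _) (norm_nonneg _)).1 this
  have h0 : Tendsto (fun k => seqFilter x 0 (1 - X * g k)) atTop
      (𝓝 (x 0 - K.starProjection (x 0))) := by
    refine (tendsto_const_nhds.sub hslim).congr fun k => ?_
    rw [map_sub, seqFilter_one, seqFilter_X_mul, zero_sub, hg]
  have hex : ∀ n, ∃ z, Tendsto (fun k => seqFilter x n (1 - X * g k)) atTop (𝓝 z) := by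
    intro n
    refine cauchySeq_tendsto_of_complete ?_
    have hc := h0.cauchySeq
    rw [Metric.cauchySeq_iff] at hc ⊢
    intro ε hε
    obtain ⟨N, hN⟩ := hc ε hε
    refine ⟨N, fun k hk l hl => ?_⟩
    have := hN k hk l hl
    rw [dist_eq_norm, ← map_sub] at this ⊢
    rwa [hsq]
  choose z hz using hex
  refine ⟨g, z, hz, fun n w hw => ?_⟩
  refine inner_eq_zero_of_mem_pastSpan (fun f => ?_) hw
  have h1 := (hz n).inner (𝕜 := ℝ) (tendsto_const_nhds (x := seqFilter x (n - 1) f))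
  have h2 := h0.inner (𝕜 := ℝ) (tendsto_const_nhds (x := seqFilter x (-1) f))
  have h3 : inner ℝ (x 0 - K.starProjection (x 0)) (seqFilter x (-1) f) = 0 := by
    exact Submodule.starProjection_inner_eq_zero _ _ (seqFilter_mem_pastSpan x (-1) f)
  rw [h3] at h2
  refine tendsto_nhds_unique h1 (h2.congr fun k => ?_)
  have := inner_seqFilter_add hx 0 (-1) n (1 - X * g k) f
  rw [← this, zero_add, show -1 + n = n - 1 by ring]

/-- A stationary sequence whose covariances vanish beyond lag `N` is a moving average of order `N`
in its innovations, and the moving average polynomial has no zeroes in the open unit disc. -/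
theorem exists_movingAverage [CompleteSpace H] {x : ℤ → H}
    (hx : ∀ m n k, inner ℝ (x (m + k)) (x (n + k)) = inner ℝ (x m) (x n)) {N : ℕ}
    (hN : ∀ m n : ℤ, n + N < m → inner ℝ (x m) (x n) = 0) :
    ∃ (θ : ℝ[X]) (v : ℝ) (z : ℤ → H), θ.coeff 0 = 1 ∧ θ.natDegree ≤ N ∧
      (∀ w : ℂ, ‖w‖ < 1 → aeval w θ ≠ 0) ∧
      (∀ m n, inner ℝ (z m) (z n) = if m = n then v else 0) ∧
      (∀ n, x n = seqFilter z n θ) ∧ ∀ n, z n ∈ pastSpan x n := by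
  obtain ⟨g, z, hz, hperp⟩ := exists_innovations hx
  have hzmem : ∀ n, z n ∈ pastSpan x n := fun n =>
    (isClosed_pastSpan x n).mem_of_tendsto (hz n)
      (Eventually.of_forall fun k => seqFilter_mem_pastSpan x n _)
  have hdiff : ∀ n, x n - z n ∈ pastSpan x (n - 1) := by
    intro n
    refine (isClosed_pastSpan x (n - 1)).mem_of_tendsto (tendsto_const_nhds.sub (hz n))
      (Eventually.of_forall fun k => ?_)
    rw [map_sub, seqFilter_one, sub_sub_cancel, seqFilter_X_mul]
    exact seqFilter_mem_pastSpan x _ _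
  have hlt : ∀ m n, m < n → inner ℝ (z n) (z m) = 0 := fun m n h =>
    hperp n _ (pastSpan_mono x (by omega) (hzmem m))
  set v := ‖z 0‖ ^ 2 with hv
  have hstat : ∀ m n k, inner ℝ (x (m + k)) (z (n + k)) = inner ℝ (x m) (z n) := by
    intro m n k
    have h1 := (tendsto_const_nhds (x := x (m + k))).inner (𝕜 := ℝ) (hz (n + k))
    have h2 := (tendsto_const_nhds (x := x m)).inner (𝕜 := ℝ) (hz n)
    refine tendsto_nhds_unique h1 (h2.congr fun i => ?_)
    have := inner_seqFilter_add hx m n k 1 (1 - X * g i)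
    rw [seqFilter_one, seqFilter_one] at this
    exact this.symm
  have hxz : ∀ n, inner ℝ (x n) (z n) = ‖z n‖ ^ 2 := by
    intro n
    have := hperp n _ (hdiff n)
    rw [inner_sub_right, sub_eq_zero, real_inner_comm, real_inner_self_eq_norm_sq] at this
    exact this
  have hnorm : ∀ n, ‖z n‖ ^ 2 = v := by
    intro n
    have := hstat 0 0 n
    rw [zero_add, hxz, hxz] at this
    exact this
  have horth : ∀ m n, inner ℝ (z m) (z n) = if m = n then v else 0 := by
    intro m n
    split_ifs with h
    · rw [h, real_inner_self_eq_norm_sq, hnorm]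
    · rcases lt_or_gt_of_ne h with h | h
      · rw [real_inner_comm]; exact hlt m n h
      · exact hlt n m h
  -- splitting off the newest innovation
  have hsplit : ∀ m, ∀ w ∈ pastSpan x m,
      w - (inner ℝ w (z m) / v) • z m ∈ pastSpan x (m - 1) := by
    intro m w hw
    refine mem_of_mem_pastSpan (f := fun w => w - (inner ℝ w (z m) / v) • z m) (by fun_prop)
      (isClosed_pastSpan x (m - 1)) (fun f => ?_) hw
    have e1 : seqFilter x m f = f.coeff 0 • z m +
        (f.coeff 0 • (x m - z m) + seqFilter x (m - 1) f.divX) := by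
      conv_lhs => rw [← divX_mul_X_add f, mul_comm, map_add, seqFilter_X_mul, ← mul_one (C _),
        ← smul_eq_C_mul, map_smul, seqFilter_one]
      module
    have e2 : f.coeff 0 • (x m - z m) + seqFilter x (m - 1) f.divX ∈ pastSpan x (m - 1) :=
      Submodule.add_mem _ (Submodule.smul_mem _ _ (hdiff m)) (seqFilter_mem_pastSpan x _ _)
    have e3 : inner ℝ (seqFilter x m f) (z m) = f.coeff 0 * v := by
      rw [e1, inner_add_left, inner_smul_left, horth, if_pos rfl, real_inner_comm, hperp m _ e2]
      simp
    have e4 : (f.coeff 0 * v / v) • z m = f.coeff 0 • z m := by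
      rcases eq_or_ne v 0 with h | h
      · have : z m = 0 := by
          have := hnorm m
          rw [h] at this
          simpa using this
        simp [this]
      · rw [mul_div_cancel_right₀ _ h]
    simp only [e3, e4, SetLike.mem_coe]
    rw [e1, add_sub_cancel_left]
    exact e2
  have hrem : ∀ n (i : ℕ), x n - ∑ j ∈ Finset.range i,
      (inner ℝ (x 0) (z (-j)) / v) • z (n - j) ∈ pastSpan x (n - i) := by
    intro n i
    induction i with
    | zero =>
      simp only [Finset.range_zero, Finset.sum_empty, sub_zero, Nat.cast_zero]
      rw [← seqFilter_one x n]
      exact seqFilter_mem_pastSpan x _ _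
    | succ i ih =>
      have h1 := hsplit _ _ ih
      have h2 : inner ℝ (x n - ∑ j ∈ Finset.range i,
          (inner ℝ (x 0) (z (-j)) / v) • z (n - j)) (z (n - i)) = inner ℝ (x 0) (z (-i)) := by
        rw [inner_sub_left, sum_inner, Finset.sum_eq_zero, sub_zero]
        · rw [← hstat 0 (-i) n, zero_add]; congr 2; ring
        · intro j hj
          rw [inner_smul_left, horth, if_neg, mul_zero]
          have := Finset.mem_range.1 hj
          omega
      rw [h2] at h1
      rw [Finset.sum_range_succ, ← sub_sub]
      convert h1 using 2
      push_cast; ring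
  have hxperp : ∀ n, ∀ w ∈ pastSpan x (n - (N + 1 : ℕ)), inner ℝ (x n) w = 0 := by
    intro n w hw
    refine inner_eq_zero_of_mem_pastSpan (fun f => ?_) hw
    rw [seqFilter_apply, Polynomial.sum, inner_sum]
    refine Finset.sum_eq_zero fun j _ => ?_
    rw [inner_smul_right, hN _ _ (by push_cast; omega), mul_zero]
  -- the remainder lies in the past beyond lag `N`, so it is orthogonal to `x n` and to the
  -- innovations of lag at most `N`, hence to itself
  have hMA : ∀ n, x n = ∑ j ∈ Finset.range (N + 1),
      (inner ℝ (x 0) (z (-j)) / v) • z (n - j) := by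
    intro n
    have h1 := hrem n (N + 1)
    set u := x n - ∑ j ∈ Finset.range (N + 1), (inner ℝ (x 0) (z (-j)) / v) • z (n - j) with hu
    have h2 : inner ℝ u u = 0 := by
      conv_lhs => rw [hu, inner_sub_left, sum_inner]
      rw [hxperp n u h1, Finset.sum_eq_zero, sub_zero]
      intro j hj
      have hj' := Finset.mem_range.1 hj
      rw [inner_smul_left, hperp _ _ (pastSpan_mono x _ h1), mul_zero]
      push_cast; omega
    exact sub_eq_zero.1 (inner_self_eq_zero.1 h2)
  rcases eq_or_ne v 0 with hv0 | hv0
  · -- without innovations the sequence vanishes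
    have hz0 : ∀ n, z n = 0 := fun n => by
      have := hnorm n
      rw [hv0] at this
      simpa using this
    refine ⟨1, v, z, by simp, by simp, by simp, horth, fun n => ?_, hzmem⟩
    rw [seqFilter_one, hMA n]
    simp [hz0]
  set θ : ℝ[X] := ∑ j ∈ Finset.range (N + 1), monomial j (inner ℝ (x 0) (z (-j)) / v) with hθ
  have hθx : ∀ n, x n = seqFilter z n θ := by
    intro n
    rw [hMA n, hθ, map_sum]
    exact Finset.sum_congr rfl fun j _ => (seqFilter_monomial _ _ _ _).symm
  refine ⟨θ, v, z, ?_, ?_, ?_, horth, hθx, hzmem⟩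
  · rw [hθ, finsetSum_coeff, Finset.sum_eq_single_of_mem 0 (by simp)]
    · simp [hxz, hv0, ← hv]
    · intro j _ hj
      rw [coeff_monomial, if_neg hj]
  · refine natDegree_sum_le_of_forall_le _ _ fun j hj => (natDegree_monomial_le _).trans ?_
    have := Finset.mem_range.1 hj
    omega
  · intro w hw hroot
    -- `z 0` is the limit of the `((1 - X g_k) θ)(B) z_0`, but `(1 - X g_k) θ - 1` takes the value
    -- `-1` at `w`, which bounds its square sum of coefficients from below
    have hvpos : 0 < v := lt_of_le_of_ne (sq_nonneg _) (Ne.symm hv0)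
    have h1 : Tendsto (fun k => ‖seqFilter z 0 ((1 - X * g k) * θ - 1)‖ ^ 2) atTop (𝓝 0) := by
      have := ((hz 0).sub (tendsto_const_nhds (x := z 0))).norm.pow 2
      rw [sub_self, norm_zero, zero_pow two_ne_zero] at this
      refine this.congr fun k => ?_
      rw [seqFilter_mul hθx, ← seqFilter_one z 0, ← map_sub]
    have h2 : v * (1 - ‖w‖ ^ 2) ≤ 0 := by
      refine ge_of_tendsto h1 (Eventually.of_forall fun k => ?_)
      rw [norm_sq_seqFilter horth]
      refine mul_le_mul_of_nonneg_left ?_ hvpos.le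
      have := norm_aeval_sq_mul_le ((1 - X * g k) * θ - 1) hw
      rw [map_sub, map_mul, hroot, mul_zero, map_one] at this
      simpa using this
    have h3 : 0 < 1 - ‖w‖ ^ 2 := by nlinarith [norm_nonneg w]
    linarith [mul_pos hvpos h3]

end Wold

/-! ### Moving average representations in `L²` -/

section MovingAverage

variable {Ω : Type*} [MeasurableSpace Ω] {μ : Measure Ω}

lemma coeFn_seqFilter (z : ℤ → Lp ℝ 2 μ) (n : ℤ) (g : ℝ[X]) :
    ⇑(seqFilter z n g) =ᵐ[μ] fun ω => shiftFilter g (fun m ω => z m ω) n ω := by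
  have h : ∀ᵐ ω ∂μ, ∀ i : ℕ, (g.coeff i • z (n - i) : Lp ℝ 2 μ) ω = g.coeff i * z (n - i) ω := by
    refine ae_all_iff.2 fun i => ?_
    filter_upwards [Lp.coeFn_smul (g.coeff i) (z (n - i))] with ω hω
    rw [hω]; rfl
  filter_upwards [h, Lp.coeFn_fun_finsetSum g.support fun i : ℕ => g.coeff i • z (n - i)]
    with ω h1 h2
  rw [seqFilter_apply, Polynomial.sum, h2, shiftFilter, Polynomial.sum]
  exact Finset.sum_congr rfl fun i _ => h1 i

/-- Orthogonal centred elements of `L²` of equal norm are white noise. -/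
lemma isWhiteNoise_of_inner [IsProbabilityMeasure μ] {z : ℤ → Lp ℝ 2 μ} {v : ℝ}
    (hz : ∀ m n, inner ℝ (z m) (z n) = if m = n then v else 0)
    (hmean : ∀ n, ∫ ω, z n ω ∂μ = 0) : IsWhiteNoise μ v fun n ω => z n ω := by
  have hcov : ∀ m n, cov[fun ω => z m ω, fun ω => z n ω; μ] = if m = n then v else 0 := by
    intro m n
    rw [covariance_eq_sub (Lp.memLp _) (Lp.memLp _), hmean, hmean, ← hz m n, L2.inner_def]
    simp [mul_comm]
  refine ⟨fun n => Lp.memLp _, hmean, fun n => ?_, fun m n h => ?_⟩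
  · rw [← covariance_self (Lp.aestronglyMeasurable _).aemeasurable, hcov, if_pos rfl]
  · rw [hcov, if_neg h]

lemma IsWhiteNoise.inner_toLp [IsProbabilityMeasure μ] {Z : ℤ → Ω → ℝ} {v : ℝ}
    (hZ : IsWhiteNoise μ v Z) (m n : ℤ) :
    inner ℝ ((hZ.memLp m).toLp (Z m)) ((hZ.memLp n).toLp (Z n)) = if m = n then v else 0 := by
  have h : inner ℝ ((hZ.memLp m).toLp (Z m)) ((hZ.memLp n).toLp (Z n)) = cov[Z m, Z n; μ] := by
    rw [_root_.inner_toLp, covariance_eq_sub (hZ.memLp m) (hZ.memLp n), hZ.mean_zero]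
    simp
  rw [h]
  split_ifs with hmn
  · rw [hmn, covariance_self (hZ.memLp n).aestronglyMeasurable.aemeasurable, hZ.variance_eq]
  · exact hZ.uncorrelated m n hmn

/-- The `L²`-form of `shiftFilter` for a sequence of square integrable random variables. -/
lemma coeFn_seqFilter_toLp {Z : ℤ → Ω → ℝ} (hZ : ∀ n, MemLp (Z n) 2 μ) (n : ℤ) (g : ℝ[X]) :
    ⇑(seqFilter (fun m => (hZ m).toLp (Z m)) n g) =ᵐ[μ] fun ω => shiftFilter g Z n ω := by
  have h : ∀ᵐ ω ∂μ, ∀ m : ℤ, (hZ m).toLp (Z m) ω = Z m ω :=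
    ae_all_iff.2 fun m => (hZ m).coeFn_toLp
  filter_upwards [coeFn_seqFilter (fun m => (hZ m).toLp (Z m)) n g, h] with ω h1 h2
  rw [h1, shiftFilter, shiftFilter]
  simp only [h2]

lemma IsMARepresentation.eq_seqFilter {m : ℕ} {W : ℤ → Ω → ℂ} {θ : ℝ[X]} {v : ℝ} {Z : ℤ → Ω → ℝ}
    (h : IsMARepresentation μ m W θ v Z) {w : ℤ → Lp ℝ 2 μ}
    (hw : ∀ n, ∀ᵐ ω ∂μ, W n ω = ((w n ω : ℝ) : ℂ)) (n : ℤ) :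
    w n = seqFilter (fun k => (h.whiteNoise.memLp k).toLp (Z k)) n θ := by
  refine Lp.ext ?_
  filter_upwards [coeFn_seqFilter_toLp h.whiteNoise.memLp n θ, hw n, h.eq n] with ω h1 h2 h3
  rw [h1]
  exact Complex.ofReal_injective (h2.symm.trans h3)

/-- The mean square error made when the moving average polynomial is replaced by another one. -/
lemma IsMARepresentation.integral_norm_sq [IsProbabilityMeasure μ] {m : ℕ} {W : ℤ → Ω → ℂ}
    {θ : ℝ[X]} {v : ℝ} {Z : ℤ → Ω → ℝ} (h : IsMARepresentation μ m W θ v Z) (θ₀ : ℝ[X]) (n : ℤ) :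
    ∫ ω, ‖W n ω - ((shiftFilter θ₀ Z n ω : ℝ) : ℂ)‖ ^ 2 ∂μ
      = v * ∑ i ∈ (θ - θ₀).support, (θ - θ₀).coeff i ^ 2 := by
  rw [← norm_sq_seqFilter h.whiteNoise.inner_toLp n, ← real_inner_self_eq_norm_sq, L2.inner_def]
  refine integral_congr_ae ?_
  have e := coeFn_seqFilter_toLp h.whiteNoise.memLp n
  have e3 := Lp.coeFn_sub (seqFilter (fun k => (h.whiteNoise.memLp k).toLp (Z k)) n θ)
    (seqFilter (fun k => (h.whiteNoise.memLp k).toLp (Z k)) n θ₀)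
  rw [← map_sub] at e3
  filter_upwards [e θ, e θ₀, e3, h.eq n] with ω h1 h2 h3 h4
  rw [h3, Pi.sub_apply, h1, h2, h4, ← Complex.ofReal_sub, Complex.norm_real, Real.norm_eq_abs,
    sq_abs]
  simp [sq]

end MovingAverage

/-! ### Existence of the moving average representation -/

lemma ite_sub_eq_sub_of_lt {p : ℕ} {c : ℕ → ℕ → ℝ} {m n : ℤ} (h : n + (p - 1 : ℕ) < m) :
    ∑ i ∈ Finset.range p, ∑ j ∈ Finset.range p, (if m - i = n - j then c i j else 0) = 0 := by
  refine Finset.sum_eq_zero fun i hi => Finset.sum_eq_zero fun j hj => if_neg fun e => ?_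
  have := Finset.mem_range.1 hi
  omega

/-- The Wold decomposition of the filtered sample is a moving average representation; the
innovations are centred because they lie in the closed span of the centred sequence. -/
lemma IsCARMA.exists_isMARepresentation {Ω : Type*} [MeasurableSpace Ω] {μ : Measure Ω}
    [IsProbabilityMeasure μ] {σ : ℝ} {L Y : ℝ → Ω → ℝ} (hL : IsSecondOrderLevy μ σ L)
    {p : ℕ} (hp : 0 < p) {a b : ℝ[X]} (ha : a.Monic) (hap : a.natDegree = p)
    (hY : IsCARMA μ p a b L Y) {Δ : ℝ} (hΔ : 0 < Δ) :
    ∃ (θ : ℝ[X]) (v : ℝ) (Z : ℤ → Ω → ℝ),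
      IsMARepresentation μ (p - 1) (filteredSample a Y Δ) θ v Z := by
  obtain ⟨φ, hφ⟩ := exists_real_arFilter a Δ
  obtain ⟨w, hw, hmean, hinner⟩ := hY.exists_L2 hL hp ha hap hΔ hφ
  have hstat : ∀ m n k, inner ℝ (w (m + k)) (w (n + k)) = inner ℝ (w m) (w n) := by
    intro m n k
    rw [hinner, hinner]
    refine Finset.sum_congr rfl fun i _ => ?_
    refine Finset.sum_congr rfl fun j _ => ?_
    have : m + k - i = n + k - j ↔ m - i = n - j := by omega
    simp only [this]
  obtain ⟨θ, v, z, h0, hdeg, hroots, hz, hwz, hmem⟩ := exists_movingAverage hstat (N := p - 1)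
    fun m n h => by rw [hinner]; exact ite_sub_eq_sub_of_lt h
  refine ⟨θ, v, fun n ω => z n ω, h0, hdeg, hroots, isWhiteNoise_of_inner hz fun n => ?_, fun n => ?_⟩
  · rw [integral_eq_inner_one]
    refine inner_eq_zero_of_mem_pastSpan (fun g => ?_) (hmem n)
    rw [seqFilter_apply, Polynomial.sum, inner_sum]
    refine Finset.sum_eq_zero fun i _ => ?_
    rw [inner_smul_right, ← integral_eq_inner_one, hmean, mul_zero]
  · filter_upwards [hw n, coeFn_seqFilter z n θ] with ω h1 h2
    rw [h1, hwz n, h2]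

/-! ### The spectral identity -/

/-- Two arrays with the same sums along all diagonals define the same Laurent polynomial. -/
lemma sum_sum_mul_pow_eq {N : ℕ} {c d : ℕ → ℕ → ℝ}
    (h : ∀ m : ℤ, ∑ i ∈ Finset.range N, ∑ j ∈ Finset.range N, (if 0 - (i : ℤ) = m - j then c i j else 0)
      = ∑ i ∈ Finset.range N, ∑ j ∈ Finset.range N, (if 0 - (i : ℤ) = m - j then d i j else 0))
    {z : ℂ} (hz : z ≠ 0) :
    ∑ i ∈ Finset.range N, ∑ j ∈ Finset.range N, (c i j : ℂ) * (z⁻¹ ^ i * z ^ j)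
      = ∑ i ∈ Finset.range N, ∑ j ∈ Finset.range N, (d i j : ℂ) * (z⁻¹ ^ i * z ^ j) := by
  have key : ∀ c : ℕ → ℕ → ℝ,
      ∑ i ∈ Finset.range N, ∑ j ∈ Finset.range N, (c i j : ℂ) * (z⁻¹ ^ i * z ^ j)
      = ∑ m ∈ Finset.Icc (-(N : ℤ)) N, ((∑ i ∈ Finset.range N, ∑ j ∈ Finset.range N,
          (if 0 - (i : ℤ) = m - j then c i j else 0) : ℝ) : ℂ) * z ^ m := by
    intro c
    push_cast
    simp only [Finset.sum_mul]
    conv_rhs => rw [Finset.sum_comm]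
    refine Finset.sum_congr rfl fun i hi => ?_
    conv_rhs => rw [Finset.sum_comm]
    refine Finset.sum_congr rfl fun j hj => ?_
    have hi' := Finset.mem_range.1 hi
    have hj' := Finset.mem_range.1 hj
    rw [Finset.sum_eq_single_of_mem ((j : ℤ) - i) (Finset.mem_Icc.2 (by omega))]
    · rw [if_pos (by ring), zpow_sub₀ hz, zpow_natCast, zpow_natCast, inv_pow]
      ring
    · intro m _ hm
      rw [if_neg (by omega)]
      simp
  rw [key, key]
  simp only [h]

/-- The spectral density of the filtered sample, computed from the Lévy integrals and from a moving
average representation. -/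
lemma IsMARepresentation.spectral_identity {Ω : Type*} [MeasurableSpace Ω] {μ : Measure Ω}
    [IsProbabilityMeasure μ] {W : ℤ → Ω → ℂ} {p : ℕ} {θ : ℝ[X]} {v : ℝ} {Z : ℤ → Ω → ℝ}
    (hp : 0 < p) (h : IsMARepresentation μ (p - 1) W θ v Z) {w : ℤ → Lp ℝ 2 μ}
    (hw : ∀ n, ∀ᵐ ω ∂μ, W n ω = ((w n ω : ℝ) : ℂ)) {c : ℕ → ℕ → ℝ}
    (hc : ∀ m n : ℤ, inner ℝ (w m) (w n) = ∑ i ∈ Finset.range p, ∑ j ∈ Finset.range p,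
        if m - i = n - j then c i j else 0) :
    (∀ z : ℂ, z ≠ 0 → ∑ i ∈ Finset.range p, ∑ j ∈ Finset.range p, (c i j : ℂ) * (z⁻¹ ^ i * z ^ j)
      = v * (aeval z⁻¹ θ * aeval z θ)) ∧
    ∑ i ∈ Finset.range p, c i i = v * ∑ i ∈ Finset.range p, θ.coeff i ^ 2 := by
  have hdeg : θ.natDegree < p := by have := h.natDegree_le; omega
  have hw2 : ∀ m n : ℤ, inner ℝ (w m) (w n) = ∑ i ∈ Finset.range p, ∑ j ∈ Finset.range p,
      if m - i = n - j then v * (θ.coeff i * θ.coeff j) else 0 := by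
    intro m n
    rw [h.eq_seqFilter hw m, h.eq_seqFilter hw n, seqFilter_apply, seqFilter_apply,
      sum_over_range' _ (by simp) p hdeg, sum_over_range' _ (by simp) p hdeg, sum_inner]
    refine Finset.sum_congr rfl fun i _ => ?_
    rw [inner_sum]
    refine Finset.sum_congr rfl fun j _ => ?_
    rw [inner_smul_left, inner_smul_right, h.whiteNoise.inner_toLp]
    split_ifs <;> simp; ring
  constructor
  · intro z hz
    rw [sum_sum_mul_pow_eq (d := fun i j => v * (θ.coeff i * θ.coeff j))
      (fun m => (hc 0 m).symm.trans (hw2 0 m)) hz, aeval_eq_sum_range' hdeg,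
      aeval_eq_sum_range' hdeg, Finset.sum_mul_sum, Finset.mul_sum]
    refine Finset.sum_congr rfl fun i _ => ?_
    rw [Finset.mul_sum]
    refine Finset.sum_congr rfl fun j _ => ?_
    simp only [Complex.real_smul]
    push_cast; ring
  · have hdiag : ∀ c : ℕ → ℕ → ℝ, ∑ i ∈ Finset.range p, ∑ j ∈ Finset.range p,
        (if (0 : ℤ) - i = 0 - j then c i j else 0) = ∑ i ∈ Finset.range p, c i i := by
      intro c
      refine Finset.sum_congr rfl fun i hi => ?_
      rw [Finset.sum_eq_single_of_mem i hi]
      · simp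
      · intro j _ hj
        rw [if_neg (by omega)]
    have := (hc 0 0).symm.trans (hw2 0 0)
    rw [hdiag, hdiag] at this
    rw [this, Finset.mul_sum]
    exact Finset.sum_congr rfl fun i _ => by ring

/-! ### Polynomials without zeroes in the open unit disc -/

/-- A real polynomial with constant coefficient one and no zeroes in the open unit disc is a
product of factors `1 - w X` with `|w| ≤ 1`. -/
lemma exists_eq_prod_one_sub {θ : ℝ[X]} (h0 : θ.coeff 0 = 1)
    (hθ : ∀ z : ℂ, ‖z‖ < 1 → aeval z θ ≠ 0) :
    ∃ s : Multiset ℂ, s.card ≤ θ.natDegree ∧ (∀ w ∈ s, ‖w‖ ≤ 1) ∧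
      θ.map (algebraMap ℝ ℂ) = (s.map fun w => 1 - C w * X).prod := by
  set f := θ.map (algebraMap ℝ ℂ) with hf
  have hroot : ∀ r ∈ f.roots, 1 ≤ ‖r‖ := by
    intro r hr
    by_contra hlt
    refine hθ r (not_le.1 hlt) ?_
    have := (mem_roots'.1 hr).2
    rwa [hf, IsRoot.def, eval_map_algebraMap] at this
  refine ⟨f.roots.map fun r => r⁻¹, ?_, ?_, ?_⟩
  · rw [Multiset.card_map]
    exact (card_roots' f).trans (natDegree_map_le)
  · intro w hw
    obtain ⟨r, hr, rfl⟩ := Multiset.mem_map.1 hw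
    rw [norm_inv]
    exact inv_le_one_of_one_le₀ (hroot r hr)
  · have h1 : ∀ s : Multiset ℂ, (∀ r ∈ s, 1 ≤ ‖r‖) → (s.map fun r => X - C r).prod
        = C (s.map fun r => -r).prod * ((s.map fun r => r⁻¹).map fun w => 1 - C w * X).prod := by
      intro s
      induction s using Multiset.induction_on with
      | empty => simp
      | cons r s ih =>
        intro hs
        have hr : r ≠ 0 := by
          rintro rfl
          have := hs 0 (Multiset.mem_cons_self _ _)
          norm_num at this
        simp only [Multiset.map_cons, Multiset.prod_cons]
        rw [ih fun w hw => hs w (Multiset.mem_cons_of_mem hw), C_mul]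
        have : (X : ℂ[X]) - C r = C (-r) * (1 - C r⁻¹ * X) := by
          rw [mul_sub, ← mul_assoc, ← C_mul, neg_mul, mul_inv_cancel₀ hr]
          simp; ring
        rw [this]; ring
    have h2 := (IsAlgClosed.splits f).eq_prod_roots
    rw [h1 _ hroot, ← mul_assoc, ← C_mul] at h2
    have h3 : f.leadingCoeff * (f.roots.map fun r => -r).prod = 1 := by
      have h4 : f.eval 0 = 1 := by
        rw [← coeff_zero_eq_eval_zero, hf, coeff_map, h0, map_one]
      rw [h2, eval_mul, eval_C, eval_multiset_prod] at h4
      simpa using h4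
    rw [h3, C_1, one_mul] at h2
    exact h2

lemma norm_coeff_prod_one_sub_le {s : Multiset ℂ} (hs : ∀ w ∈ s, ‖w‖ ≤ 1) (k : ℕ) :
    ‖((s.map fun w => 1 - C w * X).prod).coeff k‖ ≤ 2 ^ s.card := by
  induction s using Multiset.induction_on generalizing k with
  | empty =>
    simp only [Multiset.map_zero, Multiset.prod_zero, coeff_one]
    split_ifs <;> simp
  | cons w s ih =>
    have ih' := ih fun w hw => hs w (Multiset.mem_cons_of_mem hw)
    have hw := hs w (Multiset.mem_cons_self _ _)
    rw [Multiset.map_cons, Multiset.prod_cons, sub_mul, one_mul, mul_assoc, coeff_sub, coeff_C_mul,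
      Multiset.card_cons, pow_succ, mul_two]
    refine (norm_sub_le _ _).trans (add_le_add (ih' k) ?_)
    rw [norm_mul]
    rcases k with _ | k
    · simp
    · rw [coeff_X_mul]
      exact (mul_le_of_le_one_left (norm_nonneg _) hw).trans (ih' k)

lemma one_sub_norm_pow_le {s : Multiset ℂ} (hs : ∀ w ∈ s, ‖w‖ ≤ 1) {z : ℂ} (hz : ‖z‖ ≤ 1) :
    (1 - ‖z‖) ^ s.card ≤ ‖((s.map fun w => 1 - C w * X).prod).eval z‖ := by
  induction s using Multiset.induction_on with
  | empty => simp
  | cons w s ih =>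
    have ih' := ih fun w hw => hs w (Multiset.mem_cons_of_mem hw)
    have hw := hs w (Multiset.mem_cons_self _ _)
    rw [Multiset.map_cons, Multiset.prod_cons, eval_mul, norm_mul, Multiset.card_cons, pow_succ,
      mul_comm]
    refine mul_le_mul ?_ ih' (pow_nonneg (by linarith) _) (norm_nonneg _)
    simp only [eval_sub, eval_one, eval_mul, eval_C, eval_X]
    have h1 := norm_sub_norm_le 1 (w * z)
    rw [norm_one, norm_mul] at h1
    nlinarith [norm_nonneg z]

/-- Uniqueness of the spectral factorization, in terms of the reciprocal zeroes. A nonzero `w` in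
`s` produces the zero `1 / w` on the left; on the right it can only come from `w ∈ t`, because the
factors `X - conj w'` vanish outside the open unit disc only on the unit circle, where they have the
same zero as `1 - w' X`. Hence the common factor can be cancelled. -/
lemma prod_one_sub_unique {c : ℂ} (hc : c ≠ 0) {s t : Multiset ℂ} (hs : ∀ w ∈ s, ‖w‖ ≤ 1)
    (ht : ∀ w ∈ t, ‖w‖ ≤ 1)
    (h : C c * (s.map fun w => (1 - C w * X) * (X - C (starRingEnd ℂ w))).prod * X ^ t.card
      = (t.map fun w => (1 - C w * X) * (X - C (starRingEnd ℂ w))).prod * X ^ s.card) :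
    c = 1 ∧ (s.map fun w => 1 - C w * X).prod = (t.map fun w => 1 - C w * X).prod := by
  induction s using Multiset.induction_on generalizing t with
  | empty =>
    simp only [Multiset.map_zero, Multiset.prod_zero, mul_one, Multiset.card_zero, pow_zero] at h
    have ht0 : ∀ w ∈ t, w = 0 := by
      intro w hw
      by_contra hw0
      have := congrArg (eval w⁻¹) h
      rw [eval_multiset_prod, Multiset.map_map, Multiset.prod_eq_zero] at this
      · simp [hc, hw0] at this
      · refine Multiset.mem_map.2 ⟨w, hw, ?_⟩
        simp [hw0]
    obtain ⟨n, rfl⟩ : ∃ n, t = Multiset.replicate n 0 :=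
      ⟨t.card, Multiset.eq_replicate_card.2 ht0⟩
    simp only [Multiset.map_replicate, Multiset.prod_replicate, Multiset.card_replicate] at h ⊢
    have h2 := congrArg (eval 1) h
    simp at h2
    simp [h2]
  | cons w s ih =>
    have hw := hs w (Multiset.mem_cons_self _ _)
    have hs' : ∀ w' ∈ s, ‖w'‖ ≤ 1 := fun w' hw' => hs w' (Multiset.mem_cons_of_mem hw')
    rcases eq_or_ne w 0 with rfl | hw0
    · obtain ⟨h1, h2⟩ := ih hs' ht (by
        simp only [Multiset.map_cons, Multiset.prod_cons, Multiset.card_cons] at h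
        refine mul_left_cancel₀ (X_ne_zero (R := ℂ)) ?_
        simp only [map_zero, zero_mul, sub_zero, one_mul, pow_succ] at h
        linear_combination h)
      exact ⟨h1, by simpa using h2⟩
    · have hwt : w ∈ t := by
        have := congrArg (eval w⁻¹) h
        rw [Multiset.map_cons, Multiset.prod_cons] at this
        simp only [eval_mul, eval_sub, eval_one, eval_C, eval_X, eval_pow, mul_inv_cancel₀ hw0,
          sub_self, zero_mul, mul_zero] at this
        have h2 := (mul_eq_zero.1 this.symm).resolve_right (pow_ne_zero _ (inv_ne_zero hw0))
        rw [eval_multiset_prod, Multiset.prod_eq_zero_iff, Multiset.map_map] at h2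
        obtain ⟨w', hw', h3⟩ := Multiset.mem_map.1 h2
        simp only [Function.comp_apply, eval_mul, eval_sub, eval_one, eval_C, eval_X] at h3
        rcases mul_eq_zero.1 h3 with h4 | h4
        · have : w' = w := by
            field_simp at h4
            rw [mul_zero] at h4
            exact (sub_eq_zero.1 h4).symm
          rwa [← this]
        · have h5 : starRingEnd ℂ w' = w⁻¹ := (sub_eq_zero.1 h4).symm
          have h6 : ‖w‖ = 1 := by
            have h7 := ht w' hw'
            rw [← RCLike.norm_conj, h5, norm_inv] at h7
            exact le_antisymm hw ((inv_le_one₀ (norm_pos_iff.2 hw0)).1 h7)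
          have h8 : w' = w := by
            rw [← Complex.conj_conj w', h5, map_inv₀, inv_eq_iff_eq_inv]
            exact (Complex.inv_eq_conj h6).symm
          rwa [← h8]
      obtain ⟨t', rfl⟩ := Multiset.exists_cons_of_mem hwt
      obtain ⟨h1, h2⟩ := ih hs' (fun w' hw' => ht w' (Multiset.mem_cons_of_mem hw')) (by
        simp only [Multiset.map_cons, Multiset.prod_cons, Multiset.card_cons] at h
        have hne : (1 - C w * X) * (X - C (starRingEnd ℂ w)) * X ≠ 0 := by
          refine mul_ne_zero (mul_ne_zero ?_ (X_sub_C_ne_zero _)) X_ne_zero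
          intro h3
          have := congrArg (eval 0) h3
          simp at this
        refine mul_left_cancel₀ hne ?_
        simp only [pow_succ] at h
        linear_combination h)
      exact ⟨h1, by simp only [Multiset.map_cons, Multiset.prod_cons, h2]⟩

/-- Uniqueness of the spectral factorization for real polynomials without zeroes in the open unit
disc. -/
lemma spectral_factorization_unique {P Q : ℝ[X]} {c : ℝ} (hP0 : P.coeff 0 = 1) (hQ0 : Q.coeff 0 = 1)
    (hP : ∀ z : ℂ, ‖z‖ < 1 → aeval z P ≠ 0) (hQ : ∀ z : ℂ, ‖z‖ < 1 → aeval z Q ≠ 0)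
    (h : ∀ z : ℂ, z ≠ 0 → c * (aeval z⁻¹ P * aeval z P) = aeval z⁻¹ Q * aeval z Q) :
    c = 1 ∧ P = Q := by
  obtain ⟨s, -, hs, hPs⟩ := exists_eq_prod_one_sub hP0 hP
  obtain ⟨t, -, ht, hQt⟩ := exists_eq_prod_one_sub hQ0 hQ
  -- for a real polynomial the factors at `z⁻¹` may be replaced by their conjugates
  have hfac : ∀ (θ : ℝ[X]) (s : Multiset ℂ), θ.map (algebraMap ℝ ℂ)
      = (s.map fun w => 1 - C w * X).prod → ∀ z : ℂ, z ≠ 0 →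
      aeval z⁻¹ θ * aeval z θ * z ^ s.card =
        ((s.map fun w => (1 - C w * X) * (X - C (starRingEnd ℂ w))).prod).eval z := by
    intro θ s hθ z hz
    have h1 : θ.map (algebraMap ℝ ℂ) = (s.map fun w => 1 - C (starRingEnd ℂ w) * X).prod := by
      have h2 : (θ.map (algebraMap ℝ ℂ)).map (starRingEnd ℂ) = θ.map (algebraMap ℝ ℂ) := by
        rw [Polynomial.map_map]; congr 1; ext x; simp
      rw [← h2, hθ, Polynomial.map_multiset_prod, Multiset.map_map]
      congr 1
      refine Multiset.map_congr rfl fun w _ => ?_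
      simp
    rw [← eval_map_algebraMap θ z⁻¹, ← eval_map_algebraMap θ z, hθ]
    rw [hθ] at h1
    conv_lhs => enter [1, 1]; rw [h1]
    clear h1 hθ
    induction s using Multiset.induction_on with
    | empty => simp
    | cons w s ih =>
      simp only [Multiset.map_cons, Multiset.prod_cons, Multiset.card_cons, eval_mul, pow_succ]
      rw [← ih]
      simp only [eval_sub, eval_one, eval_mul, eval_C, eval_X]
      field_simp
  have hc : c ≠ 0 := by
    rintro rfl
    have h1 : (Q.map (algebraMap ℝ ℂ)) ≠ 0 := by
      rw [Polynomial.map_ne_zero_iff (algebraMap ℝ ℂ).injective]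
      rintro rfl
      simp at hQ0
    have h2 : {z : ℂ | z ≠ 0 ∧ ‖z‖ < 1}.Infinite := by
      have h3 : (Metric.ball (0 : ℂ) 1 \ {0}).Infinite :=
        ((infinite_of_mem_nhds 0 (Metric.ball_mem_nhds 0 one_pos))).sdiff (Set.finite_singleton 0)
      refine h3.mono fun z hz => ⟨hz.2, by simpa using hz.1⟩
    have h4 : {z : ℂ | z ≠ 0 ∧ ‖z‖ < 1} ⊆ (fun z => z⁻¹) ⁻¹' {z | (Q.map (algebraMap ℝ ℂ)).IsRoot z} := by
      rintro z ⟨hz0, hz1⟩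
      have h5 := h z hz0
      rw [Complex.ofReal_zero, zero_mul] at h5
      have h6 := (mul_eq_zero.1 h5.symm).resolve_right (hQ z hz1)
      rwa [Set.mem_preimage, Set.mem_ofPred_eq, IsRoot.def, eval_map_algebraMap]
    exact h2 (((finite_setOfPred_isRoot h1).preimage inv_injective.injOn).subset h4)
  obtain ⟨h1, h2⟩ := prod_one_sub_unique (c := (c : ℂ)) (by exact_mod_cast hc) hs ht (by
    refine eq_of_infinite_eval_eq _ _ ((Set.finite_singleton (0 : ℂ)).infinite_compl.mono ?_)
    intro z hz
    have hz0 : z ≠ 0 := hz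
    have h3 := h z hz0
    simp only [Set.mem_ofPred_eq, eval_mul, eval_C, eval_pow, eval_X]
    rw [← hfac P s hPs z hz0, ← hfac Q t hQt z hz0]
    linear_combination (z ^ s.card * z ^ t.card) * h3)
  refine ⟨by exact_mod_cast h1, Polynomial.map_injective (algebraMap ℝ ℂ)
    (algebraMap ℝ ℂ).injective ?_⟩
  rw [hPs, hQt, h2]

/-! ### Continuity of the spectral factorization -/

/-- If the spectral densities `v |θ|²` converge to `|Q|²` and the `θ` and `Q` have no zeroes in the
open unit disc, then `θ → Q` and `v → 1`. The coefficients of `θ` are bounded, every limit point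
of `(θ, v)` is again a spectral factorization of `|Q|²`, and this factorization is unique. -/
theorem tendsto_of_tendsto_spectral {α : Type*} {F : Filter α} {θ : α → ℝ[X]} {v : α → ℝ} {Q : ℝ[X]}
    {m : ℕ} {K : ℝ}
    (hθ : ∀ᶠ x in F, (θ x).coeff 0 = 1 ∧ (θ x).natDegree ≤ m ∧
      ∀ z : ℂ, ‖z‖ < 1 → aeval z (θ x) ≠ 0)
    (hv : ∀ᶠ x in F, v x ∈ Set.Icc 0 K)
    (hQ0 : Q.coeff 0 = 1) (hQ : ∀ z : ℂ, ‖z‖ < 1 → aeval z Q ≠ 0)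
    (h : ∀ z : ℂ, z ≠ 0 → Tendsto (fun x => (v x : ℂ) * (aeval z⁻¹ (θ x) * aeval z (θ x))) F
      (𝓝 (aeval z⁻¹ Q * aeval z Q))) :
    (∀ k, Tendsto (fun x => (θ x).coeff k) F (𝓝 (Q.coeff k))) ∧ Tendsto v F (𝓝 1) := by
  suffices hU : ∀ U : Ultrafilter α, ↑U ≤ F →
      (∀ k, Tendsto (fun x => (θ x).coeff k) U (𝓝 (Q.coeff k))) ∧ Tendsto v U (𝓝 1) from
    ⟨fun k => (tendsto_iff_ultrafilter _ _ _).2 fun U hU' => (hU U hU').1 k,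
      (tendsto_iff_ultrafilter _ _ _).2 fun U hU' => (hU U hU').2⟩
  intro U hU
  have hlim : ∀ (f : α → ℝ) (C : ℝ), (∀ᶠ x in F, |f x| ≤ C) → ∃ l, Tendsto f U (𝓝 l) := by
    intro f C hf
    have : (Ultrafilter.map f U : Filter ℝ) ≤ 𝓟 (Set.Icc (-C) C) :=
      le_principal_iff.2 (Filter.mem_map.2 ((hf.filter_mono hU).mono fun x hx => abs_le.1 hx))
    obtain ⟨l, -, hl⟩ := isCompact_Icc.ultrafilter_le_nhds _ this
    exact ⟨l, hl⟩
  obtain ⟨c, hc⟩ := hlim v K (hv.mono fun x hx => by rw [abs_of_nonneg hx.1]; exact hx.2)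
  have hcoeff : ∀ k, ∃ l, Tendsto (fun x => (θ x).coeff k) U (𝓝 l) := by
    refine fun k => hlim _ (2 ^ m) (hθ.mono fun x hx => ?_)
    obtain ⟨s, hcard, hs, hprod⟩ := exists_eq_prod_one_sub hx.1 hx.2.2
    have h1 := norm_coeff_prod_one_sub_le hs k
    rw [← hprod, coeff_map, Complex.coe_algebraMap, Complex.norm_real] at h1
    exact h1.trans (pow_le_pow_right₀ one_le_two (hcard.trans hx.2.1))
  choose l hl using hcoeff
  set P : ℝ[X] := ∑ k ∈ Finset.range (m + 1), monomial k (l k) with hP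
  have hPcoeff : ∀ k, P.coeff k = if k < m + 1 then l k else 0 := by
    intro k
    simp [hP, finsetSum_coeff, coeff_monomial]
  have hθP : ∀ k, Tendsto (fun x => (θ x).coeff k) U (𝓝 (P.coeff k)) := by
    intro k
    rw [hPcoeff]
    split_ifs with hk
    · exact hl k
    · refine tendsto_const_nhds.congr' ((hθ.filter_mono hU).mono fun x hx => ?_)
      exact (coeff_eq_zero_of_natDegree_lt (by have := hx.2.1; omega)).symm
  have hPdeg : P.natDegree < m + 1 := by
    refine Nat.lt_succ_of_le (natDegree_le_iff_coeff_eq_zero.2 fun k hk => ?_)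
    rw [hPcoeff, if_neg (by omega)]
  have haeval : ∀ z : ℂ, Tendsto (fun x => aeval z (θ x)) U (𝓝 (aeval z P)) := by
    intro z
    rw [aeval_eq_sum_range' hPdeg]
    refine Tendsto.congr' ((hθ.filter_mono hU).mono fun x hx =>
      (aeval_eq_sum_range' (Nat.lt_succ_of_le hx.2.1) z).symm) ?_
    exact tendsto_finsetSum _ fun k _ => (hθP k).smul_const _
  have hP0 : P.coeff 0 = 1 :=
    tendsto_nhds_unique (hθP 0) (tendsto_const_nhds.congr' ((hθ.filter_mono hU).mono fun x hx => hx.1.symm))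
  have hPz : ∀ z : ℂ, ‖z‖ < 1 → aeval z P ≠ 0 := by
    intro z hz h0
    have h1 := (haeval z).norm
    rw [h0, norm_zero] at h1
    have h2 : (1 - ‖z‖) ^ m ≤ 0 := by
      refine ge_of_tendsto h1 ((hθ.filter_mono hU).mono fun x hx => ?_)
      obtain ⟨s, hcard, hs, hprod⟩ := exists_eq_prod_one_sub hx.1 hx.2.2
      have h3 := one_sub_norm_pow_le hs hz.le
      rw [← hprod, eval_map_algebraMap] at h3
      exact (pow_le_pow_of_le_one (by linarith) (by linarith [norm_nonneg z])
        (hcard.trans hx.2.1)).trans h3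
    have h3 : 0 < (1 - ‖z‖) ^ m := pow_pos (by linarith) m
    linarith
  obtain ⟨h1, h2⟩ := spectral_factorization_unique (c := c) hP0 hQ0 hPz hQ fun z hz =>
    tendsto_nhds_unique (((Complex.continuous_ofReal.tendsto c).comp hc).mul
      ((haeval z⁻¹).mul (haeval z))) ((h z hz).mono_left hU)
  rw [h1] at hc
  rw [h2] at hθP
  exact ⟨hθP, hc⟩

/-! ### Small time asymptotics of the kernels -/

lemma carmaOp_pow_lastVec {p : ℕ} {a : ℝ[X]} (k : ℕ) {i : ℕ} (hi : i + k + 1 ≤ p) :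
    (carmaOp ℝ p a ^ k) (lastVec p) ⟨i, by omega⟩ = if i + k + 1 = p then 1 else 0 := by
  induction k generalizing i with
  | zero => simp [lastVec]
  | succ k ih =>
    rw [pow_succ', mul_apply_eq_comp, carmaOp_apply_of_lt _ (by omega : i + 1 < p),
      ih (i := i + 1) (by omega)]
    simp only [show i + 1 + k + 1 = i + (k + 1) + 1 by ring]

/-- The derivatives at zero of the kernel `t ↦ bᵀ exp (t A) e_p`: with `p = q + r + 1`, those of
order less than `r` vanish and that of order `r` is the leading coefficient of `b`, which is `1`. -/
lemma observation_carmaOp_pow_lastVec {q r k : ℕ} {a b : ℝ[X]} (hb : b.Monic)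
    (hbq : b.natDegree = q) (hk : k ≤ r) :
    observation (q + r + 1) b ((carmaOp ℝ (q + r + 1) a ^ k) (lastVec (q + r + 1)))
      = if k = r then 1 else 0 := by
  rw [observation_apply, Finset.sum_eq_single ⟨q, by omega⟩]
  · rw [carmaOp_pow_lastVec k (i := q) (by omega), ← hbq, hb.coeff_natDegree, one_mul]
    congr 1
    exact propext ⟨fun h => by omega, fun h => by omega⟩
  · rintro ⟨i, hi⟩ _ hne
    have hne' : i ≠ q := fun h => hne (Fin.ext h)
    rcases lt_or_gt_of_ne hne' with h | h
    · rw [carmaOp_pow_lastVec k (i := i) (by omega), if_neg (by omega), mul_zero]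
    · rw [coeff_eq_zero_of_natDegree_lt (by rw [hbq]; exact h), zero_mul]
  · simp

/-- The kernel behaves like `t ^ r / r!` at zero. -/
lemma isBigO_kernel_sub {q r : ℕ} {a b : ℝ[X]} (hb : b.Monic) (hbq : b.natDegree = q) :
    (fun t : ℝ => observation (q + r + 1) b (flow (carmaOp ℝ (q + r + 1) a) t (lastVec (q + r + 1)))
      - t ^ r / r.factorial) =O[𝓝 0] fun t => t ^ (r + 1) := by
  set A := carmaOp ℝ (q + r + 1) a with hA
  set c := observation (q + r + 1) b
  set e := lastVec (q + r + 1)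
  have h1 := (NormedSpace.exp_hasFPowerSeriesAt_zero (𝕂 := ℝ)
    (𝔸 := (Fin (q + r + 1) → ℝ) →L[ℝ] (Fin (q + r + 1) → ℝ))).isBigO_sub_partialSum_pow (r + 1)
  have h2 : Tendsto (fun t : ℝ => t • A) (𝓝 0) (𝓝 0) := by
    have : Continuous fun t : ℝ => t • A := by fun_prop
    simpa using this.tendsto 0
  have h3 := h1.comp_tendsto h2
  have h4 : (fun t : ℝ => ‖t • A‖ ^ (r + 1)) =O[𝓝 0] fun t => t ^ (r + 1) := by
    refine Asymptotics.IsBigO.of_bound (‖A‖ ^ (r + 1)) (Eventually.of_forall fun t => ?_)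
    rw [norm_smul, mul_pow, norm_mul, norm_pow, norm_pow, norm_norm, norm_norm, norm_pow, mul_comm]
  have h5 : (fun t : ℝ => c (flow A t e) - t ^ r / r.factorial) = fun t =>
      c ((NormedSpace.exp (0 + t • A) - (NormedSpace.expSeries ℝ _).partialSum (r + 1) (t • A)) e) := by
    ext t
    rw [zero_add, sub_apply, map_sub, flow]
    congr 1
    rw [FormalMultilinearSeries.partialSum, sum_apply, map_sum, Finset.sum_eq_single_of_mem r
      (by simp)]
    · rw [NormedSpace.expSeries_apply_eq, _root_.smul_pow, smul_apply, smul_apply, map_smul, map_smul,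
        observation_carmaOp_pow_lastVec hb hbq le_rfl]
      simp; ring
    · intro k hk hkr
      have := Finset.mem_range.1 hk
      rw [NormedSpace.expSeries_apply_eq, _root_.smul_pow, smul_apply, smul_apply, map_smul, map_smul,
        observation_carmaOp_pow_lastVec hb hbq (by omega), if_neg hkr]
      simp
  rw [h5]
  refine Asymptotics.IsBigO.trans ?_ (h3.trans h4)
  refine Asymptotics.IsBigO.of_bound (‖c‖ * ‖e‖) (Eventually.of_forall fun t => ?_)
  refine (c.le_opNorm _).trans ?_
  rw [mul_assoc]
  refine mul_le_mul_of_nonneg_left ?_ (norm_nonneg _)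
  rw [mul_comm ‖e‖]
  exact ContinuousLinearMap.le_opNorm _ _

lemma filteredKernel_eq_sum (p : ℕ) (a b φ : ℝ[X]) (Δ : ℝ) (k : ℕ) (s : ℝ) :
    filteredKernel p a b φ Δ k s = ∑ j ∈ Finset.range (k + 1), φ.coeff j *
      observation p b (flow (carmaOp ℝ p a) ((k - j : ℕ) * Δ + s) (lastVec p)) := by
  rw [filteredKernel, filteredObservation, ContinuousLinearMap.comp_apply, truncatedFilter,
    sum_apply, map_sum]
  refine Finset.sum_congr rfl fun j _ => ?_
  rw [smul_apply, map_smul, flow_add, flow_nat_mul, mul_apply_eq_comp, smul_eq_mul]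

lemma continuous_coeff_prod_exp (s : Multiset ℂ) (k : ℕ) :
    Continuous fun Δ : ℝ =>
      ((s.map fun l => 1 - C (Complex.exp (l * (Δ : ℂ))) * X).prod).coeff k := by
  induction s using Multiset.induction_on generalizing k with
  | empty => simpa using continuous_const
  | cons l s ih =>
    simp only [Multiset.map_cons, Multiset.prod_cons, sub_mul, one_mul, mul_assoc, coeff_sub,
      coeff_C_mul]
    refine (ih k).sub (Continuous.mul (by fun_prop) ?_)
    rcases k with _ | k
    · simpa using continuous_const
    · simpa only [coeff_X_mul] using ih k

/-- The autoregressive filter tends to `(1 - B) ^ p`. -/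
lemma tendsto_coeff_arFilter {a : ℝ[X]} {φ : ℝ → ℝ[X]}
    (hφ : ∀ Δ, (φ Δ).map (algebraMap ℝ ℂ) = arFilter a Δ) (k : ℕ) :
    Tendsto (fun Δ => (φ Δ).coeff k) (𝓝[>] 0) (𝓝 (((1 - X : ℝ[X]) ^ a.natDegree).coeff k)) := by
  have h1 := ((continuous_coeff_prod_exp (a.aroots ℂ) k).tendsto 0).mono_left
    (nhdsWithin_le_nhds (s := Set.Ioi 0))
  have h2 : (((a.aroots ℂ).map fun l => 1 - C (Complex.exp (l * ((0 : ℝ) : ℂ))) * X).prod).coeff k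
      = ((((1 - X : ℝ[X]) ^ a.natDegree).coeff k : ℝ) : ℂ) := by
    have : (1 - X : ℂ[X]) ^ a.natDegree
        = ((1 - X : ℝ[X]) ^ a.natDegree).map (algebraMap ℝ ℂ) := by simp
    simp only [Complex.ofReal_zero, mul_zero, Complex.exp_zero, C_1, one_mul, Multiset.map_const',
      Multiset.prod_replicate, card_aroots]
    rw [this, coeff_map]; rfl
  rw [h2] at h1
  have h3 := (Complex.continuous_re.tendsto _).comp h1
  rw [Complex.ofReal_re] at h3
  refine h3.congr fun Δ => ?_
  have := congrArg (fun f : ℂ[X] => (f.coeff k).re) (hφ Δ)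
  simp only [coeff_map, Complex.coe_algebraMap, Complex.ofReal_re] at this
  rw [this]; rfl

/-- The limit of the rescaled kernels: the value at `k + x`, for `0 < x ≤ 1`, of the function obtained
by applying the difference operator `(1 - B) ^ p` to the truncated power `t_+ ^ r / r!`. -/
noncomputable def limitKernel (p r k : ℕ) (x : ℝ) : ℝ :=
  ∑ j ∈ Finset.range (k + 1), ((1 - X : ℝ[X]) ^ p).coeff j * ((((k - j : ℕ) : ℝ) + x) ^ r
    / r.factorial)

@[fun_prop]
lemma continuous_limitKernel (p r k : ℕ) : Continuous (limitKernel p r k) := by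
  unfold limitKernel; fun_prop

section Rescaling

variable {q r : ℕ} {a b : ℝ[X]} {φ : ℝ → ℝ[X]}

lemma tendsto_kernel_rescaled (hb : b.Monic) (hbq : b.natDegree = q) (y : ℝ) :
    Tendsto (fun Δ : ℝ => observation (q + r + 1) b
      (flow (carmaOp ℝ (q + r + 1) a) (y * Δ) (lastVec (q + r + 1))) / Δ ^ r) (𝓝[>] 0)
      (𝓝 (y ^ r / r.factorial)) := by
  have hy : Tendsto (fun Δ : ℝ => y * Δ) (𝓝[>] 0) (𝓝 0) := by
    have : Continuous fun Δ : ℝ => y * Δ := by fun_prop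
    simpa using (this.tendsto 0).mono_left nhdsWithin_le_nhds
  have h1 := (isBigO_kernel_sub (r := r) (a := a) hb hbq).comp_tendsto hy
  have h2 : ((fun t : ℝ => t ^ (r + 1)) ∘ fun Δ : ℝ => y * Δ) =o[𝓝[>] 0] fun Δ => Δ ^ r := by
    have h3 : (fun Δ : ℝ => Δ ^ (r + 1)) =o[𝓝[>] 0] fun Δ => Δ ^ r :=
      (Asymptotics.isLittleO_pow_pow (Nat.lt_succ_self r)).mono nhdsWithin_le_nhds
    refine (h3.const_mul_left (y ^ (r + 1))).congr_left fun Δ => ?_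
    simp [mul_pow]
  have h3 := (h1.trans_isLittleO h2).tendsto_div_nhds_zero
  have h4 := h3.add_const (y ^ r / r.factorial)
  rw [zero_add] at h4
  refine h4.congr' ?_
  filter_upwards [self_mem_nhdsWithin] with Δ hΔ
  have hΔ0 : Δ ^ r ≠ 0 := pow_ne_zero _ (ne_of_gt hΔ)
  simp only [Function.comp_apply]
  rw [sub_div, mul_pow]
  field_simp
  ring

lemma exists_bound_kernel_rescaled (hb : b.Monic) (hbq : b.natDegree = q) (M : ℝ) :
    ∃ K, ∀ᶠ Δ : ℝ in 𝓝[>] 0, ∀ y ∈ Set.Icc 0 M, |observation (q + r + 1) b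
      (flow (carmaOp ℝ (q + r + 1) a) (y * Δ) (lastVec (q + r + 1))) / Δ ^ r| ≤ K := by
  obtain ⟨K, hK⟩ := (isBigO_kernel_sub (r := r) (a := a) hb hbq).bound
  obtain ⟨δ, hδ, hball⟩ := Metric.eventually_nhds_iff.1 hK
  refine ⟨|K| * M ^ (r + 1) + M ^ r, ?_⟩
  have h1 : ∀ᶠ Δ : ℝ in 𝓝[>] 0, |M| * Δ < δ := by
    have hc : Continuous fun Δ : ℝ => |M| * Δ := by fun_prop
    have := (hc.tendsto 0).mono_left (nhdsWithin_le_nhds (s := Set.Ioi 0))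
    rw [mul_zero] at this
    exact this.eventually (gt_mem_nhds hδ)
  have h2 : ∀ᶠ Δ : ℝ in 𝓝[>] 0, Δ < 1 := nhdsWithin_le_nhds (gt_mem_nhds one_pos)
  filter_upwards [h1, h2, self_mem_nhdsWithin] with Δ hΔ1 hΔ2 hΔ y hy
  have hΔ0 : 0 < Δ := hΔ
  have hM : 0 ≤ M := hy.1.trans hy.2
  have hyΔ : 0 ≤ y * Δ := mul_nonneg hy.1 hΔ0.le
  have h3 := hball (y := y * Δ) (by
    rw [Real.dist_eq, sub_zero, abs_of_nonneg hyΔ]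
    rw [abs_of_nonneg hM] at hΔ1
    exact (mul_le_mul_of_nonneg_right hy.2 hΔ0.le).trans_lt hΔ1)
  rw [Real.norm_eq_abs, Real.norm_eq_abs, abs_of_nonneg (pow_nonneg hyΔ _)] at h3
  set g := observation (q + r + 1) b (flow (carmaOp ℝ (q + r + 1) a) (y * Δ) (lastVec (q + r + 1)))
  have hyM : ∀ n, y ^ n ≤ M ^ n := fun n => pow_le_pow_left₀ hy.1 hy.2 n
  have h4 : |g| ≤ |K| * (y * Δ) ^ (r + 1) + (y * Δ) ^ r := by
    have h5 : (y * Δ) ^ r / r.factorial ≤ (y * Δ) ^ r :=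
      div_le_self (pow_nonneg hyΔ _) (by exact_mod_cast Nat.succ_le_of_lt r.factorial_pos)
    have h6 : |g| ≤ |g - (y * Δ) ^ r / r.factorial| + (y * Δ) ^ r / r.factorial := by
      have := abs_add_le (g - (y * Δ) ^ r / r.factorial) ((y * Δ) ^ r / r.factorial)
      rwa [sub_add_cancel, abs_of_nonneg (a := (y * Δ) ^ r / _) (by positivity)] at this
    have h7 : K * (y * Δ) ^ (r + 1) ≤ |K| * (y * Δ) ^ (r + 1) :=
      mul_le_mul_of_nonneg_right (le_abs_self K) (pow_nonneg hyΔ _)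
    linarith
  rw [abs_div, abs_of_pos (pow_pos hΔ0 r), div_le_iff₀ (pow_pos hΔ0 r)]
  refine h4.trans ?_
  have h8 : (y * Δ) ^ (r + 1) ≤ M ^ (r + 1) * Δ ^ r := by
    rw [mul_pow]
    refine mul_le_mul (hyM _) ?_ (pow_nonneg hΔ0.le _) (pow_nonneg hM _)
    exact pow_le_pow_of_le_one hΔ0.le hΔ2.le (Nat.le_succ r)
  have h9 : (y * Δ) ^ r ≤ M ^ r * Δ ^ r := by
    rw [mul_pow]; exact mul_le_mul_of_nonneg_right (hyM r) (pow_nonneg hΔ0.le _)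
  have := mul_le_mul_of_nonneg_left h8 (abs_nonneg K)
  linarith

lemma tendsto_filteredKernel_rescaled (hb : b.Monic) (hbq : b.natDegree = q)
    (hap : a.natDegree = q + r + 1) (hφ : ∀ Δ, (φ Δ).map (algebraMap ℝ ℂ) = arFilter a Δ)
    (k : ℕ) (x : ℝ) :
    Tendsto (fun Δ => filteredKernel (q + r + 1) a b (φ Δ) Δ k (Δ * x) / Δ ^ r) (𝓝[>] 0)
      (𝓝 (limitKernel (q + r + 1) r k x)) := by
  simp only [filteredKernel_eq_sum, limitKernel, Finset.sum_div]
  refine tendsto_finsetSum _ fun j _ => ?_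
  have h1 := tendsto_coeff_arFilter hφ j
  rw [hap] at h1
  refine (h1.mul (tendsto_kernel_rescaled (a := a) hb hbq (((k - j : ℕ) : ℝ) + x))).congr fun Δ => ?_
  rw [show ((k - j : ℕ) : ℝ) * Δ + Δ * x = (((k - j : ℕ) : ℝ) + x) * Δ by ring, mul_div_assoc]

lemma exists_bound_filteredKernel_rescaled (hb : b.Monic) (hbq : b.natDegree = q)
    (hφ : ∀ Δ, (φ Δ).map (algebraMap ℝ ℂ) = arFilter a Δ) (k : ℕ) :
    ∃ K, ∀ᶠ Δ in 𝓝[>] 0, ∀ x ∈ Set.Icc (0 : ℝ) 1,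
      |filteredKernel (q + r + 1) a b (φ Δ) Δ k (Δ * x) / Δ ^ r| ≤ K := by
  obtain ⟨K, hK⟩ := exists_bound_kernel_rescaled (r := r) (a := a) hb hbq (k + 1)
  have h1 : ∀ᶠ Δ in 𝓝[>] (0 : ℝ), ∀ j ∈ Finset.range (k + 1), |(φ Δ).coeff j|
      ≤ |((1 - X : ℝ[X]) ^ a.natDegree).coeff j| + 1 := by
    rw [Filter.eventually_all_finset]
    intro j _
    exact ((tendsto_coeff_arFilter hφ j).abs.eventually (gt_mem_nhds (lt_add_one _))).mono
      fun Δ h => h.le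
  refine ⟨∑ j ∈ Finset.range (k + 1), (|((1 - X : ℝ[X]) ^ a.natDegree).coeff j| + 1) * K, ?_⟩
  filter_upwards [hK, h1] with Δ h2 h3 x hx
  rw [filteredKernel_eq_sum, Finset.sum_div]
  refine (Finset.abs_sum_le_sum_abs _ _).trans (Finset.sum_le_sum fun j hj => ?_)
  rw [show ((k - j : ℕ) : ℝ) * Δ + Δ * x = (((k - j : ℕ) : ℝ) + x) * Δ by ring, mul_div_assoc,
    abs_mul]
  refine mul_le_mul (h3 j hj) (h2 _ ⟨by have := hx.1; positivity, ?_⟩) (abs_nonneg _)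
    (by positivity)
  have : ((k - j : ℕ) : ℝ) ≤ k := by exact_mod_cast Nat.sub_le k j
  linarith [hx.2]

/-- The covariances of the filtered sample, suitably rescaled, converge. -/
lemma tendsto_kernelGram (hb : b.Monic) (hbq : b.natDegree = q)
    (hap : a.natDegree = q + r + 1) (hφ : ∀ Δ, (φ Δ).map (algebraMap ℝ ℂ) = arFilter a Δ)
    (i j : ℕ) :
    Tendsto (fun Δ => kernelGram (q + r + 1) a b (φ Δ) Δ i j / Δ ^ (2 * r + 1)) (𝓝[>] 0)
      (𝓝 (∫ x in (0 : ℝ)..1, limitKernel (q + r + 1) r i x * limitKernel (q + r + 1) r j x)) := by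
  obtain ⟨K, hK⟩ := exists_bound_filteredKernel_rescaled (r := r) hb hbq hφ i
  obtain ⟨K', hK'⟩ := exists_bound_filteredKernel_rescaled (r := r) hb hbq hφ j
  have h1 : Tendsto (fun Δ => ∫ x in (0 : ℝ)..1,
      (filteredKernel (q + r + 1) a b (φ Δ) Δ i (Δ * x) / Δ ^ r) *
      (filteredKernel (q + r + 1) a b (φ Δ) Δ j (Δ * x) / Δ ^ r)) (𝓝[>] 0)
      (𝓝 (∫ x in (0 : ℝ)..1, limitKernel (q + r + 1) r i x * limitKernel (q + r + 1) r j x)) := by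
    refine intervalIntegral.tendsto_integral_filter_of_dominated_convergence (fun _ => K * K')
      (Eventually.of_forall fun Δ => ?_) ?_ (intervalIntegrable_const) ?_
    · have hc : ∀ k, Continuous fun x => filteredKernel (q + r + 1) a b (φ Δ) Δ k (Δ * x) / Δ ^ r :=
        fun k => ((continuous_filteredKernel _ _ _ _ _ k).comp
          (continuous_const.mul continuous_id)).div_const _
      exact ((hc i).mul (hc j)).aestronglyMeasurable
    · filter_upwards [hK, hK'] with Δ h2 h3
      refine Eventually.of_forall fun x hx => ?_
      rw [Set.uIoc_of_le zero_le_one] at hx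
      rw [norm_mul, Real.norm_eq_abs, Real.norm_eq_abs]
      have h4 := h2 x ⟨hx.1.le, hx.2⟩
      exact mul_le_mul h4 (h3 x ⟨hx.1.le, hx.2⟩) (abs_nonneg _) ((abs_nonneg _).trans h4)
    · exact Eventually.of_forall fun x _ =>
        (tendsto_filteredKernel_rescaled hb hbq hap hφ i x).mul
          (tendsto_filteredKernel_rescaled hb hbq hap hφ j x)
  refine h1.congr' ?_
  filter_upwards [self_mem_nhdsWithin] with Δ hΔ
  have hΔ0 : Δ ≠ 0 := ne_of_gt hΔ
  have h2 := intervalIntegral.mul_integral_comp_mul_left (a := 0) (b := 1) (c := Δ)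
    (f := fun s => filteredKernel (q + r + 1) a b (φ Δ) Δ i s
      * filteredKernel (q + r + 1) a b (φ Δ) Δ j s)
  rw [mul_zero, mul_one] at h2
  rw [kernelGram, ← h2, mul_div_assoc, ← intervalIntegral.integral_div,
    ← intervalIntegral.integral_const_mul]
  refine intervalIntegral.integral_congr fun x _ => ?_
  field_simp
  ring

end Rescaling

/-! ### The limiting kernels as coefficients of a polynomial -/

lemma one_sub_X_mul_mk (f : ℕ → ℝ) : (1 - PowerSeries.X) * PowerSeries.mk f
    = PowerSeries.mk fun n => f n - if n = 0 then 0 else f (n - 1) := by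
  ext n
  rw [sub_mul, one_mul, map_sub, PowerSeries.coeff_mk, PowerSeries.coeff_mk]
  rcases n with _ | n
  · simp
  · rw [PowerSeries.coeff_succ_X_mul, PowerSeries.coeff_mk]; simp

/-- If the generating function of `(m + x) ^ r / r!`, multiplied by `(1 - z) ^ (r + 1)`, is a
polynomial `N` of degree at most `r`, then `(1 - z) ^ q N` generates the limiting kernels. -/
lemma coeff_mul_one_sub_pow {q r : ℕ} {x : ℝ} {N : ℝ[X]}
    (hN : (1 - PowerSeries.X) ^ (r + 1) * PowerSeries.mk (fun m : ℕ => ((m : ℝ) + x) ^ r / r.factorial)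
      = (N : PowerSeries ℝ)) (k : ℕ) :
    ((1 - X) ^ q * N).coeff k = limitKernel (q + r + 1) r k x := by
  rw [← Polynomial.coeff_coe]
  push_cast
  rw [← hN, ← mul_assoc, ← pow_add, ← add_assoc, PowerSeries.coeff_mul,
    Finset.Nat.sum_antidiagonal_eq_sum_range_succ_mk, limitKernel]
  refine Finset.sum_congr rfl fun j _ => ?_
  rw [PowerSeries.coeff_mk, ← Polynomial.coeff_coe]
  push_cast
  rfl

lemma sum_limitKernel_mul_pow {q r : ℕ} {x : ℝ} {N : ℝ[X]} (hdeg : N.natDegree ≤ r)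
    (hN : (1 - PowerSeries.X) ^ (r + 1) * PowerSeries.mk (fun m : ℕ => ((m : ℝ) + x) ^ r / r.factorial)
      = (N : PowerSeries ℝ)) (z : ℂ) :
    ∑ k ∈ Finset.range (q + r + 1), (limitKernel (q + r + 1) r k x : ℂ) * z ^ k
      = (1 - z) ^ q * aeval z N := by
  have h1 : ((1 - X) ^ q * N).natDegree < q + r + 1 := by
    refine Nat.lt_succ_of_le (natDegree_mul_le.trans (add_le_add ?_ hdeg))
    refine natDegree_pow_le.trans ?_
    have : (1 - X : ℝ[X]).natDegree ≤ 1 := by compute_degree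
    nlinarith
  have h2 : (1 - z) ^ q * aeval z N = aeval z ((1 - X) ^ q * N) := by simp
  rw [h2, aeval_eq_sum_range' h1]
  refine Finset.sum_congr rfl fun k _ => ?_
  rw [coeff_mul_one_sub_pow hN, Complex.real_smul]

/-- The spectral density of the limiting kernels. -/
lemma sum_integral_limitKernel {q r : ℕ} {N : ℝ → ℝ[X]} (hdeg : ∀ x, (N x).natDegree ≤ r)
    (hN : ∀ x, (1 - PowerSeries.X) ^ (r + 1) *
      PowerSeries.mk (fun m : ℕ => ((m : ℝ) + x) ^ r / r.factorial) = (N x : PowerSeries ℝ))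
    (z : ℂ) :
    ∑ i ∈ Finset.range (q + r + 1), ∑ j ∈ Finset.range (q + r + 1),
      ((∫ x in (0 : ℝ)..1, limitKernel (q + r + 1) r i x * limitKernel (q + r + 1) r j x : ℝ) : ℂ)
        * (z⁻¹ ^ i * z ^ j)
      = (1 - z⁻¹) ^ q * (1 - z) ^ q * ∫ x in (0 : ℝ)..1, aeval z⁻¹ (N x) * aeval z (N x) := by
  have h1 : ∀ i j, ((∫ x in (0 : ℝ)..1, limitKernel (q + r + 1) r i x
      * limitKernel (q + r + 1) r j x : ℝ) : ℂ) * (z⁻¹ ^ i * z ^ j)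
      = ∫ x in (0 : ℝ)..1, ((limitKernel (q + r + 1) r i x : ℂ) * z⁻¹ ^ i)
        * ((limitKernel (q + r + 1) r j x : ℂ) * z ^ j) := by
    intro i j
    rw [← intervalIntegral.integral_ofReal, ← intervalIntegral.integral_mul_const]
    refine intervalIntegral.integral_congr fun x _ => ?_
    push_cast; ring
  simp only [h1]
  have hint : ∀ i j, IntervalIntegrable (fun x => ((limitKernel (q + r + 1) r i x : ℂ) * z⁻¹ ^ i)
        * ((limitKernel (q + r + 1) r j x : ℂ) * z ^ j)) volume 0 1 := by
    intro i j
    exact Continuous.intervalIntegrable (by fun_prop) _ _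
  rw [← intervalIntegral.integral_const_mul]
  calc _ = ∑ i ∈ Finset.range (q + r + 1), ∫ x in (0 : ℝ)..1, ∑ j ∈ Finset.range (q + r + 1),
        ((limitKernel (q + r + 1) r i x : ℂ) * z⁻¹ ^ i)
        * ((limitKernel (q + r + 1) r j x : ℂ) * z ^ j) := by
        refine Finset.sum_congr rfl fun i _ => ?_
        rw [intervalIntegral.integral_finsetSum fun j _ => hint i j]
    _ = ∫ x in (0 : ℝ)..1, ∑ i ∈ Finset.range (q + r + 1), ∑ j ∈ Finset.range (q + r + 1),
        ((limitKernel (q + r + 1) r i x : ℂ) * z⁻¹ ^ i)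
        * ((limitKernel (q + r + 1) r j x : ℂ) * z ^ j) := by
        refine (intervalIntegral.integral_finsetSum fun i _ => ?_).symm
        exact Continuous.intervalIntegrable (by fun_prop) _ _
    _ = _ := by
        refine intervalIntegral.integral_congr fun x _ => ?_
        rw [← Finset.sum_mul_sum, sum_limitKernel_mul_pow (hdeg x) (hN x),
          sum_limitKernel_mul_pow (hdeg x) (hN x)]
        ring

/-! ### The asymptotic form of the moving average -/

section AsymptoticForm

variable {Ω : Type*} [MeasurableSpace Ω] {μ : Measure Ω} [IsProbabilityMeasure μ]

omit [IsProbabilityMeasure μ] in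
lemma IsMARepresentation.variance_nonneg {m : ℕ} {W : ℤ → Ω → ℂ} {θ : ℝ[X]} {v : ℝ} {Z : ℤ → Ω → ℝ}
    (h : IsMARepresentation μ m W θ v Z) : 0 ≤ v :=
  h.whiteNoise.variance_eq 0 ▸ ProbabilityTheory.variance_nonneg _ _

/-- Convergence of the coefficients makes the relative mean square error negligible. -/
lemma tendsto_integral_norm_sq_div {m : ℕ} {W : ℝ → ℤ → Ω → ℂ} {θ : ℝ → ℝ[X]} {v : ℝ → ℝ}
    {Z : ℝ → ℤ → Ω → ℝ} {θ₀ : ℝ[X]}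
    (h : ∀ Δ, 0 < Δ → IsMARepresentation μ m (W Δ) (θ Δ) (v Δ) (Z Δ))
    (hθ : ∀ k, Tendsto (fun Δ => (θ Δ).coeff k) (𝓝[>] 0) (𝓝 (θ₀.coeff k))) (n : ℤ) :
    Tendsto (fun Δ => (∫ ω, ‖W Δ n ω - ((shiftFilter θ₀ (Z Δ) n ω : ℝ) : ℂ)‖ ^ 2 ∂μ) / v Δ)
      (𝓝[>] 0) (𝓝 0) := by
  set M := max m θ₀.natDegree with hM
  have hlim : Tendsto (fun Δ => ∑ i ∈ Finset.range (M + 1), ((θ Δ).coeff i - θ₀.coeff i) ^ 2)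
      (𝓝[>] 0) (𝓝 0) := by
    have h0 : ∑ i ∈ Finset.range (M + 1), (θ₀.coeff i - θ₀.coeff i) ^ 2 = 0 := by simp
    have h1 := tendsto_finsetSum (Finset.range (M + 1)) fun i _ =>
      ((hθ i).sub_const (θ₀.coeff i)).pow 2
    rwa [h0] at h1
  refine tendsto_of_tendsto_of_tendsto_of_le_of_le' tendsto_const_nhds hlim ?_ ?_
  · filter_upwards [self_mem_nhdsWithin] with Δ hΔ
    exact div_nonneg (integral_nonneg fun ω => sq_nonneg _) (h Δ hΔ).variance_nonneg
  · filter_upwards [self_mem_nhdsWithin] with Δ hΔ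
    rw [(h Δ hΔ).integral_norm_sq]
    have h1 : ∑ i ∈ (θ Δ - θ₀).support, (θ Δ - θ₀).coeff i ^ 2
        ≤ ∑ i ∈ Finset.range (M + 1), ((θ Δ).coeff i - θ₀.coeff i) ^ 2 := by
      simp only [coeff_sub]
      refine Finset.sum_le_sum_of_subset_of_nonneg ?_ fun i _ _ => sq_nonneg _
      refine supp_subset_range (Nat.lt_succ_of_le ((natDegree_sub_le _ _).trans ?_))
      exact max_le_max (h Δ hΔ).natDegree_le le_rfl
    refine le_trans ?_ h1
    rcases eq_or_ne (v Δ) 0 with hv | hv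
    · rw [hv, div_zero]
      exact Finset.sum_nonneg fun i _ => sq_nonneg _
    · rw [mul_div_cancel_left₀ _ hv]

/-- The asymptotic form of the filtered sample, given a spectral factorization `τ |ϑ|²` of the
limiting kernel polynomials `N`. -/
theorem IsCARMA.hasAsymptoticForm {σ : ℝ} (hσ : 0 < σ) {L Y : ℝ → Ω → ℝ}
    (hL : IsSecondOrderLevy μ σ L) {q r : ℕ} {a b : ℝ[X]} (ha : a.Monic)
    (hap : a.natDegree = q + r + 1) (hb : b.Monic) (hbq : b.natDegree = q)
    (hY : IsCARMA μ (q + r + 1) a b L Y) {N : ℝ → ℝ[X]} (hdeg : ∀ x, (N x).natDegree ≤ r)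
    (hN : ∀ x, (1 - PowerSeries.X) ^ (r + 1) *
      PowerSeries.mk (fun m : ℕ => ((m : ℝ) + x) ^ r / r.factorial) = (N x : PowerSeries ℝ))
    {ϑ : ℝ[X]} {τ : ℝ} (hτ : 0 < τ) (hϑ0 : ϑ.coeff 0 = 1)
    (hϑ : ∀ z : ℂ, ‖z‖ < 1 → aeval z ϑ ≠ 0)
    (hspec : ∀ z : ℂ, z ≠ 0 → ∫ x in (0 : ℝ)..1, aeval z⁻¹ (N x) * aeval z (N x)
      = τ * (aeval z⁻¹ ϑ * aeval z ϑ))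
    {θ : ℝ → ℝ[X]} {v : ℝ → ℝ} {Z : ℝ → ℤ → Ω → ℝ}
    (h : ∀ Δ : ℝ, 0 < Δ →
      IsMARepresentation μ (q + r + 1 - 1) (filteredSample a Y Δ) (θ Δ) (v Δ) (Z Δ)) :
    HasAsymptoticForm μ (filteredSample a Y) θ v Z (ϑ * (1 - X) ^ q)
      (fun Δ => σ ^ 2 * Δ ^ (2 * r + 1) * τ) := by
  choose φ hφ using exists_real_arFilter a
  set p := q + r + 1 with hp
  set G : ℝ → ℕ → ℕ → ℝ := fun Δ => kernelGram p a b (φ Δ) Δ with hG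
  set G₀ : ℕ → ℕ → ℝ := fun i j => ∫ x in (0 : ℝ)..1, limitKernel p r i x * limitKernel p r j x
    with hG₀
  set v₀ : ℝ → ℝ := fun Δ => σ ^ 2 * Δ ^ (2 * r + 1) * τ with hv₀
  have hv₀pos : ∀ Δ, 0 < Δ → 0 < v₀ Δ := fun Δ hΔ => by positivity
  have hlim : ∀ i j, Tendsto (fun Δ => σ ^ 2 * G Δ i j / v₀ Δ) (𝓝[>] 0) (𝓝 (G₀ i j / τ)) := by
    intro i j
    refine ((tendsto_kernelGram hb hbq hap hφ i j).div_const τ).congr' ?_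
    filter_upwards [self_mem_nhdsWithin] with Δ hΔ
    have hΔ0 : Δ ≠ 0 := ne_of_gt hΔ
    simp only [hv₀, hG, ← hp]
    field_simp
  have hid : ∀ Δ, 0 < Δ →
      (∀ z : ℂ, z ≠ 0 → ∑ i ∈ Finset.range p, ∑ j ∈ Finset.range p,
        ((σ ^ 2 * G Δ i j : ℝ) : ℂ) * (z⁻¹ ^ i * z ^ j)
          = v Δ * (aeval z⁻¹ (θ Δ) * aeval z (θ Δ))) ∧
      ∑ i ∈ Finset.range p, σ ^ 2 * G Δ i i = v Δ * ∑ i ∈ Finset.range p, (θ Δ).coeff i ^ 2 := by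
    intro Δ hΔ
    obtain ⟨w, hw, -, hinner⟩ := hY.exists_L2 hL (Nat.succ_pos _) ha hap hΔ (hφ Δ)
    exact (h Δ hΔ).spectral_identity (Nat.succ_pos _) hw hinner
  have hbound : ∀ᶠ Δ in 𝓝[>] 0, v Δ / v₀ Δ ∈ Set.Icc 0 (∑ i ∈ Finset.range p, G₀ i i / τ + 1) := by
    have h1 := tendsto_finsetSum (Finset.range p) fun i _ => hlim i i
    filter_upwards [self_mem_nhdsWithin, h1.eventually (gt_mem_nhds (lt_add_one _))] with Δ hΔ h2
    refine ⟨div_nonneg (h Δ hΔ).variance_nonneg (hv₀pos Δ hΔ).le, le_trans ?_ h2.le⟩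
    rw [← Finset.sum_div, (hid Δ hΔ).2]
    refine div_le_div_of_nonneg_right ?_ (hv₀pos Δ hΔ).le
    refine le_mul_of_one_le_right (h Δ hΔ).variance_nonneg ?_
    have h3 := Finset.single_le_sum (f := fun i => (θ Δ).coeff i ^ 2) (fun i _ => sq_nonneg _)
      (Finset.mem_range.2 (Nat.succ_pos (q + r)))
    simpa [(h Δ hΔ).coeff_zero] using h3
  have hspec' : ∀ z : ℂ, z ≠ 0 →
      Tendsto (fun Δ => ((v Δ / v₀ Δ : ℝ) : ℂ) * (aeval z⁻¹ (θ Δ) * aeval z (θ Δ))) (𝓝[>] 0)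
        (𝓝 (aeval z⁻¹ (ϑ * (1 - X) ^ q) * aeval z (ϑ * (1 - X) ^ q))) := by
    intro z hz
    have h1 : Tendsto (fun Δ => ∑ i ∈ Finset.range p, ∑ j ∈ Finset.range p,
        ((σ ^ 2 * G Δ i j / v₀ Δ : ℝ) : ℂ) * (z⁻¹ ^ i * z ^ j)) (𝓝[>] 0)
        (𝓝 (∑ i ∈ Finset.range p, ∑ j ∈ Finset.range p,
          ((G₀ i j / τ : ℝ) : ℂ) * (z⁻¹ ^ i * z ^ j))) :=
      tendsto_finsetSum _ fun i _ => tendsto_finsetSum _ fun j _ =>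
        ((Complex.continuous_ofReal.tendsto _).comp (hlim i j)).mul_const _
    have h2 : ∑ i ∈ Finset.range p, ∑ j ∈ Finset.range p,
          ((G₀ i j / τ : ℝ) : ℂ) * (z⁻¹ ^ i * z ^ j)
        = aeval z⁻¹ (ϑ * (1 - X) ^ q) * aeval z (ϑ * (1 - X) ^ q) := by
      have h3 := sum_integral_limitKernel (q := q) hdeg hN z
      rw [hspec z hz] at h3
      have hτ' : (τ : ℂ) ≠ 0 := by exact_mod_cast hτ.ne'
      have h4 : ∑ i ∈ Finset.range p, ∑ j ∈ Finset.range p,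
          ((G₀ i j / τ : ℝ) : ℂ) * (z⁻¹ ^ i * z ^ j) = (τ : ℂ)⁻¹ * ∑ i ∈ Finset.range p,
          ∑ j ∈ Finset.range p, (G₀ i j : ℂ) * (z⁻¹ ^ i * z ^ j) := by
        rw [Finset.mul_sum]
        refine Finset.sum_congr rfl fun i _ => ?_
        rw [Finset.mul_sum]
        refine Finset.sum_congr rfl fun j _ => ?_
        push_cast; ring
      rw [h4, h3]
      simp only [map_mul, map_pow, map_sub, map_one, aeval_X]
      field_simp
    rw [h2] at h1
    refine h1.congr' ?_
    filter_upwards [self_mem_nhdsWithin] with Δ hΔ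
    have h5 := (hid Δ hΔ).1 z hz
    rw [Complex.ofReal_div, div_mul_eq_mul_div, ← h5, Finset.sum_div]
    refine Finset.sum_congr rfl fun i _ => ?_
    rw [Finset.sum_div]
    refine Finset.sum_congr rfl fun j _ => ?_
    push_cast; ring
  have hQ0 : (ϑ * (1 - X) ^ q).coeff 0 = 1 := by
    rw [mul_coeff_zero, hϑ0, coeff_zero_eq_eval_zero]
    simp
  have hQ : ∀ z : ℂ, ‖z‖ < 1 → aeval z (ϑ * (1 - X) ^ q) ≠ 0 := by
    intro z hz
    simp only [map_mul, map_pow, map_sub, map_one, aeval_X]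
    refine mul_ne_zero (hϑ z hz) (pow_ne_zero _ fun h1 => ?_)
    rw [← sub_eq_zero.1 h1, norm_one] at hz
    exact lt_irrefl _ hz
  have hθ : ∀ᶠ Δ in 𝓝[>] 0, (θ Δ).coeff 0 = 1 ∧ (θ Δ).natDegree ≤ q + r ∧
      ∀ z : ℂ, ‖z‖ < 1 → aeval z (θ Δ) ≠ 0 := by
    filter_upwards [self_mem_nhdsWithin] with Δ hΔ
    exact ⟨(h Δ hΔ).coeff_zero, (h Δ hΔ).natDegree_le, (h Δ hΔ).no_zeroes⟩
  obtain ⟨h1, h2⟩ := tendsto_of_tendsto_spectral hθ hbound hQ0 hQ hspec'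
  exact ⟨h1, h2, tendsto_integral_norm_sq_div h h1⟩

end AsymptoticForm

/-! ### The three explicit cases -/

lemma generating_one (x : ℝ) : (1 - PowerSeries.X) ^ (0 + 1) *
    PowerSeries.mk (fun m : ℕ => ((m : ℝ) + x) ^ 0 / (Nat.factorial 0)) = ((1 : ℝ[X]) : PowerSeries ℝ) := by
  rw [zero_add, pow_one, one_sub_X_mul_mk]
  ext n
  rw [PowerSeries.coeff_mk, Polynomial.coeff_coe, coeff_one]
  rcases n with _ | n <;> simp

/-- The kernel polynomial for `p - q = 2`: a linear B-spline. -/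
noncomputable def linearSpline (x : ℝ) : ℝ[X] := C x + C (1 - x) * X

lemma generating_linearSpline (x : ℝ) : (1 - PowerSeries.X) ^ (1 + 1) *
    PowerSeries.mk (fun m : ℕ => ((m : ℝ) + x) ^ 1 / (Nat.factorial 1))
      = (linearSpline x : PowerSeries ℝ) := by
  rw [pow_succ, pow_one, mul_assoc, one_sub_X_mul_mk, one_sub_X_mul_mk]
  ext n
  rw [PowerSeries.coeff_mk, Polynomial.coeff_coe, linearSpline, coeff_add, coeff_C, coeff_C_mul,
    coeff_X]
  rcases n with _ | _ | n
  · simp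
  · simp
  · simp

/-- The kernel polynomial for `p - q = 3`: a quadratic B-spline. -/
noncomputable def quadraticSpline (x : ℝ) : ℝ[X] :=
  C (x ^ 2 / 2) + C ((1 + 2 * x - 2 * x ^ 2) / 2) * X + C ((1 - x) ^ 2 / 2) * X ^ 2

lemma generating_quadraticSpline (x : ℝ) : (1 - PowerSeries.X) ^ (2 + 1) *
    PowerSeries.mk (fun m : ℕ => ((m : ℝ) + x) ^ 2 / (Nat.factorial 2))
      = (quadraticSpline x : PowerSeries ℝ) := by
  rw [pow_succ, pow_succ, pow_one, mul_assoc, mul_assoc, one_sub_X_mul_mk, one_sub_X_mul_mk,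
    one_sub_X_mul_mk]
  ext n
  rw [PowerSeries.coeff_mk, Polynomial.coeff_coe, quadraticSpline, coeff_add, coeff_add, coeff_C,
    coeff_C_mul, coeff_C_mul, coeff_X, coeff_X_pow]
  rcases n with _ | _ | _ | n
  · simp
  · simp; ring
  · simp; ring
  · simp; ring

lemma integral_ofReal_pow (n : ℕ) : ∫ x in (0 : ℝ)..1, (x : ℂ) ^ n = 1 / (n + 1) := by
  have h1 : ∀ x : ℝ, (x : ℂ) ^ n = ((x ^ n : ℝ) : ℂ) := fun x => by push_cast; rfl
  simp only [h1]
  rw [intervalIntegral.integral_ofReal, integral_pow]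
  push_cast
  simp

lemma integral_quartic (c : Fin 5 → ℂ) : ∫ x in (0 : ℝ)..1, ∑ i, c i * (x : ℂ) ^ (i : ℕ)
    = ∑ i : Fin 5, c i / ((i : ℕ) + 1) := by
  rw [intervalIntegral.integral_finsetSum
    fun i _ => Continuous.intervalIntegrable (by fun_prop) _ _]
  refine Finset.sum_congr rfl fun i _ => ?_
  rw [intervalIntegral.integral_const_mul, integral_ofReal_pow]
  ring

lemma integral_linearSpline {z : ℂ} (hz : z ≠ 0) :
    ∫ x in (0 : ℝ)..1, aeval z⁻¹ (linearSpline x) * aeval z (linearSpline x)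
      = 2 / 3 + (z + z⁻¹) / 6 := by
  have h : ∀ x : ℝ, aeval z⁻¹ (linearSpline x) * aeval z (linearSpline x)
      = ∑ i : Fin 5, (![1, z + z⁻¹ - 2, 2 - z - z⁻¹, 0, 0] : Fin 5 → ℂ) i * (x : ℂ) ^ (i : ℕ) := by
    intro x
    simp [linearSpline, Fin.sum_univ_five]
    field_simp
    ring
  simp only [h, integral_quartic]
  simp [Fin.sum_univ_five]
  field_simp
  ring

lemma integral_quadraticSpline {z : ℂ} (hz : z ≠ 0) :
    ∫ x in (0 : ℝ)..1, aeval z⁻¹ (quadraticSpline x) * aeval z (quadraticSpline x)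
      = 11 / 20 + 13 / 60 * (z + z⁻¹) + (z ^ 2 + (z⁻¹) ^ 2) / 120 := by
  -- coefficients in `x` of the product of the two quadratic polynomials
  -- `α + β x + γ x ^ 2` at `z⁻¹` and at `z`
  have h : ∀ x : ℝ, aeval z⁻¹ (quadraticSpline x) * aeval z (quadraticSpline x)
      = ∑ i : Fin 5, (![(z⁻¹ + z⁻¹ ^ 2) / 2 * ((z + z ^ 2) / 2),
        (z⁻¹ + z⁻¹ ^ 2) / 2 * (z - z ^ 2) + (z⁻¹ - z⁻¹ ^ 2) * ((z + z ^ 2) / 2),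
        (z⁻¹ + z⁻¹ ^ 2) / 2 * ((1 - z) ^ 2 / 2) + (z⁻¹ - z⁻¹ ^ 2) * (z - z ^ 2)
          + (1 - z⁻¹) ^ 2 / 2 * ((z + z ^ 2) / 2),
        (z⁻¹ - z⁻¹ ^ 2) * ((1 - z) ^ 2 / 2) + (1 - z⁻¹) ^ 2 / 2 * (z - z ^ 2),
        (1 - z⁻¹) ^ 2 / 2 * ((1 - z) ^ 2 / 2)] : Fin 5 → ℂ) i * (x : ℂ) ^ (i : ℕ) := by
    intro x
    simp [quadraticSpline, Fin.sum_univ_five]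
    ring
  simp only [h, integral_quartic]
  simp [Fin.sum_univ_five]
  field_simp
  ring

lemma one_add_mul_add_mul_sq_ne_zero {t₁ t₂ : ℝ} (h₁ : 0 ≤ t₁) (h₂ : 0 ≤ t₂) (h : t₁ + t₂ < 1)
    {z : ℂ} (hz : ‖z‖ ≤ 1) : 1 + (t₁ : ℂ) * z + (t₂ : ℂ) * z ^ 2 ≠ 0 := by
  intro h0
  have h3 : ‖(t₁ : ℂ) * z + (t₂ : ℂ) * z ^ 2‖ ≤ t₁ + t₂ := by
    refine (norm_add_le _ _).trans (add_le_add ?_ ?_)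
    · rw [norm_mul, Complex.norm_real, Real.norm_of_nonneg h₁]
      exact mul_le_of_le_one_right h₁ hz
    · rw [norm_mul, norm_pow, Complex.norm_real, Real.norm_of_nonneg h₂]
      exact mul_le_of_le_one_right h₂ (pow_le_one₀ (norm_nonneg _) hz)
  have h4 : (t₁ : ℂ) * z + (t₂ : ℂ) * z ^ 2 = -1 := by linear_combination h0
  rw [h4, norm_neg, norm_one] at h3
  linarith

/-- The constants `t₁`, `t₂` of the case `p - q = 3` and the variance factor `U` solve the spectral
equations `U t₂ = 1`, `U t₁ (1 + t₂) = 26`, `U (1 + t₁ ^ 2 + t₂ ^ 2) = 66`. -/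
lemma quadratic_constants {t₁ t₂ U : ℝ} (ht₂ : t₂ = 2 * (8 + √30) - √(375 + 64 * √30))
    (ht₁ : t₁ = 26 * t₂ / (1 + t₂)) (hU : U = 2 * (8 + √30) + √(375 + 64 * √30)) :
    0 ≤ t₁ ∧ 0 ≤ t₂ ∧ t₁ + t₂ < 1 ∧ t₁ = 13 - √(135 + 4 * √30) ∧
      U * t₂ = 1 ∧ U * (t₁ * (1 + t₂)) = 26 ∧ U * (1 + t₁ ^ 2 + t₂ ^ 2) = 66 := by
  have hs : √30 ^ 2 = 30 := Real.sq_sqrt (by norm_num)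
  have hs5 : 5 < √30 := Real.lt_sqrt_of_sq_lt (by norm_num)
  have hu : √(375 + 64 * √30) ^ 2 = 375 + 64 * √30 := Real.sq_sqrt (by positivity)
  have hu5 : 26 < √(375 + 64 * √30) := Real.lt_sqrt_of_sq_lt (by linarith)
  set s := √30
  set u := √(375 + 64 * s)
  have h1 : U * t₂ = 1 := by rw [hU, ht₂]; linear_combination 4 * hs - hu
  have hadd : t₂ + U = 32 + 4 * s := by rw [hU, ht₂]; ring
  have hU52 : 52 < U := by rw [hU]; linarith
  have hpos : 0 < t₂ := by
    by_contra hn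
    nlinarith
  have hlt : t₂ < 1 / 52 := by
    by_contra hn
    nlinarith
  have hd : 0 < 1 + t₂ := by linarith
  have ht₁' : t₁ * (1 + t₂) = 26 * t₂ := by rw [ht₁]; field_simp
  have hpos₁ : 0 ≤ t₁ := by rw [ht₁]; positivity
  have hlt₁ : t₁ < 1 / 2 := by
    by_contra hn
    nlinarith
  have hquad : t₂ ^ 2 = (32 + 4 * s) * t₂ - 1 := by linear_combination t₂ * hadd - h1
  have hroot : √(135 + 4 * s) = 13 - t₁ := by
    have h : 13 - t₁ = 13 * (1 - t₂) / (1 + t₂) := by rw [ht₁]; field_simp; ring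
    rw [Real.sqrt_eq_iff_mul_self_eq (by positivity) (by linarith), h]
    field_simp
    linear_combination -(34 - 4 * s) * hquad + 16 * t₂ * hs
  refine ⟨hpos₁, hpos.le, by linarith, by linarith, h1, by rw [ht₁']; linarith, ?_⟩
  have hsq : U * t₁ ^ 2 = 34 - 4 * s := by
    have h : U * t₁ ^ 2 * (1 + t₂) ^ 2 = (34 - 4 * s) * (1 + t₂) ^ 2 := by
      linear_combination U * (t₁ * (1 + t₂) + 26 * t₂) * ht₁' + 676 * t₂ * h1
        - (34 - 4 * s) * hquad + 16 * t₂ * hs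
    exact mul_right_cancel₀ (by positivity) h
  linear_combination hsq + hadd + t₂ * h1

theorem corollary3p4 {Ω : Type*} [MeasurableSpace Ω] (μ : Measure Ω) [IsProbabilityMeasure μ]
    (σ : ℝ) (hσ : 0 < σ) (L : ℝ → Ω → ℝ) (hL : IsSecondOrderLevy μ σ L)
    (p q : ℕ) (hqp : q < p) (a b : ℝ[X])
    (ha : a.Monic) (hap : a.natDegree = p) (hb : b.Monic) (hbq : b.natDegree = q)
    (hstable : ∀ z : ℂ, aeval z a = 0 → z.re < 0)
    (hcoprime : ∀ z : ℂ, aeval z a = 0 → aeval z b ≠ 0)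
    (Y : ℝ → Ω → ℝ) (hY : IsCARMA μ p a b L Y) :
    -- the moving average representation exists for every sampling interval
    (∀ Δ : ℝ, 0 < Δ → ∃ (θ : ℝ[X]) (v : ℝ) (Z : ℤ → Ω → ℝ),
      IsMARepresentation μ (p - 1) (filteredSample a Y Δ) θ v Z) ∧
    -- and every such representation has the stated asymptotic form
    ∀ (θ : ℝ → ℝ[X]) (v : ℝ → ℝ) (Z : ℝ → ℤ → Ω → ℝ),
      (∀ Δ : ℝ, 0 < Δ →
        IsMARepresentation μ (p - 1) (filteredSample a Y Δ) (θ Δ) (v Δ) (Z Δ)) →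
      (p = q + 1 →
        HasAsymptoticForm μ (filteredSample a Y) θ v Z
          ((1 - X) ^ q) (fun Δ => σ ^ 2 * Δ)) ∧
      (p = q + 2 → ∀ t : ℝ, t = 2 - √3 →
        (∀ z : ℂ, ‖z‖ ≤ 1 → 1 + (t : ℂ) * z ≠ 0) ∧
        HasAsymptoticForm μ (filteredSample a Y) θ v Z
          ((1 + C t * X) * (1 - X) ^ q) (fun Δ => σ ^ 2 * Δ ^ 3 * (2 + √3) / 6)) ∧
      (p = q + 3 → ∀ t₁ t₂ : ℝ,
        t₂ = 2 * (8 + √30) - √(375 + 64 * √30) →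
        t₁ = 26 * t₂ / (1 + t₂) →
        t₁ = 13 - √(135 + 4 * √30) ∧
        (∀ z : ℂ, ‖z‖ ≤ 1 → 1 + (t₁ : ℂ) * z + (t₂ : ℂ) * z ^ 2 ≠ 0) ∧
        HasAsymptoticForm μ (filteredSample a Y) θ v Z
          ((1 + C t₁ * X + C t₂ * X ^ 2) * (1 - X) ^ q)
          (fun Δ => (2 * (8 + √30) + √(375 + 64 * √30)) * Δ ^ 5 * σ ^ 2 / 120)) := by
  refine ⟨fun Δ hΔ => hY.exists_isMARepresentation hL (by omega) ha hap hΔ,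
    fun θ v Z h => ⟨?_, ?_, ?_⟩⟩
  · rintro rfl
    have := hY.hasAsymptoticForm hσ hL (q := q) (r := 0) ha hap hb hbq (N := fun _ => 1) (ϑ := 1)
      (τ := 1) (by simp) generating_one one_pos (by simp) (by simp) (by simp) h
    simpa using this
  · rintro rfl t rfl
    have h3 : √3 ^ 2 = 3 := Real.sq_sqrt (by norm_num)
    have h3' : √3 < 2 := by nlinarith [Real.sqrt_nonneg 3]
    have h3'' : 1 < √3 := by nlinarith [Real.sqrt_nonneg 3]
    have hne : ∀ z : ℂ, ‖z‖ ≤ 1 → 1 + ((2 - √3 : ℝ) : ℂ) * z ≠ 0 := by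
      intro z hz
      have := one_add_mul_add_mul_sq_ne_zero (t₁ := 2 - √3) (t₂ := 0) (by linarith) le_rfl
        (by linarith) hz
      simpa using this
    refine ⟨hne, ?_⟩
    have := hY.hasAsymptoticForm hσ hL (q := q) (r := 1) ha hap hb hbq (N := linearSpline)
      (ϑ := 1 + C (2 - √3) * X) (τ := (2 + √3) / 6)
      (fun x => by unfold linearSpline; compute_degree) generating_linearSpline
      (by positivity) (by simp) (fun z hz => by simpa using hne z hz.le) (fun z hz => by
        have hc : (√3 : ℂ) ^ 2 = 3 := by exact_mod_cast h3
        rw [integral_linearSpline hz]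
        simp
        field_simp
        linear_combination (3 + 3 * z ^ 2 + 6 * z - 3 * √3 * z) * hc) h
    convert this using 2 with Δ
    ring
  · rintro rfl t₁ t₂ ht₂ ht₁
    obtain ⟨h₁, h₂, hlt, hroot, hU, hU₁, hU₂⟩ := quadratic_constants ht₂ ht₁ rfl
    set U := 2 * (8 + √30) + √(375 + 64 * √30) with hUdef
    have hne : ∀ z : ℂ, ‖z‖ ≤ 1 → 1 + (t₁ : ℂ) * z + (t₂ : ℂ) * z ^ 2 ≠ 0 := fun z hz =>
      one_add_mul_add_mul_sq_ne_zero h₁ h₂ hlt hz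
    refine ⟨hroot, hne, ?_⟩
    have := hY.hasAsymptoticForm hσ hL (q := q) (r := 2) ha hap hb hbq (N := quadraticSpline)
      (ϑ := 1 + C t₁ * X + C t₂ * X ^ 2) (τ := U / 120)
      (fun x => by unfold quadraticSpline; compute_degree) generating_quadraticSpline
      (by positivity) (by simp) (fun z hz => by simpa using hne z hz.le) (fun z hz => by
        have hc : (U : ℂ) * t₂ = 1 := by exact_mod_cast hU
        have hc₁ : (U : ℂ) * (t₁ * (1 + t₂)) = 26 := by exact_mod_cast hU₁
        have hc₂ : (U : ℂ) * (1 + t₁ ^ 2 + t₂ ^ 2) = 66 := by exact_mod_cast hU₂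
        have hz' : z⁻¹ * z = 1 := inv_mul_cancel₀ hz
        rw [integral_quadraticSpline hz]
        simp only [map_add, map_mul, map_one, map_pow, aeval_X, aeval_C, Complex.coe_algebraMap,
          Complex.ofReal_div, Complex.ofReal_ofNat]
        linear_combination (-(1 : ℂ) / 120) * hc₂ - (z + z⁻¹) / 120 * hc₁
          - (z ^ 2 + z⁻¹ ^ 2) / 120 * hc - (U : ℂ) / 120 * (t₁ ^ 2 + t₁ * t₂ * (z + z⁻¹)
            + t₂ ^ 2 * (z⁻¹ * z + 1)) * hz') h
    convert this using 2 with Δ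
    ring
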